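/- Let $\ell>0$ and let $\Omega\subset\mathbb{R}^2$ be the interior of an equilateral triangle with sides of length $\ell$. A Laplace eigenfunction with eigenvalue $\lambda$ is a function $u\in H^2(\Omega)$ with $\Delta u+\lambda u=0$ in $\Omega$ which satisfies, in the usual weak sense, either the Dirichlet condition $u=0$ on $\partial\Omega$ or the Neumann condition $\partial_\nu u=0$ on $\partial\Omega$. Let $\lambda_1\le\lambda_2\le\dots$ be the Dirichlet eigenvalues and $\mu_0\le\mu_1\le\dots$ the Neumann eigenvalues, each repeated according to its multiplicity, and let $$H^D(t)=\sum_{k\ge1}e^{-\lambda_k t},\qquad H^N(t)=\sum_{k\ge0}e^{-\mu_k t}$$ be the Dirichlet and Neumann heat traces. Both are finite for every $t>0$, and as $t\to0^+$ $$H^D(t)=\frac{\ell^2\sqrt3}{16\pi t}-\frac{3\ell}{8\sqrt{\pi t}}+\frac13-\frac{3\ell}{4\sqrt{\pi t}}\,e^{-\frac{9\ell^2}{16t}}+\frac{3\ell^2\sqrt3}{8\pi t}\,e^{-\frac{3\ell^2}{4t}}+\mathcal O\!\left(t^{-1}e^{-\frac{9\ell^2}{4t}}\right),$$ $$H^N(t)=\frac{\ell^2\sqrt3}{16\pi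 t}+\frac{3\ell}{8\sqrt{\pi t}}+\frac13+\frac{3\ell}{4\sqrt{\pi t}}\,e^{-\frac{9\ell^2}{16t}}+\frac{3\ell^2\sqrt3}{8\pi t}\,e^{-\frac{3\ell^2}{4t}}+\mathcal O\!\left(t^{-1}e^{-\frac{9\ell^2}{4t}}\right).$$ The remainders are sharp: each remainder is, in absolute value, also bounded below by a positive constant times $t^{-1}e^{-9\ell^2/(4t)}$ for all sufficiently small $t>0$, and $\frac{9\ell^2}{4}$ is the supremum of all $c>0$ such that the remainder is $\mathcal O(e^{-c/t})$ as $t\to0^+$. -/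

import Mathlib

open MeasureTheory Filter Topology Asymptotics
open scoped ENNReal ContDiff Gradient

noncomputable section

/-- The Euclidean plane. -/
abbrev Plane : Type := EuclideanSpace ℝ (Fin 2)

/-- `L²(Ω; F)` with respect to Lebesgue measure. -/
abbrev L2 (Ω : Set Plane) (F : Type) [NormedAddCommGroup F] : Type :=
  Lp F 2 (volume.restrict Ω)

/-- `ψ ∈ C_c^∞(Ω)`. -/
structure IsTestFunction (Ω : Set Plane) (ψ : Plane → ℝ) : Prop where
  contDiff : ContDiff ℝ ∞ ψ
  hasCompactSupport : HasCompactSupport ψ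
  tsupport_subset : tsupport ψ ⊆ Ω

/-- `G` is the weak (distributional) gradient of `u` in `Ω`. -/
def IsWeakGradient (Ω : Set Plane) (u : L2 Ω ℝ) (G : L2 Ω Plane) : Prop :=
  ∀ ψ : Plane → ℝ, IsTestFunction Ω ψ →
    ∫ x in Ω, u x • ∇ ψ x = -∫ x in Ω, ψ x • G x

theorem IsTestFunction.continuous_gradient {Ω : Set Plane} {ψ : Plane → ℝ}
    (h : IsTestFunction Ω ψ) : Continuous (∇ ψ) :=
  (InnerProductSpace.toDual ℝ Plane).symm.continuous.comp
    (h.contDiff.continuous_fderiv (by simp))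

theorem IsTestFunction.hasCompactSupport_gradient {Ω : Set Plane} {ψ : Plane → ℝ}
    (h : IsTestFunction Ω ψ) : HasCompactSupport (∇ ψ) :=
  (h.hasCompactSupport.fderiv (𝕜 := ℝ)).comp_left (map_zero _)

theorem IsTestFunction.integrable_smul_gradient {Ω : Set Plane} {ψ : Plane → ℝ}
    (h : IsTestFunction Ω ψ) (u : L2 Ω ℝ) :
    Integrable (fun x => u x • ∇ ψ x) (volume.restrict Ω) :=
  memLp_one_iff_integrable.1 <| MemLp.smul (p := 2) (q := 2)
    ((h.continuous_gradient.memLp_of_hasCompactSupport h.hasCompactSupport_gradient).restrict Ω)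
    (Lp.memLp u)

theorem IsTestFunction.integrable_smul {Ω : Set Plane} {ψ : Plane → ℝ}
    (h : IsTestFunction Ω ψ) (G : L2 Ω Plane) :
    Integrable (fun x => ψ x • G x) (volume.restrict Ω) :=
  memLp_one_iff_integrable.1 <| MemLp.smul (p := 2) (q := 2) (Lp.memLp G)
    ((h.contDiff.continuous.memLp_of_hasCompactSupport h.hasCompactSupport).restrict Ω)

/-- The Sobolev space `H¹(Ω)`, as the space of all pairs `(u, ∇u)` with `u` in `L²(Ω)` and weak
gradient `∇u` in `L²(Ω)`. -/
def sobolevH1 (Ω : Set Plane) : Submodule ℝ (L2 Ω ℝ × L2 Ω Plane) where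
  carrier := {p | IsWeakGradient Ω p.1 p.2}
  zero_mem' := by
    intro ψ hψ
    have h1 : ∀ᵐ x ∂(volume.restrict Ω), (0 : L2 Ω ℝ) x • ∇ ψ x = 0 := by
      filter_upwards [Lp.coeFn_zero ℝ 2 (volume.restrict Ω)] with x hx
      rw [hx, Pi.zero_apply, zero_smul]
    have h2 : ∀ᵐ x ∂(volume.restrict Ω), ψ x • (0 : L2 Ω Plane) x = 0 := by
      filter_upwards [Lp.coeFn_zero Plane 2 (volume.restrict Ω)] with x hx
      rw [hx, Pi.zero_apply, smul_zero]
    simp only [Prod.fst_zero, Prod.snd_zero]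
    rw [integral_eq_zero_of_ae h1, integral_eq_zero_of_ae h2, neg_zero]
  add_mem' := by
    rintro ⟨u, G⟩ ⟨v, H⟩ hu hv ψ hψ
    have h1 : ∀ᵐ x ∂(volume.restrict Ω),
        (u + v) x • ∇ ψ x = u x • ∇ ψ x + v x • ∇ ψ x := by
      filter_upwards [Lp.coeFn_add u v] with x hx
      rw [hx, Pi.add_apply, add_smul]
    have h2 : ∀ᵐ x ∂(volume.restrict Ω), ψ x • (G + H) x = ψ x • G x + ψ x • H x := by
      filter_upwards [Lp.coeFn_add G H] with x hx
      rw [hx, Pi.add_apply, smul_add]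
    have hu' := hu ψ hψ
    have hv' := hv ψ hψ
    simp only [Prod.mk_add_mk] at hu' hv' ⊢
    rw [integral_congr_ae h1, integral_congr_ae h2,
      integral_add (hψ.integrable_smul_gradient u) (hψ.integrable_smul_gradient v),
      integral_add (hψ.integrable_smul G) (hψ.integrable_smul H), hu', hv', neg_add]
  smul_mem' := by
    rintro c ⟨u, G⟩ hu ψ hψ
    have h1 : ∀ᵐ x ∂(volume.restrict Ω), (c • u) x • ∇ ψ x = c • (u x • ∇ ψ x) := by
      filter_upwards [Lp.coeFn_smul c u] with x hx
      rw [hx, Pi.smul_apply, smul_assoc]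
    have h2 : ∀ᵐ x ∂(volume.restrict Ω), ψ x • (c • G) x = c • (ψ x • G x) := by
      filter_upwards [Lp.coeFn_smul c G] with x hx
      rw [hx, Pi.smul_apply, smul_comm]
    have hu' := hu ψ hψ
    simp only [Prod.smul_mk] at hu' ⊢
    rw [integral_congr_ae h1, integral_congr_ae h2, integral_smul, integral_smul, hu', smul_neg]

/-- The Sobolev space `H¹₀(Ω)`: the closure of `C_c^∞(Ω)` in the `H¹` norm, again as a space of
pairs `(u, ∇u)`. -/
def sobolevH10 (Ω : Set Plane) : Submodule ℝ (L2 Ω ℝ × L2 Ω Plane) :=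
  (Submodule.span ℝ {p : L2 Ω ℝ × L2 Ω Plane | ∃ ψ : Plane → ℝ, IsTestFunction Ω ψ ∧
    p.1 =ᵐ[volume.restrict Ω] ψ ∧ p.2 =ᵐ[volume.restrict Ω] ∇ ψ}).topologicalClosure

/-- The pair `(u, ∇u)` belongs to `H²(Ω)`: it is in `H¹(Ω)`, and so is the derivative of `u` in
every direction `e`. -/
def IsSobolevH2 {Ω : Set Plane} (p : L2 Ω ℝ × L2 Ω Plane) : Prop :=
  p ∈ sobolevH1 Ω ∧ ∀ e : Plane, ∃ q ∈ sobolevH1 Ω,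
    q.1 =ᵐ[volume.restrict Ω] fun x => inner ℝ e (p.2 x)

theorem IsSobolevH2.add {Ω : Set Plane} {p q : L2 Ω ℝ × L2 Ω Plane}
    (hp : IsSobolevH2 p) (hq : IsSobolevH2 q) : IsSobolevH2 (p + q) := by
  refine ⟨add_mem hp.1 hq.1, fun e => ?_⟩
  obtain ⟨r, hr, hr'⟩ := hp.2 e
  obtain ⟨s, hs, hs'⟩ := hq.2 e
  refine ⟨r + s, add_mem hr hs, ?_⟩
  filter_upwards [hr', hs', Lp.coeFn_add r.1 s.1, Lp.coeFn_add p.2 q.2] with x h1 h2 h3 h4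
  rw [Prod.fst_add, Prod.snd_add, h3, h4, Pi.add_apply, Pi.add_apply, h1, h2, inner_add_right]

theorem IsSobolevH2.smul {Ω : Set Plane} {p : L2 Ω ℝ × L2 Ω Plane} (c : ℝ)
    (hp : IsSobolevH2 p) : IsSobolevH2 (c • p) := by
  refine ⟨Submodule.smul_mem _ c hp.1, fun e => ?_⟩
  obtain ⟨r, hr, hr'⟩ := hp.2 e
  refine ⟨c • r, Submodule.smul_mem _ c hr, ?_⟩
  filter_upwards [hr', Lp.coeFn_smul c r.1, Lp.coeFn_smul c p.2] with x h1 h3 h4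
  rw [Prod.smul_fst, Prod.smul_snd, h3, h4, Pi.smul_apply, Pi.smul_apply, h1, inner_smul_right,
    smul_eq_mul]

theorem isSobolevH2_zero {Ω : Set Plane} : IsSobolevH2 (0 : L2 Ω ℝ × L2 Ω Plane) := by
  refine ⟨zero_mem _, fun e => ⟨0, zero_mem _, ?_⟩⟩
  filter_upwards [Lp.coeFn_zero ℝ 2 (volume.restrict Ω),
    Lp.coeFn_zero Plane 2 (volume.restrict Ω)] with x h1 h2
  rw [Prod.fst_zero, Prod.snd_zero, h1, h2, Pi.zero_apply, Pi.zero_apply, inner_zero_right]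

/-- The space of all `u ∈ H²(Ω)` that satisfy `Δu + lam u = 0` in `Ω` and the boundary condition
encoded by the form domain `V`: `u ∈ V` and `∫ ∇u · ∇v = lam ∫ u v` for all `v ∈ V`.
Taking `V = H¹₀(Ω)` gives the Dirichlet condition, and `V = H¹(Ω)` the Neumann condition. -/
def laplaceEigenspace {Ω : Set Plane} (V : Submodule ℝ (L2 Ω ℝ × L2 Ω Plane)) (lam : ℝ) :
    Submodule ℝ (L2 Ω ℝ) where
  carrier := {u | ∃ G : L2 Ω Plane, (u, G) ∈ V ∧ IsSobolevH2 (u, G) ∧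
    ∀ q ∈ V, inner ℝ G q.2 = lam * inner ℝ u q.1}
  zero_mem' := ⟨0, zero_mem _, isSobolevH2_zero, fun q _ => by simp⟩
  add_mem' := by
    rintro u v ⟨G, hG, hG2, hG'⟩ ⟨H, hH, hH2, hH'⟩
    exact ⟨G + H, add_mem hG hH, hG2.add hH2, fun q hq => by
      rw [inner_add_left, inner_add_left, hG' q hq, hH' q hq, mul_add]⟩
  smul_mem' := by
    rintro c u ⟨G, hG, hG2, hG'⟩
    exact ⟨c • G, Submodule.smul_mem _ c hG, hG2.smul c, fun q hq => by
      rw [real_inner_smul_left, real_inner_smul_left, hG' q hq]; ring⟩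

/-- `∑ₖ exp (-lamₖ t)`, the sum over the Laplace eigenvalues, each repeated according to its
multiplicity (the dimension of the eigenspace). It takes the value `∞` if the sum diverges or if
an eigenspace has infinite dimension. -/
def heatTrace {Ω : Set Plane} (V : Submodule ℝ (L2 Ω ℝ × L2 Ω Plane)) (t : ℝ) : ℝ≥0∞ :=
  ∑' lam : ℝ, (Cardinal.toENat (Module.rank ℝ (laplaceEigenspace V lam)) : ℝ≥0∞) *
    ENNReal.ofReal (Real.exp (-lam * t))

/-- The Dirichlet heat trace of `Ω`. -/
def dirichletHeatTrace (Ω : Set Plane) (t : ℝ) : ℝ≥0∞ := heatTrace (sobolevH10 Ω) t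

/-- The Neumann heat trace of `Ω`. -/
def neumannHeatTrace (Ω : Set Plane) (t : ℝ) : ℝ≥0∞ := heatTrace (sobolevH1 Ω) t

/-- The open triangle with vertices `A`, `B`, `C`. -/
def openTriangle (A B C : Plane) : Set Plane := interior (convexHull ℝ {A, B, C})

/-- The explicit terms of the expansion of the Dirichlet heat trace. -/
def dirichletExpansion (ℓ t : ℝ) : ℝ :=
  ℓ ^ 2 * √3 / (16 * Real.pi * t) - 3 * ℓ / (8 * √(Real.pi * t)) + 1 / 3
    - 3 * ℓ / (4 * √(Real.pi * t)) * Real.exp (-(9 * ℓ ^ 2) / (16 * t))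
    + 3 * ℓ ^ 2 * √3 / (8 * Real.pi * t) * Real.exp (-(3 * ℓ ^ 2) / (4 * t))

/-- The explicit terms of the expansion of the Neumann heat trace. -/
def neumannExpansion (ℓ t : ℝ) : ℝ :=
  ℓ ^ 2 * √3 / (16 * Real.pi * t) + 3 * ℓ / (8 * √(Real.pi * t)) + 1 / 3
    + 3 * ℓ / (4 * √(Real.pi * t)) * Real.exp (-(9 * ℓ ^ 2) / (16 * t))
    + 3 * ℓ ^ 2 * √3 / (8 * Real.pi * t) * Real.exp (-(3 * ℓ ^ 2) / (4 * t))

/-- The remainder `R` is `O(t⁻¹ exp (-c / t))` as `t → 0⁺`, and this is sharp: `R` is also bounded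
below by a positive multiple of `t⁻¹ exp (-c / t)`, and `c` is the optimal exponential rate. -/
def IsSharpRemainder (R : ℝ → ℝ) (c : ℝ) : Prop :=
  R =O[𝓝[>] 0] (fun t => t⁻¹ * Real.exp (-c / t)) ∧
  (fun t => t⁻¹ * Real.exp (-c / t)) =O[𝓝[>] 0] R ∧
  IsLUB {b : ℝ | 0 < b ∧ R =O[𝓝[>] 0] (fun t => Real.exp (-b / t))} c

end

/-!
The eigenfunctions of an equilateral triangle can be written down, and their eigenvalues turn the
heat traces into theta series.

**Angles.** In terms of three angles `α₀`, `α₁`, `α₂` with sum zero, affine functions whose linear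
parts are multiples of the oriented sides (`sideFrame`, `IsA2Frame`), the triangle is a fundamental
alcove of the affine Weyl group of type `A₂` (`openTriangle_eq_alcove`). The plane waves attached to
the weights `(m, n)`, summed over the symmetric group on the three angles with or without signs
(`planeWave`), satisfy the Neumann or the Dirichlet condition on the walls and have the eigenvalue
`q (m² + m n + n²)` with `q = 16 π² / (9 ℓ²)`. That the conditions hold weakly is checked with
cutoff functions: at each wall the boundary terms cancel in pairs (`exists_bound_sum_cas_phase`),
whence `restrictL2_mem_neumannEigenspace` and `restrictL2_mem_dirichletEigenspace`.

**Completeness.** The symmetric waves span an algebra that separates the points of the closed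
alcove, so by the Stone–Weierstrass theorem nothing in `L²` is orthogonal to all of them; the
antisymmetric ones are handled through division by the Weyl denominator, which does not vanish
inside (`IsA2Frame.ae_eq_zero_of_integral_planeWave`). Orthogonality follows from the product
formula and the vanishing means. As eigenfunctions with different eigenvalues are orthogonal, each
eigenspace is spanned by the waves it contains (`laplaceEigenspace_eq_span`), and the heat trace is
the sum of `exp (-λ t)` over the waves (`heatTrace_eq_tsum`). Neither the spectral theorem for the
Laplacian nor elliptic regularity is needed.

**Theta series.** The Dirichlet waves are indexed by the interior of a sector of the hexagonal
lattice, the Neumann waves by the closed sector. Six open sectors, six open rays and the origin make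
up the whole lattice (`hexSum_eq_sectors`), which in turn is the disjoint union of a rectangular
lattice and a translate of it (`hexSum_eq`). Jacobi's transformation formula (`thetaNome_exp_neg`)
then expresses the traces through theta series in `x = exp (-3 ℓ² / (16 t))`, which tends to zero
with `t`. The explicit terms of the expansion are those of degree at most four, and the next ones
have degree twelve (`tendsto_hexNome`, `tendsto_theta_cube`). Among these the term from the
hexagonal lattice carries the factor `t⁻¹` and dominates the one from the boundary rays, which
carries `t^(-1/2)`; its coefficient is not zero, so the remainder is sharp
(`isSharpRemainder_of_tendsto`).
-/

/-! ### Smooth functions as elements of `L²` and of the Sobolev spaces -/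

/-- The class in `L²(Ω; F)` of a function on the plane; it is `0` if the function is not square
integrable on `Ω`. -/
noncomputable def restrictL2 (Ω : Set Plane) {F : Type} [NormedAddCommGroup F] (f : Plane → F) :
    L2 Ω F :=
  open Classical in if h : MemLp f 2 (volume.restrict Ω) then h.toLp f else 0

section restrictL2

variable {Ω : Set Plane} {F : Type} [NormedAddCommGroup F]

theorem Bornology.IsBounded.isFiniteMeasure_restrict (hΩ : Bornology.IsBounded Ω) :
    IsFiniteMeasure ((volume : Measure Plane).restrict Ω) :=
  ⟨by simpa using hΩ.measure_lt_top⟩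

theorem Continuous.exists_bound_of_isBounded (hΩ : Bornology.IsBounded Ω) {f : Plane → F}
    (hf : Continuous f) : ∃ C, 0 ≤ C ∧ ∀ x ∈ Ω, ‖f x‖ ≤ C := by
  obtain ⟨C, hC⟩ := hΩ.isCompact_closure.exists_bound_of_continuousOn hf.continuousOn
  exact ⟨max C 0, le_max_right _ _, fun x hx => (hC x (subset_closure hx)).trans (le_max_left _ _)⟩

theorem Continuous.memLp_of_isBounded [SecondCountableTopologyEither Plane F]
    (hΩ : Bornology.IsBounded Ω) (hm : MeasurableSet Ω) {f : Plane → F} (hf : Continuous f) :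
    MemLp f 2 (volume.restrict Ω) := by
  have := hΩ.isFiniteMeasure_restrict
  obtain ⟨C, -, hC⟩ := hf.exists_bound_of_isBounded hΩ
  exact MemLp.of_bound hf.aestronglyMeasurable C ((ae_restrict_iff' hm).2 (ae_of_all _ hC))

theorem restrictL2_ae_eq [SecondCountableTopologyEither Plane F] (hΩ : Bornology.IsBounded Ω)
    (hm : MeasurableSet Ω) {f : Plane → F} (hf : Continuous f) :
    restrictL2 Ω f =ᵐ[volume.restrict Ω] f := by
  rw [restrictL2, dif_pos (hf.memLp_of_isBounded hΩ hm)]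
  exact MemLp.coeFn_toLp _

theorem integrable_of_L2 (hΩ : Bornology.IsBounded Ω) (u : L2 Ω F) :
    Integrable u (volume.restrict Ω) := by
  have := hΩ.isFiniteMeasure_restrict
  exact (Lp.memLp u).integrable one_le_two

theorem inner_restrictL2 [InnerProductSpace ℝ F] [SecondCountableTopologyEither Plane F]
    (hΩ : Bornology.IsBounded Ω) (hm : MeasurableSet Ω) {f : Plane → F} (hf : Continuous f)
    (u : L2 Ω F) : inner ℝ (restrictL2 Ω f) u = ∫ x in Ω, inner ℝ (f x) (u x) := by
  rw [L2.inner_def]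
  refine integral_congr_ae ?_
  filter_upwards [restrictL2_ae_eq hΩ hm hf] with x hx
  rw [hx]

/-- Dominated convergence in `L²(Ω)` for a uniformly bounded sequence of continuous functions. -/
theorem tendsto_restrictL2 [InnerProductSpace ℝ F] [SecondCountableTopologyEither Plane F]
    (hΩ : Bornology.IsBounded Ω)
    (hm : MeasurableSet Ω) {f : ℕ → Plane → F} {g : Plane → F} (hf : ∀ n, Continuous (f n))
    (hg : Continuous g) {C : ℝ} (hC : ∀ n, ∀ x ∈ Ω, ‖f n x‖ ≤ C)
    (hlim : ∀ x ∈ Ω, Tendsto (fun n => f n x) atTop (𝓝 (g x))) :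
    Tendsto (fun n => restrictL2 Ω (f n)) atTop (𝓝 (restrictL2 Ω g)) := by
  have := hΩ.isFiniteMeasure_restrict
  obtain ⟨D, hD0, hD⟩ := hg.exists_bound_of_isBounded hΩ
  rw [tendsto_iff_norm_sub_tendsto_zero]
  have key : Tendsto (fun n => ∫ x in Ω, ‖f n x - g x‖ ^ 2) atTop (𝓝 (∫ x in Ω, (0 : ℝ))) := by
    refine tendsto_integral_of_dominated_convergence (fun _ => (C + D) ^ 2)
      (fun n => ?_) (integrable_const _) (fun n => ?_) ?_
    · exact (((hf n).sub hg).norm.pow 2).aestronglyMeasurable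
    · refine (ae_restrict_iff' hm).2 (ae_of_all _ fun x hx => ?_)
      rw [Real.norm_of_nonneg (by positivity)]
      gcongr
      exact (norm_sub_le _ _).trans (add_le_add (hC n x hx) (hD x hx))
    · refine (ae_restrict_iff' hm).2 (ae_of_all _ fun x hx => ?_)
      have := ((tendsto_iff_norm_sub_tendsto_zero.1 (hlim x hx)).pow 2)
      simpa using this
  have hnorm : ∀ n, ‖restrictL2 Ω (f n) - restrictL2 Ω g‖ ^ 2 = ∫ x in Ω, ‖f n x - g x‖ ^ 2 := by
    intro n
    rw [← real_inner_self_eq_norm_sq, L2.inner_def]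
    refine integral_congr_ae ?_
    filter_upwards [restrictL2_ae_eq hΩ hm (hf n), restrictL2_ae_eq hΩ hm hg,
      Lp.coeFn_sub (restrictL2 Ω (f n)) (restrictL2 Ω g)] with x h1 h2 h3
    rw [h3, Pi.sub_apply, h1, h2, real_inner_self_eq_norm_sq]
  have h2 : Tendsto (fun n => √(‖restrictL2 Ω (f n) - restrictL2 Ω g‖ ^ 2)) atTop (𝓝 (√0)) := by
    refine Tendsto.sqrt ?_
    simp_rw [hnorm]
    simpa using key
  simpa [Real.sqrt_sq (norm_nonneg _)] using h2

end restrictL2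

section smooth

variable {Ω : Set Plane} {f : Plane → ℝ}

theorem ContDiff.gradient (hf : ContDiff ℝ ∞ f) : ContDiff ℝ ∞ (∇ f) :=
  (InnerProductSpace.toDual ℝ Plane).symm.contDiff.comp (hf.fderiv_right (by simp))

theorem ContDiff.continuous_gradient (hf : ContDiff ℝ ∞ f) : Continuous (∇ f) :=
  hf.gradient.continuous

theorem gradient_mul {f g : Plane → ℝ} {x : Plane} (hf : DifferentiableAt ℝ f x)
    (hg : DifferentiableAt ℝ g x) : ∇ (fun y => f y * g y) x = f x • ∇ g x + g x • ∇ f x := by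
  refine ext_inner_right ℝ fun v => ?_
  rw [inner_add_left, real_inner_smul_left, real_inner_smul_left,
    inner_gradient_left, inner_gradient_left, inner_gradient_left,
    fderiv_fun_mul hf hg]
  simp

/-- Integration by parts against a test function. -/
theorem IsTestFunction.integral_smul_gradient {ψ : Plane → ℝ} (hψ : IsTestFunction Ω ψ)
    (hf : ContDiff ℝ ∞ f) : ∫ x in Ω, f x • ∇ ψ x = -∫ x in Ω, ψ x • ∇ f x := by
  have h0 : ∀ x, x ∉ Ω → ψ x = 0 := fun x hx =>
    image_eq_zero_of_notMem_tsupport fun h => hx (hψ.tsupport_subset h)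
  have h1 : ∀ x, x ∉ Ω → ∇ ψ x = 0 := by
    intro x hx
    have : fderiv ℝ ψ x = 0 := image_eq_zero_of_notMem_tsupport fun h =>
      hx (hψ.tsupport_subset (tsupport_fderiv_subset ℝ h))
    rw [_root_.gradient, this, map_zero]
  rw [setIntegral_eq_integral_of_forall_compl_eq_zero (fun x hx => by rw [h1 x hx, smul_zero]),
    setIntegral_eq_integral_of_forall_compl_eq_zero (fun x hx => by rw [h0 x hx, zero_smul])]
  have dψ : Differentiable ℝ ψ := hψ.contDiff.differentiable (by simp)
  have df : Differentiable ℝ f := hf.differentiable (by simp)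
  have i1 : Integrable (fun x => f x • ∇ ψ x) :=
    (hf.continuous.smul hψ.continuous_gradient).integrable_of_hasCompactSupport
      hψ.hasCompactSupport_gradient.smul_left
  have i2 : Integrable (fun x => ψ x • ∇ f x) :=
    (hψ.contDiff.continuous.smul hf.continuous_gradient).integrable_of_hasCompactSupport
      hψ.hasCompactSupport.smul_right
  refine ext_inner_left ℝ fun v => ?_
  have e1 : ∀ x, inner ℝ v (f x • ∇ ψ x) = f x * fderiv ℝ ψ x v := fun x => by
    rw [real_inner_smul_right, real_inner_comm, inner_gradient_left]
  have e2 : ∀ x, inner ℝ v (ψ x • ∇ f x) = fderiv ℝ f x v * ψ x := fun x => by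
    rw [real_inner_smul_right, real_inner_comm, inner_gradient_left, mul_comm]
  have j1 := i1.const_inner (𝕜 := ℝ) v
  have j2 := i2.const_inner (𝕜 := ℝ) v
  rw [inner_neg_right, ← integral_inner i1, ← integral_inner i2]
  simp only [e1, e2] at j1 j2 ⊢
  refine integral_mul_fderiv_eq_neg_fderiv_mul_of_integrable j2 j1 ?_ (fun x _ => df x)
    (fun x _ => dψ x)
  exact (hf.continuous.mul hψ.contDiff.continuous).integrable_of_hasCompactSupport
    hψ.hasCompactSupport.mul_left

theorem mem_sobolevH1_of_contDiff (hΩ : Bornology.IsBounded Ω) (hm : MeasurableSet Ω)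
    (hf : ContDiff ℝ ∞ f) : (restrictL2 Ω f, restrictL2 Ω (∇ f)) ∈ sobolevH1 Ω := by
  intro ψ hψ
  have h1 : ∀ᵐ x ∂(volume.restrict Ω), restrictL2 Ω f x • ∇ ψ x = f x • ∇ ψ x := by
    filter_upwards [restrictL2_ae_eq hΩ hm hf.continuous] with x hx
    rw [hx]
  have h2 : ∀ᵐ x ∂(volume.restrict Ω), ψ x • restrictL2 Ω (∇ f) x = ψ x • ∇ f x := by
    filter_upwards [restrictL2_ae_eq hΩ hm hf.continuous_gradient] with x hx
    rw [hx]
  rw [integral_congr_ae h1, integral_congr_ae h2, hψ.integral_smul_gradient hf]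

theorem isSobolevH2_of_contDiff (hΩ : Bornology.IsBounded Ω) (hm : MeasurableSet Ω)
    (hf : ContDiff ℝ ∞ f) : IsSobolevH2 (restrictL2 Ω f, restrictL2 Ω (∇ f)) := by
  refine ⟨mem_sobolevH1_of_contDiff hΩ hm hf, fun e => ?_⟩
  have he : ContDiff ℝ ∞ fun x => inner ℝ e (∇ f x) := contDiff_const.inner ℝ hf.gradient
  refine ⟨_, mem_sobolevH1_of_contDiff hΩ hm he, ?_⟩
  filter_upwards [restrictL2_ae_eq hΩ hm he.continuous,
    restrictL2_ae_eq hΩ hm hf.continuous_gradient] with x h1 h2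
  rw [h1, h2]

end smooth

/-! ### Cutoff functions on convex polygons -/

section polygon

variable {ι : Type} [Fintype ι]

/-- The open convex polygon cut out by the inequalities `0 < c j + ⟪g j, x⟫`. -/
def polygon (c : ι → ℝ) (g : ι → Plane) : Set Plane := {x | ∀ j, 0 < c j + inner ℝ (g j) x}

variable {c : ι → ℝ} {g : ι → Plane}

theorem isOpen_polygon : IsOpen (polygon c g) := by
  simp only [polygon, Set.ofPred_forall]
  exact isOpen_iInter_of_finite fun j => isOpen_lt continuous_const (by fun_prop)

/-- A smooth function which is `1` where all `c j + ⟪g j, x⟫` are at least `2 / n`, and `0` where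
one of them is at most `1 / n`, for `n ≥ 1`. -/
noncomputable def polygonCutoff (c : ι → ℝ) (g : ι → Plane) (n : ℕ) (x : Plane) : ℝ :=
  ∏ j, Real.smoothTransition (n * (c j + inner ℝ (g j) x) - 1)

theorem contDiff_polygonCutoff (n : ℕ) : ContDiff ℝ ∞ (polygonCutoff c g n) := by
  refine contDiff_prod fun j _ => ?_
  have h : ContDiff ℝ ∞ fun x : Plane => n * (c j + inner ℝ (g j) x) - 1 :=
    (contDiff_const.mul (contDiff_const.add (contDiff_const.inner ℝ contDiff_id))).sub
      contDiff_const
  exact Real.smoothTransition.contDiff.comp h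

theorem polygonCutoff_nonneg (n : ℕ) (x : Plane) : 0 ≤ polygonCutoff c g n x :=
  Finset.prod_nonneg fun _ _ => Real.smoothTransition.nonneg _

theorem polygonCutoff_le_one (n : ℕ) (x : Plane) : polygonCutoff c g n x ≤ 1 :=
  Finset.prod_le_one (fun _ _ => Real.smoothTransition.nonneg _)
    fun _ _ => Real.smoothTransition.le_one _

theorem tsupport_polygonCutoff_subset (n : ℕ) : tsupport (polygonCutoff c g n) ⊆ polygon c g := by
  have hcl : IsClosed {x : Plane | ∀ j, 1 ≤ n * (c j + inner ℝ (g j) x)} := by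
    simp only [Set.ofPred_forall]
    exact isClosed_iInter fun j => isClosed_le continuous_const (by fun_prop)
  have h1 : tsupport (polygonCutoff c g n) ⊆
      {x : Plane | ∀ j, 1 ≤ n * (c j + inner ℝ (g j) x)} := by
    refine closure_minimal (fun x hx j => ?_) hcl
    by_contra h
    refine hx (Finset.prod_eq_zero (Finset.mem_univ j)
      (Real.smoothTransition.zero_of_nonpos ?_))
    linarith [not_le.1 h]
  intro x hx j
  have := h1 hx j
  have hn : (0 : ℝ) ≤ n := Nat.cast_nonneg n
  by_contra h
  nlinarith [mul_nonpos_of_nonneg_of_nonpos hn (not_lt.1 h)]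

theorem isTestFunction_polygonCutoff_mul (hb : Bornology.IsBounded (polygon c g)) (n : ℕ)
    {f : Plane → ℝ} (hf : ContDiff ℝ ∞ f) :
    IsTestFunction (polygon c g) fun x => polygonCutoff c g n x * f x := by
  have hs : tsupport (fun x => polygonCutoff c g n x * f x) ⊆ polygon c g :=
    (tsupport_mul_subset_left (f := polygonCutoff c g n) (g := f)).trans
      (tsupport_polygonCutoff_subset n)
  exact ⟨(contDiff_polygonCutoff n).mul hf,
    Metric.isCompact_of_isClosed_isBounded (isClosed_tsupport _) (hb.subset hs), hs⟩

theorem eventually_polygonCutoff_eq_one {x : Plane} (hx : x ∈ polygon c g) :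
    ∀ᶠ n in atTop, polygonCutoff c g n =ᶠ[𝓝 x] fun _ => 1 := by
  have h : ∀ᶠ n : ℕ in atTop, ∀ j, 2 < n * (c j + inner ℝ (g j) x) := by
    rw [eventually_all]
    intro j
    exact (tendsto_natCast_atTop_atTop.atTop_mul_const (hx j)).eventually_gt_atTop 2
  filter_upwards [h] with n hn
  have h2 : ∀ᶠ y in 𝓝 x, ∀ j, 2 < n * (c j + inner ℝ (g j) y) := by
    rw [eventually_all]
    intro j
    have hc : Continuous fun y : Plane => n * (c j + inner ℝ (g j) y) := by fun_prop
    exact hc.continuousAt.eventually (lt_mem_nhds (hn j))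
  filter_upwards [h2] with y hy
  exact Finset.prod_eq_one fun j _ =>
    Real.smoothTransition.one_of_one_le (by linarith [hy j])

theorem tendsto_polygonCutoff {x : Plane} (hx : x ∈ polygon c g) :
    Tendsto (fun n => polygonCutoff c g n x) atTop (𝓝 1) := by
  refine tendsto_const_nhds.congr' ?_
  filter_upwards [eventually_polygonCutoff_eq_one hx] with n hn using hn.eq_of_nhds.symm

theorem tendsto_gradient_polygonCutoff {x : Plane} (hx : x ∈ polygon c g) :
    Tendsto (fun n => ∇ (polygonCutoff c g n) x) atTop (𝓝 0) := by
  refine tendsto_const_nhds.congr' ?_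
  filter_upwards [eventually_polygonCutoff_eq_one hx] with n hn
  rw [hn.gradient_eq, gradient_fun_const]

theorem exists_bound_deriv_smoothTransition :
    ∃ M, 0 ≤ M ∧ ∀ (n : ℕ) (t : ℝ), 0 < t →
      n * |deriv Real.smoothTransition (n * t - 1)| * t ≤ M := by
  have hc : Continuous (deriv Real.smoothTransition) :=
    (Real.smoothTransition.contDiff (n := 1)).continuous_deriv (by simp)
  obtain ⟨M, hM⟩ := (isCompact_Icc (a := (0 : ℝ)) (b := 1)).exists_bound_of_continuousOn
    hc.continuousOn
  have hM0 : 0 ≤ M := (norm_nonneg _).trans (hM 0 (by simp))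
  refine ⟨2 * M, by positivity, fun n t ht => ?_⟩
  have hnt : 0 ≤ (n : ℝ) * t := by positivity
  rcases lt_or_ge ((n : ℝ) * t - 1) 0 with h | h
  · have : deriv Real.smoothTransition (n * t - 1) = 0 := by
      have : Real.smoothTransition =ᶠ[𝓝 ((n : ℝ) * t - 1)] fun _ => 0 := by
        filter_upwards [gt_mem_nhds h] with s hs
        exact Real.smoothTransition.zero_of_nonpos hs.le
      rw [this.deriv_eq, deriv_const]
    rw [this]
    simpa using hM0
  rcases le_or_gt ((n : ℝ) * t - 1) 1 with h' | h'
  · have := hM _ ⟨h, h'⟩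
    rw [Real.norm_eq_abs] at this
    calc n * |deriv Real.smoothTransition (n * t - 1)| * t
        = (n * t) * |deriv Real.smoothTransition (n * t - 1)| := by ring
      _ ≤ 2 * M := by gcongr; linarith
  · have : deriv Real.smoothTransition (n * t - 1) = 0 := by
      have : Real.smoothTransition =ᶠ[𝓝 ((n : ℝ) * t - 1)] fun _ => 1 := by
        filter_upwards [lt_mem_nhds h'] with s hs
        exact Real.smoothTransition.one_of_one_le hs.le
      rw [this.deriv_eq, deriv_const]
    rw [this]
    simpa using hM0

/-- The gradient of the cutoff blows up like `n` in a strip along the boundary, but its product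
with a vector that is nearly tangential to the sides is bounded. -/
theorem exists_bound_inner_gradient_polygonCutoff (c : ι → ℝ) (g : ι → Plane) :
    ∃ M, 0 ≤ M ∧ ∀ (n : ℕ) (C : ℝ) (v : Plane), ∀ x ∈ polygon c g,
      (∀ j, |inner ℝ (g j) v| ≤ C * (c j + inner ℝ (g j) x)) →
      |inner ℝ (∇ (polygonCutoff c g n) x) v| ≤ M * C := by
  classical
  obtain ⟨M, hM0, hM⟩ := exists_bound_deriv_smoothTransition
  refine ⟨Fintype.card ι * M, by positivity, fun n C v x hx hv => ?_⟩
  have hd : ∀ j, HasFDerivAt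
      (fun y : Plane => Real.smoothTransition (n * (c j + inner ℝ (g j) y) - 1))
      (deriv Real.smoothTransition (n * (c j + inner ℝ (g j) x) - 1) •
        ((n : ℝ) • innerSL ℝ (g j))) x := by
    intro j
    have h1 : HasFDerivAt (fun y : Plane => n * (c j + inner ℝ (g j) y) - 1)
        ((n : ℝ) • innerSL ℝ (g j)) x :=
      ((((innerSL ℝ (g j)).hasFDerivAt (x := x)).const_add (c j)).const_mul (n : ℝ)).sub_const 1
    have h2 : DifferentiableAt ℝ Real.smoothTransition (n * (c j + inner ℝ (g j) x) - 1) :=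
      (Real.smoothTransition.contDiff (n := 1)).differentiable (by simp) _
    exact h2.hasDerivAt.comp_hasFDerivAt x h1
  have hp := HasFDerivAt.finsetProd (u := Finset.univ) (x := x) fun j _ => hd j
  rw [inner_gradient_left]
  have : fderiv ℝ (polygonCutoff c g n) x = _ := hp.fderiv
  rw [this, sum_apply]
  refine (Finset.abs_sum_le_sum_abs _ _).trans ?_
  have hterm : ∀ j ∈ (Finset.univ : Finset ι),
      |((∏ i ∈ Finset.univ.erase j, Real.smoothTransition (n * (c i + inner ℝ (g i) x) - 1)) •
        (deriv Real.smoothTransition (n * (c j + inner ℝ (g j) x) - 1) •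
          ((n : ℝ) • innerSL ℝ (g j)))) v| ≤ M * C := by
    intro j _
    have hC : 0 ≤ C := nonneg_of_mul_nonneg_left ((abs_nonneg _).trans (hv j)) (hx j)
    have h1 : |∏ i ∈ Finset.univ.erase j, Real.smoothTransition (n * (c i + inner ℝ (g i) x) - 1)|
        ≤ 1 := by
      rw [abs_of_nonneg (Finset.prod_nonneg fun _ _ => Real.smoothTransition.nonneg _)]
      exact Finset.prod_le_one (fun _ _ => Real.smoothTransition.nonneg _)
        fun _ _ => Real.smoothTransition.le_one _
    simp only [smul_apply, innerSL_apply_apply, smul_eq_mul, abs_mul,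
      Nat.abs_cast]
    calc _ ≤ 1 * (|deriv Real.smoothTransition (n * (c j + inner ℝ (g j) x) - 1)| *
          (n * (C * (c j + inner ℝ (g j) x)))) := by gcongr; exact hv j
      _ = (n * |deriv Real.smoothTransition (n * (c j + inner ℝ (g j) x) - 1)| *
          (c j + inner ℝ (g j) x)) * C := by ring
      _ ≤ M * C := by gcongr; exact hM n _ (hx j)
  refine (Finset.sum_le_sum hterm).trans ?_
  simp [mul_assoc]

end polygon

/-! ### Smooth eigenfunctions on convex polygons -/

section eigenfunction

variable {ι : Type} [Fintype ι] {c : ι → ℝ} {g : ι → Plane} {f : Plane → ℝ} {lam : ℝ}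

/-- `Δf + lam f = 0` on the whole plane, with the Laplacian written as the divergence of the
gradient. -/
def IsHelmholtz (f : Plane → ℝ) (lam : ℝ) : Prop :=
  ∀ x, ∑ i : Fin 2, inner ℝ (EuclideanSpace.basisFun (Fin 2) ℝ i)
    (∇ (fun y => inner ℝ (EuclideanSpace.basisFun (Fin 2) ℝ i) (∇ f y)) x) = -lam * f x

theorem sum_inner_basisFun_mul (v w : Plane) :
    ∑ i : Fin 2, inner ℝ (EuclideanSpace.basisFun (Fin 2) ℝ i) v *
      inner ℝ (EuclideanSpace.basisFun (Fin 2) ℝ i) w = inner ℝ v w := by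
  rw [← (EuclideanSpace.basisFun (Fin 2) ℝ).sum_inner_mul_inner v w]
  simp_rw [real_inner_comm v]

theorem contDiff_inner_gradient (hf : ContDiff ℝ ∞ f) (e : Plane) :
    ContDiff ℝ ∞ fun y => inner ℝ e (∇ f y) := contDiff_const.inner ℝ hf.gradient

/-- Green's formula for the product of a function in `H¹(Ω)` and a multiple `ψ f` of a solution of
the Helmholtz equation, where `ψ f` has compact support in `Ω`. -/
theorem integral_cutoff_green {Ω : Set Plane}
    (hf : ContDiff ℝ ∞ f) (hlap : IsHelmholtz f lam) {ψ : Plane → ℝ} (hψc : ContDiff ℝ ∞ ψ)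
    (hψ : ∀ φ : Plane → ℝ, ContDiff ℝ ∞ φ → IsTestFunction Ω fun x => ψ x * φ x)
    {u : L2 Ω ℝ} {G : L2 Ω Plane} (hu : (u, G) ∈ sobolevH1 Ω) :
    ∫ x in Ω, u x * (inner ℝ (∇ ψ x) (∇ f x) - lam * (ψ x * f x)) =
      -∫ x in Ω, ψ x * inner ℝ (∇ f x) (G x) := by
  set b := EuclideanSpace.basisFun (Fin 2) ℝ with hbdef
  have dψ : Differentiable ℝ ψ := hψc.differentiable (by simp)
  have hT : ∀ i, IsTestFunction Ω fun x => ψ x * inner ℝ (b i) (∇ f x) :=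
    fun i => hψ _ (contDiff_inner_gradient hf _)
  have hweak : ∀ i, ∫ x in Ω, u x *
        inner ℝ (b i) (∇ (fun x => ψ x * inner ℝ (b i) (∇ f x)) x) =
      -∫ x in Ω, (ψ x * inner ℝ (b i) (∇ f x)) * inner ℝ (b i) (G x) := by
    intro i
    have h := congrArg (fun v => inner ℝ (b i) v) (hu _ (hT i))
    simp only [inner_neg_right] at h
    rw [← integral_inner ((hT i).integrable_smul_gradient u),
      ← integral_inner ((hT i).integrable_smul G)] at h
    simpa only [real_inner_smul_right] using h
  have i1 : ∀ i, Integrable (fun x => u x *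
      inner ℝ (b i) (∇ (fun x => ψ x * inner ℝ (b i) (∇ f x)) x)) (volume.restrict Ω) := by
    intro i
    simpa only [real_inner_smul_right] using
      ((hT i).integrable_smul_gradient u).const_inner (𝕜 := ℝ) (b i)
  have i2 : ∀ i, Integrable (fun x => (ψ x * inner ℝ (b i) (∇ f x)) * inner ℝ (b i) (G x))
      (volume.restrict Ω) := by
    intro i
    simpa only [real_inner_smul_right] using
      ((hT i).integrable_smul G).const_inner (𝕜 := ℝ) (b i)
  have hsum := Finset.sum_congr (rfl : (Finset.univ : Finset (Fin 2)) = _) fun i _ => hweak i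
  rw [Finset.sum_neg_distrib, ← integral_finsetSum _ fun i _ => i1 i,
    ← integral_finsetSum _ fun i _ => i2 i] at hsum
  have e1 : ∀ x, ∑ i, u x * inner ℝ (b i) (∇ (fun x => ψ x * inner ℝ (b i) (∇ f x)) x) =
      u x * (inner ℝ (∇ ψ x) (∇ f x) - lam * (ψ x * f x)) := by
    intro x
    rw [← Finset.mul_sum]
    congr 1
    have hd : ∀ i, DifferentiableAt ℝ (fun y => inner ℝ (b i) (∇ f y)) x := fun i =>
      (contDiff_inner_gradient hf (b i)).differentiable (by simp) x
    have : ∀ i, inner ℝ (b i) (∇ (fun x => ψ x * inner ℝ (b i) (∇ f x)) x) =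
        ψ x * inner ℝ (b i) (∇ (fun y => inner ℝ (b i) (∇ f y)) x) +
          inner ℝ (b i) (∇ ψ x) * inner ℝ (b i) (∇ f x) := by
      intro i
      rw [gradient_mul (dψ x) (hd i), inner_add_right, real_inner_smul_right,
        real_inner_smul_right, mul_comm (inner ℝ (b i) (∇ ψ x))]
    simp_rw [this]
    rw [Finset.sum_add_distrib, ← Finset.mul_sum, hlap x, sum_inner_basisFun_mul]
    ring
  have e2 : ∀ x, ∑ i, (ψ x * inner ℝ (b i) (∇ f x)) * inner ℝ (b i) (G x) =
      ψ x * inner ℝ (∇ f x) (G x) := by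
    intro x
    rw [← sum_inner_basisFun_mul, Finset.mul_sum]
    exact Finset.sum_congr rfl fun i _ => by rw [mul_assoc]
  simpa only [e1, e2] using hsum

/-- A solution of the Helmholtz equation whose normal derivative vanishes (to first order) on each
side of a bounded convex polygon is a Neumann eigenfunction. Green's formula holds for the cutoffs
of the solution, and the gradient of the cutoff contributes nothing in the limit. -/
theorem restrictL2_mem_neumannEigenspace (hb : Bornology.IsBounded (polygon c g))
    (hf : ContDiff ℝ ∞ f) (hlap : IsHelmholtz f lam)
    (hN : ∃ C, ∀ j, ∀ x ∈ polygon c g, |inner ℝ (g j) (∇ f x)| ≤ C * (c j + inner ℝ (g j) x)) :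
    restrictL2 (polygon c g) f ∈ laplaceEigenspace (sobolevH1 (polygon c g)) lam := by
  have hm : MeasurableSet (polygon c g) := isOpen_polygon.measurableSet
  refine ⟨restrictL2 _ (∇ f), mem_sobolevH1_of_contDiff hb hm hf, isSobolevH2_of_contDiff hb hm hf,
    ?_⟩
  rintro ⟨u, G⟩ hu
  obtain ⟨C, hC⟩ := hN
  obtain ⟨M, hM0, hM⟩ := exists_bound_inner_gradient_polygonCutoff c g
  obtain ⟨K, hK0, hK⟩ := hf.continuous.exists_bound_of_isBounded hb
  obtain ⟨K', hK'0, hK'⟩ := hf.continuous_gradient.exists_bound_of_isBounded hb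
  have hgreen := fun n => integral_cutoff_green hf hlap (contDiff_polygonCutoff n)
    (fun φ hφ => isTestFunction_polygonCutoff_mul hb n hφ) hu
  have lim1 : Tendsto (fun n => ∫ x in polygon c g, u x *
      (inner ℝ (∇ (polygonCutoff c g n) x) (∇ f x) - lam * (polygonCutoff c g n x * f x))) atTop
      (𝓝 (∫ x in polygon c g, u x * (inner ℝ 0 (∇ f x) - lam * (1 * f x)))) := by
    refine tendsto_integral_of_dominated_convergence (fun x => ‖u x‖ * (M * C + |lam| * (1 * K)))
      (fun n => ?_) ((integrable_of_L2 hb u).norm.mul_const _) (fun n => ?_) ?_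
    · refine (Lp.aestronglyMeasurable u).mul (Continuous.aestronglyMeasurable ?_)
      have h1 := (contDiff_polygonCutoff (c := c) (g := g) n).continuous_gradient
      have h2 := (contDiff_polygonCutoff (c := c) (g := g) n).continuous
      exact (h1.inner hf.continuous_gradient).sub
        (continuous_const.mul (h2.mul hf.continuous))
    · refine (ae_restrict_iff' hm).2 (ae_of_all _ fun x hx => ?_)
      rw [norm_mul]
      gcongr
      rw [Real.norm_eq_abs]
      refine (abs_sub _ _).trans (add_le_add (hM n C _ x hx fun j => hC j x hx) ?_)
      rw [abs_mul, abs_mul, abs_of_nonneg (polygonCutoff_nonneg n x)]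
      gcongr
      · exact polygonCutoff_le_one n x
      · exact hK x hx
    · refine (ae_restrict_iff' hm).2 (ae_of_all _ fun x hx => ?_)
      exact (((tendsto_gradient_polygonCutoff hx).inner tendsto_const_nhds).sub
        (((tendsto_polygonCutoff hx).mul_const _).const_mul _)).const_mul _
  have lim2 : Tendsto (fun n => -∫ x in polygon c g,
      polygonCutoff c g n x * inner ℝ (∇ f x) (G x)) atTop
      (𝓝 (-∫ x in polygon c g, 1 * inner ℝ (∇ f x) (G x))) := by
    refine (tendsto_integral_of_dominated_convergence (fun x => 1 * (K' * ‖G x‖))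
      (fun n => ?_) (((integrable_of_L2 hb G).norm.const_mul _).const_mul _)
      (fun n => ?_) ?_).neg
    · exact (contDiff_polygonCutoff (c := c) (g := g) n).continuous.aestronglyMeasurable.mul
        (hf.continuous_gradient.aestronglyMeasurable.inner (Lp.aestronglyMeasurable G))
    · refine (ae_restrict_iff' hm).2 (ae_of_all _ fun x hx => ?_)
      rw [norm_mul, Real.norm_of_nonneg (polygonCutoff_nonneg n x)]
      gcongr
      · exact polygonCutoff_le_one n x
      · exact (norm_inner_le_norm _ _).trans (by gcongr; exact hK' x hx)
    · refine (ae_restrict_iff' hm).2 (ae_of_all _ fun x hx => ?_)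
      exact (tendsto_polygonCutoff hx).mul_const _
  simp_rw [hgreen] at lim1
  have := tendsto_nhds_unique lim1 lim2
  rw [inner_restrictL2 hb hm hf.continuous_gradient, inner_restrictL2 hb hm hf.continuous]
  simp only [inner_zero_left, one_mul, zero_sub, mul_neg, integral_neg, neg_inj] at this
  rw [← this, ← integral_const_mul]
  refine integral_congr_ae (ae_of_all _ fun x => ?_)
  simp only [RCLike.inner_apply, conj_trivial]
  ring

theorem exists_bound_smul_gradient_polygonCutoff
    (hD : ∃ C, ∀ j, ∀ x ∈ polygon c g, |f x| ≤ C * (c j + inner ℝ (g j) x)) :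
    ∃ K, ∀ n, ∀ x ∈ polygon c g, ‖f x • ∇ (polygonCutoff c g n) x‖ ≤ K := by
  obtain ⟨C, hC⟩ := hD
  obtain ⟨M, hM0, hM⟩ := exists_bound_inner_gradient_polygonCutoff c g
  refine ⟨M * ((∑ j, ‖g j‖) * C), fun n x hx => ?_⟩
  rcases isEmpty_or_nonempty ι with hι | ⟨⟨i⟩⟩
  · have : polygonCutoff c g n = fun _ => 1 := by
      ext y
      simp [polygonCutoff]
    rw [this, gradient_fun_const]
    simp
  have hC0 : 0 ≤ C := nonneg_of_mul_nonneg_left ((abs_nonneg _).trans (hC i x hx)) (hx i)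
  obtain ⟨v, hv⟩ : ∃ v, v = ∇ (polygonCutoff c g n) x := ⟨_, rfl⟩
  rw [← hv]
  obtain ⟨w, hw⟩ : ∃ w, w = f x • v := ⟨_, rfl⟩
  have h1 : ‖w‖ * ‖w‖ = inner ℝ v (f x • w) := by
    rw [← real_inner_self_eq_norm_mul_norm]
    nth_rewrite 1 [hw]
    rw [real_inner_smul_left, real_inner_smul_right]
  have h2 : inner ℝ v (f x • w) ≤ M * ((∑ j, ‖g j‖) * C * ‖w‖) := by
    rw [hv]
    refine (le_abs_self _).trans (hM n _ _ x hx fun j => ?_)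
    rw [real_inner_smul_right, abs_mul]
    have h3 : ‖g j‖ ≤ ∑ j, ‖g j‖ :=
      Finset.single_le_sum (f := fun j => ‖g j‖) (fun _ _ => norm_nonneg _) (Finset.mem_univ j)
    have h4 := (hx j).le
    calc |f x| * |inner ℝ (g j) w| ≤ (C * (c j + inner ℝ (g j) x)) * (‖g j‖ * ‖w‖) :=
          mul_le_mul (hC j x hx) (abs_real_inner_le_norm _ _) (abs_nonneg _) (by positivity)
      _ ≤ (C * (c j + inner ℝ (g j) x)) * ((∑ j, ‖g j‖) * ‖w‖) := by gcongr
      _ = _ := by ring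
  rw [← hw]
  rcases (norm_nonneg w).eq_or_lt with h0 | h0
  · rw [← h0]
    exact mul_nonneg hM0 (mul_nonneg (Finset.sum_nonneg fun _ _ => norm_nonneg _) hC0)
  · have h3 : ‖w‖ * ‖w‖ ≤ M * ((∑ j, ‖g j‖) * C) * ‖w‖ := by
      rw [h1, mul_assoc]
      exact h2
    exact le_of_mul_le_mul_right h3 h0

theorem mem_sobolevH10_of_contDiff (hb : Bornology.IsBounded (polygon c g)) (hf : ContDiff ℝ ∞ f)
    (hD : ∃ C, ∀ j, ∀ x ∈ polygon c g, |f x| ≤ C * (c j + inner ℝ (g j) x)) :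
    (restrictL2 (polygon c g) f, restrictL2 (polygon c g) (∇ f)) ∈
      sobolevH10 (polygon c g) := by
  have hm : MeasurableSet (polygon c g) := isOpen_polygon.measurableSet
  obtain ⟨B, hB⟩ := exists_bound_smul_gradient_polygonCutoff hD
  obtain ⟨K, hK0, hK⟩ := hf.continuous.exists_bound_of_isBounded hb
  obtain ⟨K', hK'0, hK'⟩ := hf.continuous_gradient.exists_bound_of_isBounded hb
  have hTn := fun n => isTestFunction_polygonCutoff_mul hb n hf
  have hgrad : ∀ n x, ∇ (fun y => polygonCutoff c g n y * f y) x =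
      polygonCutoff c g n x • ∇ f x + f x • ∇ (polygonCutoff c g n) x := fun n x =>
    gradient_mul ((contDiff_polygonCutoff n).differentiable (by simp) x)
      (hf.differentiable (by simp) x)
  have l1 : Tendsto (fun n => restrictL2 (polygon c g) (fun y => polygonCutoff c g n y * f y))
      atTop (𝓝 (restrictL2 (polygon c g) f)) := by
    refine tendsto_restrictL2 hb hm (fun n => (hTn n).contDiff.continuous) hf.continuous
      (C := 1 * K) (fun n x hx => ?_) fun x hx => ?_
    · rw [norm_mul, Real.norm_of_nonneg (polygonCutoff_nonneg n x)]
      gcongr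
      · exact polygonCutoff_le_one n x
      · exact hK x hx
    · simpa using (tendsto_polygonCutoff hx).mul_const (f x)
  have l2 : Tendsto (fun n => restrictL2 (polygon c g) (∇ fun y => polygonCutoff c g n y * f y))
      atTop (𝓝 (restrictL2 (polygon c g) (∇ f))) := by
    refine tendsto_restrictL2 hb hm (fun n => (hTn n).continuous_gradient) hf.continuous_gradient
      (C := 1 * K' + B) (fun n x hx => ?_) fun x hx => ?_
    · rw [hgrad]
      refine (norm_add_le _ _).trans (add_le_add ?_ (hB n x hx))
      rw [norm_smul, Real.norm_of_nonneg (polygonCutoff_nonneg n x)]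
      gcongr
      · exact polygonCutoff_le_one n x
      · exact hK' x hx
    · simp_rw [hgrad]
      simpa using ((tendsto_polygonCutoff hx).smul_const (∇ f x)).add
        ((tendsto_gradient_polygonCutoff hx).const_smul (f x))
  exact mem_closure_of_tendsto (l1.prodMk_nhds l2) (Eventually.of_forall fun n =>
    Submodule.subset_span ⟨_, hTn n, restrictL2_ae_eq hb hm (hTn n).contDiff.continuous,
      restrictL2_ae_eq hb hm (hTn n).continuous_gradient⟩)

/-- The weak form of the Helmholtz equation, tested with `H¹₀(Ω)`: by linearity and continuity it
suffices to test with smooth functions of compact support. -/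
theorem inner_gradient_eq_of_mem_sobolevH10 {Ω : Set Plane} (hb : Bornology.IsBounded Ω)
    (hm : MeasurableSet Ω) (hf : ContDiff ℝ ∞ f) (hlap : IsHelmholtz f lam)
    {q : L2 Ω ℝ × L2 Ω Plane} (hq : q ∈ sobolevH10 Ω) :
    inner ℝ (restrictL2 Ω (∇ f)) q.2 = lam * inner ℝ (restrictL2 Ω f) q.1 := by
  have hcl : IsClosed {q : L2 Ω ℝ × L2 Ω Plane |
      inner ℝ (restrictL2 Ω (∇ f)) q.2 = lam * inner ℝ (restrictL2 Ω f) q.1} :=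
    isClosed_eq (by fun_prop) (by fun_prop)
  refine closure_minimal (fun q hq => ?_) hcl hq
  induction hq using Submodule.span_induction with
  | zero => simp
  | add p q _ _ hp hq =>
    simp only [Set.mem_ofPred_eq, Prod.snd_add, Prod.fst_add, inner_add_right] at hp hq ⊢
    rw [hp, hq, mul_add]
  | smul a p _ hp =>
    simp only [Set.mem_ofPred_eq, Prod.smul_snd, Prod.smul_fst, real_inner_smul_right] at hp ⊢
    rw [hp]
    ring
  | mem q hq =>
    obtain ⟨ψ, hψ, h1, h2⟩ := hq
    have hψmul : ∀ φ : Plane → ℝ, ContDiff ℝ ∞ φ →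
        IsTestFunction Ω fun x => ψ x * φ x := fun φ hφ =>
      ⟨hψ.contDiff.mul hφ, hψ.hasCompactSupport.mul_right,
        (tsupport_mul_subset_left (f := ψ) (g := φ)).trans hψ.tsupport_subset⟩
    have hone : ContDiff ℝ ∞ fun _ : Plane => (1 : ℝ) := contDiff_const
    have hgreen := integral_cutoff_green hf hlap hψ.contDiff hψmul
      (mem_sobolevH1_of_contDiff hb hm hone)
    have e1 : ∫ x in Ω, ψ x * inner ℝ (∇ f x)
        (restrictL2 Ω (∇ fun _ : Plane => (1 : ℝ)) x) = 0 := by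
      refine integral_eq_zero_of_ae ?_
      filter_upwards [restrictL2_ae_eq hb hm hone.continuous_gradient] with x hx
      rw [hx, gradient_fun_const]
      simp
    have i1 : Integrable (fun x => inner ℝ (∇ f x) (q.2 x)) (volume.restrict Ω) := by
      refine (L2.integrable_inner (𝕜 := ℝ) (restrictL2 Ω (∇ f)) q.2).congr ?_
      filter_upwards [restrictL2_ae_eq hb hm hf.continuous_gradient] with x hx
      rw [hx]
    have i2 : Integrable (fun x => inner ℝ (f x) (q.1 x)) (volume.restrict Ω) := by
      refine (L2.integrable_inner (𝕜 := ℝ) (restrictL2 Ω f) q.1).congr ?_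
      filter_upwards [restrictL2_ae_eq hb hm hf.continuous] with x hx
      rw [hx]
    rw [e1, neg_zero] at hgreen
    simp only [Set.mem_ofPred_eq]
    rw [inner_restrictL2 hb hm hf.continuous_gradient, inner_restrictL2 hb hm hf.continuous,
      ← integral_const_mul, ← sub_eq_zero, ← integral_sub i1 (i2.const_mul _), ← hgreen]
    refine integral_congr_ae ?_
    filter_upwards [h1, h2, restrictL2_ae_eq hb hm hone.continuous] with x hx1 hx2 hx3
    rw [hx1, hx2, hx3, one_mul, real_inner_comm]
    simp

/-- A solution of the Helmholtz equation which vanishes (to first order) on each side of a bounded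
convex polygon is a Dirichlet eigenfunction: its cutoffs converge to it in `H¹`. -/
theorem restrictL2_mem_dirichletEigenspace (hb : Bornology.IsBounded (polygon c g))
    (hf : ContDiff ℝ ∞ f) (hlap : IsHelmholtz f lam)
    (hD : ∃ C, ∀ j, ∀ x ∈ polygon c g, |f x| ≤ C * (c j + inner ℝ (g j) x)) :
    restrictL2 (polygon c g) f ∈ laplaceEigenspace (sobolevH10 (polygon c g)) lam :=
  have hm : MeasurableSet (polygon c g) := isOpen_polygon.measurableSet
  ⟨restrictL2 _ (∇ f), mem_sobolevH10_of_contDiff hb hf hD, isSobolevH2_of_contDiff hb hm hf,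
    fun _ hq => inner_gradient_eq_of_mem_sobolevH10 hb hm hf hlap hq⟩

end eigenfunction

/-! ### Waves symmetrized over the symmetric group -/

/-- `cos + sin`. As `cas (-θ) = cos θ - sin θ`, the functions for a frequency and its negative span
the cosine and the sine; so there is a single real function for each frequency. -/
noncomputable def cas (θ : ℝ) : ℝ := Real.cos θ + Real.sin θ

theorem cas_add_int_mul_two_pi (θ : ℝ) (n : ℤ) : cas (θ + n * (2 * Real.pi)) = cas θ := by
  simp [cas]

theorem hasDerivAt_cas (θ : ℝ) : HasDerivAt cas (cas (-θ)) θ := by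
  have h := (Real.hasDerivAt_cos θ).add (Real.hasDerivAt_sin θ)
  have e : -Real.sin θ + Real.cos θ = cas (-θ) := by
    simp [cas]
    ring
  rw [e] at h
  exact h

theorem contDiff_cas : ContDiff ℝ ∞ cas := Real.contDiff_cos.add Real.contDiff_sin

theorem abs_cas_le (θ : ℝ) : |cas θ| ≤ 2 :=
  (abs_add_le _ _).trans (by linarith [Real.abs_cos_le_one θ, Real.abs_sin_le_one θ])

theorem abs_cas_sub_cas_le (θ η : ℝ) : |cas θ - cas η| ≤ 2 * |θ - η| := by
  have := Convex.norm_image_sub_le_of_norm_hasDerivWithin_le (f := cas) (C := 2) (s := Set.univ)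
    (x := η) (y := θ) (fun x _ => (hasDerivAt_cas x).hasDerivWithinAt)
    (fun x _ => by simpa using abs_cas_le (-x)) convex_univ trivial trivial
  simpa using this

theorem cas_mul_cas (a b : ℝ) :
    cas a * cas b = (cas (a - b) + cas (b - a) + cas (a + b) - cas (-a - b)) / 2 := by
  have h1 : cas (b - a) = Real.cos (a - b) - Real.sin (a - b) := by
    rw [cas, ← neg_sub, Real.cos_neg, Real.sin_neg]
    ring
  have h2 : cas (-a - b) = Real.cos (a + b) - Real.sin (a + b) := by
    rw [cas, ← neg_add', Real.cos_neg, Real.sin_neg]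
    ring
  rw [h1, h2]
  simp only [cas, Real.cos_add, Real.sin_add, Real.cos_sub, Real.sin_sub]
  ring

/-- The symmetric group on three letters, the Weyl group of the root system `A₂`. -/
abbrev S3 : Type := Equiv.Perm (Fin 3)

/-- The phase `∑ᵢ kᵢ αᵢ` of a wave with frequency `k`. -/
noncomputable def phase (k : Fin 3 → ℤ) (α : Fin 3 → ℝ) : ℝ := ∑ i, (k i : ℝ) * α i

theorem phase_add (k l : Fin 3 → ℤ) (α : Fin 3 → ℝ) : phase (k + l) α = phase k α + phase l α := by
  simp [phase, add_mul, Finset.sum_add_distrib]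

theorem phase_sub (k l : Fin 3 → ℤ) (α : Fin 3 → ℝ) : phase (k - l) α = phase k α - phase l α := by
  simp [phase, sub_mul, Finset.sum_sub_distrib]

theorem phase_neg (k : Fin 3 → ℤ) (α : Fin 3 → ℝ) : phase (-k) α = -phase k α := by
  simp [phase]

/-- The real number `±1` attached to a permutation by a character of `S₃`. -/
def charVal (χ : S3 →* ℤˣ) (σ : S3) : ℝ := ((χ σ : ℤˣ) : ℤ)

theorem charVal_mul (χ : S3 →* ℤˣ) (σ τ : S3) : charVal χ (σ * τ) = charVal χ σ * charVal χ τ := by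
  simp [charVal]

theorem charVal_mul_left (χ χ' : S3 →* ℤˣ) (σ : S3) :
    charVal (χ * χ') σ = charVal χ σ * charVal χ' σ := by
  simp [charVal]

@[simp] theorem charVal_one (σ : S3) : charVal 1 σ = 1 := by simp [charVal]

@[simp] theorem charVal_apply_one (χ : S3 →* ℤˣ) : charVal χ 1 = 1 := by simp [charVal]

theorem charVal_mul_self (χ : S3 →* ℤˣ) (σ : S3) : charVal χ σ * charVal χ σ = 1 := by
  rcases Int.units_eq_one_or (χ σ) with h | h <;> simp [charVal, h]

theorem charVal_sign_swap {i j : Fin 3} (h : i ≠ j) :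
    charVal Equiv.Perm.sign (Equiv.swap i j) = -1 := by
  simp [charVal, Equiv.Perm.sign_swap h]

theorem character_mul_self (χ : S3 →* ℤˣ) : χ * χ = 1 := by
  ext σ
  rcases Int.units_eq_one_or (χ σ) with h | h <;> simp [h]

/-- The wave with frequency `k`, symmetrized over the permutations of the three angles according
to the character `χ`. -/
noncomputable def orbitWave (χ : S3 →* ℤˣ) (k : Fin 3 → ℤ) (α : Fin 3 → ℝ) : ℝ :=
  ∑ σ : S3, charVal χ σ * cas (phase (k ∘ σ) α)

theorem orbitWave_comp (χ : S3 →* ℤˣ) (k : Fin 3 → ℤ) (τ : S3) (α : Fin 3 → ℝ) :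
    orbitWave χ (k ∘ τ) α = charVal χ τ * orbitWave χ k α := by
  rw [orbitWave, orbitWave, Finset.mul_sum, ← Equiv.sum_comp (Equiv.mulLeft τ)
    fun σ : S3 => charVal χ τ * (charVal χ σ * cas (phase (k ∘ σ) α))]
  refine Finset.sum_congr rfl fun σ _ => ?_
  simp only [Equiv.coe_mulLeft, charVal_mul, ← mul_assoc, charVal_mul_self, one_mul]
  rfl

theorem orbitWave_of_sub_const (χ : S3 →* ℤˣ) {k l : Fin 3 → ℤ} {c : ℤ} (h : ∀ i, k i = l i + c)
    {α : Fin 3 → ℝ} (hα : ∑ i, α i = 0) : orbitWave χ k α = orbitWave χ l α := by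
  refine Finset.sum_congr rfl fun σ _ => ?_
  have : phase (k ∘ σ) α = phase (l ∘ σ) α + c * ∑ i, α i := by
    simp only [phase, Function.comp, h, Finset.mul_sum, ← Finset.sum_add_distrib]
    refine Finset.sum_congr rfl fun i _ => ?_
    push_cast
    ring
  rw [this, hα, mul_zero, add_zero]

/-- Products of symmetrized waves are combinations of symmetrized waves. -/
theorem orbitWave_mul (χ χ' : S3 →* ℤˣ) (k l : Fin 3 → ℤ) (α : Fin 3 → ℝ) :
    orbitWave χ k α * orbitWave χ' l α = ∑ τ : S3, charVal χ' τ *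
      ((orbitWave (χ * χ') (k - l ∘ τ) α + orbitWave (χ * χ') (l ∘ τ - k) α
        + orbitWave (χ * χ') (k + l ∘ τ) α - orbitWave (χ * χ') (-k - l ∘ τ) α) / 2) := by
  have h1 : ∀ τ σ : S3, charVal χ σ * cas (phase (k ∘ σ) α) *
      (charVal χ' (τ * σ) * cas (phase (l ∘ (τ * σ : S3)) α)) = charVal χ' τ *
      (charVal (χ * χ') σ * ((cas (phase ((k - l ∘ τ) ∘ σ) α) + cas (phase ((l ∘ τ - k) ∘ σ) α)
        + cas (phase ((k + l ∘ τ) ∘ σ) α) - cas (phase ((-k - l ∘ τ) ∘ σ) α)) / 2)) := by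
    intro τ σ
    have e1 : phase ((k - l ∘ τ) ∘ σ) α = phase (k ∘ σ) α - phase (l ∘ (τ * σ : S3)) α :=
      phase_sub (k ∘ σ) (l ∘ (τ * σ : S3)) α
    have e2 : phase ((l ∘ τ - k) ∘ σ) α = phase (l ∘ (τ * σ : S3)) α - phase (k ∘ σ) α :=
      phase_sub (l ∘ (τ * σ : S3)) (k ∘ σ) α
    have e3 : phase ((k + l ∘ τ) ∘ σ) α = phase (k ∘ σ) α + phase (l ∘ (τ * σ : S3)) α :=
      phase_add (k ∘ σ) (l ∘ (τ * σ : S3)) α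
    have e4 : phase ((-k - l ∘ τ) ∘ σ) α = -phase (k ∘ σ) α - phase (l ∘ (τ * σ : S3)) α := by
      rw [← phase_neg]
      exact phase_sub (-(k ∘ σ)) (l ∘ (τ * σ : S3)) α
    rw [e1, e2, e3, e4, ← cas_mul_cas, charVal_mul, charVal_mul_left]
    ring
  calc orbitWave χ k α * orbitWave χ' l α
      = ∑ σ : S3, ∑ τ : S3, charVal χ σ * cas (phase (k ∘ σ) α) *
          (charVal χ' τ * cas (phase (l ∘ τ) α)) := by
        rw [orbitWave, orbitWave, Finset.sum_mul_sum]
    _ = ∑ σ : S3, ∑ τ : S3, charVal χ σ * cas (phase (k ∘ σ) α) *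
          (charVal χ' (τ * σ) * cas (phase (l ∘ (τ * σ : S3)) α)) := by
        refine Finset.sum_congr rfl fun σ _ => ?_
        exact (Equiv.sum_comp (Equiv.mulRight σ) fun τ : S3 =>
          charVal χ σ * cas (phase (k ∘ σ) α) * (charVal χ' τ * cas (phase (l ∘ τ) α))).symm
    _ = _ := by
        rw [Finset.sum_comm]
        refine Finset.sum_congr rfl fun τ _ => ?_
        simp_rw [h1, ← Finset.mul_sum]
        congr 1
        simp only [orbitWave, ← Finset.sum_add_distrib, ← Finset.sum_sub_distrib, Finset.sum_div]
        refine Finset.sum_congr rfl fun σ _ => ?_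
        ring

/-- Cancellation at a wall. Let `αᵢ - αⱼ` differ by `2π t` from a multiple of `2π`, so that `t`
measures the distance from a wall. If the coefficients are odd under the transposition of `i` and
`j`, then the terms of the sum cancel in pairs up to `O(t)`. -/
theorem exists_bound_sum_cas_phase (k : Fin 3 → ℤ) {i j : Fin 3} (hij : i ≠ j) (d : S3 → ℝ)
    (hd : ∀ σ : S3, d (σ * Equiv.swap i j) = -d σ) (c : ℤ) :
    ∃ C, 0 ≤ C ∧ ∀ (α : Fin 3 → ℝ) (t : ℝ), α i - α j = 2 * Real.pi * (t - c) →
      |∑ σ : S3, d σ * cas (phase (k ∘ σ) α)| ≤ C * |t| := by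
  refine ⟨∑ σ : S3, |d σ| * (2 * (|(k (σ i) : ℝ) - k (σ j)| * (2 * Real.pi))), ?_, ?_⟩
  · positivity
  intro α t ht
  have h1 : ∑ σ : S3, d σ * cas (phase (k ∘ σ) α) =
      -∑ σ : S3, d σ * cas (phase (k ∘ (σ * Equiv.swap i j : S3)) α) := by
    rw [← Equiv.sum_comp (Equiv.mulRight (Equiv.swap i j)), ← Finset.sum_neg_distrib]
    refine Finset.sum_congr rfl fun σ _ => ?_
    rw [Equiv.coe_mulRight, hd, neg_mul]
  have h2 : ∀ σ : S3, |cas (phase (k ∘ σ) α) - cas (phase (k ∘ (σ * Equiv.swap i j : S3)) α)| ≤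
      2 * (|(k (σ i) : ℝ) - k (σ j)| * (2 * Real.pi) * |t|) := by
    intro σ
    have h3 : phase (k ∘ σ) α - phase (k ∘ (σ * Equiv.swap i j : S3)) α =
        ((k (σ i) : ℝ) - k (σ j)) * (α i - α j) := by
      rw [phase, phase, ← Finset.sum_sub_distrib, ← Finset.sum_subset (Finset.subset_univ {i, j})]
      · rw [Finset.sum_pair hij]
        simp [Equiv.swap_apply_left, Equiv.swap_apply_right]
        ring
      · intro m _ hm
        simp only [Finset.mem_insert, Finset.mem_singleton, not_or] at hm
        simp [Equiv.swap_apply_of_ne_of_ne hm.1 hm.2]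
    have h4 : phase (k ∘ (σ * Equiv.swap i j : S3)) α +
        ((-((k (σ i) - k (σ j)) * c) : ℤ) : ℝ) * (2 * Real.pi) =
        phase (k ∘ σ) α - ((k (σ i) : ℝ) - k (σ j)) * (2 * Real.pi) * t := by
      simp only [Int.cast_neg, Int.cast_mul, Int.cast_sub]
      rw [ht] at h3
      linear_combination -h3
    rw [← cas_add_int_mul_two_pi (phase (k ∘ (σ * Equiv.swap i j : S3)) α)
      (-((k (σ i) - k (σ j)) * c)), h4]
    refine (abs_cas_sub_cas_le _ _).trans_eq ?_
    rw [sub_sub_cancel, abs_mul, abs_mul, abs_of_pos (Real.two_pi_pos)]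
  have h5 : ∑ σ : S3, d σ * cas (phase (k ∘ σ) α) = (∑ σ : S3, d σ * (cas (phase (k ∘ σ) α) -
      cas (phase (k ∘ (σ * Equiv.swap i j : S3)) α))) / 2 := by
    simp only [mul_sub, Finset.sum_sub_distrib]
    linarith
  rw [h5, abs_div, abs_two]
  have h6 : |∑ σ : S3, d σ * (cas (phase (k ∘ σ) α) -
      cas (phase (k ∘ (σ * Equiv.swap i j : S3)) α))| ≤
      ∑ σ : S3, |d σ| * (2 * (|(k (σ i) : ℝ) - k (σ j)| * (2 * Real.pi) * |t|)) := by
    refine (Finset.abs_sum_le_sum_abs _ _).trans (Finset.sum_le_sum fun σ _ => ?_)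
    rw [abs_mul]
    gcongr
    exact h2 σ
  refine (div_le_self (abs_nonneg _) one_le_two).trans (h6.trans_eq ?_)
  rw [Finset.sum_mul]
  refine Finset.sum_congr rfl fun σ _ => ?_
  ring

/-- The dominant frequency with Dynkin labels `m`, `n`. -/
def dominant (p : ℕ × ℕ) : Fin 3 → ℤ := ![p.1 + p.2, p.2, 0]

/-- Every frequency is equivalent, under permutations and translations by constants, to a dominant
one. -/
theorem exists_dominant (k : Fin 3 → ℤ) :
    ∃ (σ : S3) (p : ℕ × ℕ) (c : ℤ), ∀ i, (k ∘ σ) i = dominant p i + c := by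
  set σ := Tuple.sort (fun i => -k i)
  have h := Tuple.monotone_sort (fun i => -k i)
  have h01 : -k (σ 0) ≤ -k (σ 1) := h (by decide)
  have h12 : -k (σ 1) ≤ -k (σ 2) := h (by decide)
  refine ⟨σ, ((k (σ 0) - k (σ 1)).toNat, (k (σ 1) - k (σ 2)).toNat), k (σ 2), fun i => ?_⟩
  fin_cases i <;> simp [dominant] <;> omega

theorem orbitWave_eq_dominant (k : Fin 3 → ℤ) : ∃ (σ : S3) (p : ℕ × ℕ), ∀ (χ : S3 →* ℤˣ)
    (α : Fin 3 → ℝ), ∑ i, α i = 0 → orbitWave χ k α = charVal χ σ * orbitWave χ (dominant p) α := by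
  obtain ⟨σ, p, c, h⟩ := exists_dominant k
  refine ⟨σ, p, fun χ α hα => ?_⟩
  rw [← orbitWave_of_sub_const χ h hα, orbitWave_comp, ← mul_assoc, charVal_mul_self, one_mul]

theorem orbitWave_sign_eq_zero {k : Fin 3 → ℤ} {i j : Fin 3} (hij : i ≠ j) (hk : k i = k j)
    (α : Fin 3 → ℝ) : orbitWave Equiv.Perm.sign k α = 0 := by
  have h : k ∘ Equiv.swap i j = k := by
    ext m
    by_cases hi : m = i
    · subst hi; simp [hk]
    by_cases hj : m = j
    · subst hj; simp [hk]
    simp [Equiv.swap_apply_of_ne_of_ne hi hj]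
  have := orbitWave_comp Equiv.Perm.sign k (Equiv.swap i j) α
  rw [h, charVal_sign_swap hij] at this
  linarith

/-- Two dominant frequencies that are equivalent under a permutation and a translation are equal. -/
theorem dominant_eq_of_comp {p p' : ℕ × ℕ} {τ : S3} {c : ℤ}
    (h : ∀ i, dominant p i - dominant p' (τ i) = c) : p = p' := by
  have h0 := h 0
  have h1 := h 1
  have h2 := h 2
  have n01 : τ 0 ≠ τ 1 := τ.injective.ne (by decide)
  have n02 : τ 0 ≠ τ 2 := τ.injective.ne (by decide)
  have n12 : τ 1 ≠ τ 2 := τ.injective.ne (by decide)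
  generalize τ 0 = a at *
  generalize τ 1 = b at *
  generalize τ 2 = d at *
  ext <;> fin_cases a <;> fin_cases b <;> fin_cases d <;> simp [dominant] at * <;> omega

theorem eq_one_of_dominant_comp {p : ℕ × ℕ} (h1 : 0 < p.1) (h2 : 0 < p.2) {τ : S3} {c : ℤ}
    (h : ∀ i, dominant p i - dominant p (τ i) = c) : τ = 1 := by
  have h0 := h 0
  have h1 := h 1
  have h2 := h 2
  have n01 : τ 0 ≠ τ 1 := τ.injective.ne (by decide)
  have n02 : τ 0 ≠ τ 2 := τ.injective.ne (by decide)
  have n12 : τ 1 ≠ τ 2 := τ.injective.ne (by decide)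
  suffices τ 0 = 0 ∧ τ 1 = 1 ∧ τ 2 = 2 by
    ext i
    fin_cases i <;> simp [this]
  generalize τ 0 = a at *
  generalize τ 1 = b at *
  generalize τ 2 = d at *
  fin_cases a <;> fin_cases b <;> fin_cases d <;> simp [dominant] at * <;> omega

/-! ### Symmetrized waves on the plane -/

/-- Three vectors that sum to zero, all of squared length `q`, at angles `2π / 3`: the weights of
the vector representation of the root system `A₂`. -/
structure IsA2Frame (a : Fin 3 → Plane) (q : ℝ) : Prop where
  pos : 0 < q
  sum_eq_zero : ∑ i, a i = 0
  inner_self : ∀ i, inner ℝ (a i) (a i) = q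
  inner_ne : ∀ i j, i ≠ j → inner ℝ (a i) (a j) = -(q / 2)

/-- The three angles of a point of the plane, with respect to the base point `A`. -/
noncomputable def angles (a : Fin 3 → Plane) (A x : Plane) (i : Fin 3) : ℝ := inner ℝ (a i) (x - A)

/-- The frequency vector of a plane wave with phase `∑ᵢ kᵢ αᵢ`. -/
noncomputable def freqVec (a : Fin 3 → Plane) (k : Fin 3 → ℤ) : Plane := ∑ i, (k i : ℝ) • a i

/-- The constant terms of the affine functions `(αⱼ - αⱼ₊₁) / 2π`, increased by `1` for `j = 2`,
whose positivity defines the alcove. The indices are cyclic. -/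
noncomputable def alcoveConst (a : Fin 3 → Plane) (A : Plane) (j : Fin 3) : ℝ :=
  ((![0, 0, 1] : Fin 3 → ℤ) j : ℝ) - inner ℝ ((2 * Real.pi)⁻¹ • (a j - a (j + 1))) A

/-- The linear terms of the affine functions defining the alcove. -/
noncomputable def alcoveNormal (a : Fin 3 → Plane) (j : Fin 3) : Plane :=
  (2 * Real.pi)⁻¹ • (a j - a (j + 1))

/-- The open triangle where the angles satisfy `α₀ > α₁ > α₂ > α₀ - 2π`. -/
noncomputable def alcove (a : Fin 3 → Plane) (A : Plane) : Set Plane :=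
  polygon (alcoveConst a A) (alcoveNormal a)

section waves

variable {a : Fin 3 → Plane} {A : Plane} {q : ℝ}

theorem phase_angles (k : Fin 3 → ℤ) (x : Plane) :
    phase k (angles a A x) = inner ℝ (freqVec a k) (x - A) := by
  simp [phase, angles, freqVec, sum_inner, real_inner_smul_left]

theorem freqVec_neg (k : Fin 3 → ℤ) : freqVec a (-k) = -freqVec a k := by
  simp [freqVec]

theorem freqVec_comp (k : Fin 3 → ℤ) (σ : S3) : freqVec a (k ∘ σ) = freqVec (a ∘ σ.symm) k := by
  rw [freqVec, freqVec, ← Equiv.sum_comp σ fun i => (k i : ℝ) • (a ∘ σ.symm) i]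
  simp

theorem IsA2Frame.sum_angles (ha : IsA2Frame a q) (x : Plane) : ∑ i, angles a A x i = 0 := by
  simp only [angles, ← sum_inner, ha.sum_eq_zero, inner_zero_left]

theorem angles_sub_angles (j : Fin 3) (x : Plane) :
    angles a A x j - angles a A x (j + 1) = 2 * Real.pi *
      (alcoveConst a A j + inner ℝ (alcoveNormal a j) x - ((![0, 0, 1] : Fin 3 → ℤ) j : ℝ)) := by
  have := Real.pi_pos
  simp only [angles, alcoveConst, alcoveNormal, inner_sub_right, inner_sub_left,
    real_inner_smul_left]
  field_simp
  ring

theorem isOpen_alcove : IsOpen (alcove a A) := isOpen_polygon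

theorem IsA2Frame.norm_freqVec_sq (ha : IsA2Frame a q) (k : Fin 3 → ℤ) :
    ‖freqVec a k‖ ^ 2 = q * (((3 * ∑ i, k i ^ 2 - (∑ i, k i) ^ 2 : ℤ) : ℝ) / 2) := by
  rw [← real_inner_self_eq_norm_sq, freqVec]
  simp only [Fin.sum_univ_three, inner_add_left, inner_add_right, real_inner_smul_left,
    real_inner_smul_right, ha.inner_self, ha.inner_ne 0 1 (by decide), ha.inner_ne 0 2 (by decide),
    ha.inner_ne 1 0 (by decide), ha.inner_ne 1 2 (by decide), ha.inner_ne 2 0 (by decide),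
    ha.inner_ne 2 1 (by decide)]
  push_cast
  ring

theorem IsA2Frame.norm_freqVec_comp_sq (ha : IsA2Frame a q) (k : Fin 3 → ℤ) (σ : S3) :
    ‖freqVec a (k ∘ σ)‖ ^ 2 = ‖freqVec a k‖ ^ 2 := by
  rw [ha.norm_freqVec_sq, ha.norm_freqVec_sq]
  congr 4
  · exact congrArg _ (Equiv.sum_comp σ fun i => k i ^ 2)
  · exact congrArg (· ^ 2) (Equiv.sum_comp σ k)

theorem IsA2Frame.norm_freqVec_dominant_sq (ha : IsA2Frame a q) (p : ℕ × ℕ) :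
    ‖freqVec a (dominant p)‖ ^ 2 = q * (p.1 ^ 2 + p.1 * p.2 + p.2 ^ 2 : ℕ) := by
  rw [ha.norm_freqVec_sq]
  simp [dominant, Fin.sum_univ_three]
  left
  ring

/-- A frequency vector vanishes only if the frequency is constant. -/
theorem IsA2Frame.eq_of_freqVec_eq_zero (ha : IsA2Frame a q) {k : Fin 3 → ℤ}
    (h : freqVec a k = 0) (i j : Fin 3) : k i = k j := by
  have h1 := ha.norm_freqVec_sq k
  rw [h, norm_zero, zero_pow two_ne_zero, eq_comm, mul_eq_zero, or_iff_right ha.pos.ne',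
    div_eq_zero_iff, or_iff_left two_ne_zero, Int.cast_eq_zero] at h1
  simp only [Fin.sum_univ_three] at h1
  have h2 : (k 0 - k 1) ^ 2 + (k 1 - k 2) ^ 2 + (k 0 - k 2) ^ 2 = 0 := by linarith
  have h3 : k 0 - k 1 = 0 := by
    nlinarith [sq_nonneg (k 0 - k 1), sq_nonneg (k 1 - k 2), sq_nonneg (k 0 - k 2)]
  have h4 : k 1 - k 2 = 0 := by
    nlinarith [sq_nonneg (k 0 - k 1), sq_nonneg (k 1 - k 2), sq_nonneg (k 0 - k 2)]
  fin_cases i <;> fin_cases j <;> simp <;> omega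

theorem freqVec_eq_zero_of_const (ha : IsA2Frame a q) {k : Fin 3 → ℤ} (h : ∀ i, k i = k 0) :
    freqVec a k = 0 := by
  rw [freqVec, Finset.sum_congr rfl fun i _ => by rw [h i], ← Finset.smul_sum, ha.sum_eq_zero,
    smul_zero]

/-- The vectors of the frame span the plane. -/
theorem IsA2Frame.eq_zero_of_inner_eq_zero (ha : IsA2Frame a q) {x : Plane}
    (h : ∀ i, inner ℝ (a i) x = 0) : x = 0 := by
  have h0 := h 0
  have h1 := h 1
  have e0 := ha.inner_self 0
  have e1 := ha.inner_self 1
  have e2 := ha.inner_ne 0 1 (by decide)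
  simp only [PiLp.inner_apply, Fin.sum_univ_two, RCLike.inner_apply, conj_trivial] at h0 h1 e0 e1 e2
  have hq := ha.pos
  have hdet : (a 0 0 * a 1 1 - a 0 1 * a 1 0) ^ 2 = 3 / 4 * q ^ 2 := by
    linear_combination (a 1 0 ^ 2 + a 1 1 ^ 2) * e0 + q * e1 -
      (a 1 0 * a 0 0 + a 1 1 * a 0 1 - q / 2) * e2
  have hdet0 : a 0 0 * a 1 1 - a 0 1 * a 1 0 ≠ 0 := by
    intro h
    rw [h] at hdet
    nlinarith [sq_pos_of_pos hq]
  ext i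
  have hx0 : (a 0 0 * a 1 1 - a 0 1 * a 1 0) * x 0 = 0 := by
    linear_combination a 1 1 * h0 - a 0 1 * h1
  have hx1 : (a 0 0 * a 1 1 - a 0 1 * a 1 0) * x 1 = 0 := by
    linear_combination a 0 0 * h1 - a 1 0 * h0
  fin_cases i
  · exact (mul_eq_zero.1 hx0).resolve_left hdet0
  · exact (mul_eq_zero.1 hx1).resolve_left hdet0

theorem IsA2Frame.ext_angles (ha : IsA2Frame a q) {x y : Plane}
    (h : ∀ i, angles a A x i = angles a A y i) : x = y := by
  refine sub_eq_zero.1 (ha.eq_zero_of_inner_eq_zero fun i => ?_)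
  have := h i
  simp only [angles, inner_sub_right] at this ⊢
  linarith

/-- A combination of plane waves with permuted frequencies. -/
noncomputable def weightedWave (a : Fin 3 → Plane) (A : Plane) (d : S3 → ℝ) (k : Fin 3 → ℤ)
    (x : Plane) : ℝ :=
  ∑ σ : S3, d σ * cas (phase (k ∘ σ) (angles a A x))

theorem contDiff_weightedWave (d : S3 → ℝ) (k : Fin 3 → ℤ) :
    ContDiff ℝ ∞ (weightedWave a A d k) := by
  refine ContDiff.sum fun σ _ => contDiff_const.mul (contDiff_cas.comp ?_)
  simp_rw [phase_angles]
  exact contDiff_const.inner ℝ (contDiff_id.sub contDiff_const)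

theorem gradient_weightedWave (d : S3 → ℝ) (k : Fin 3 → ℤ) (x : Plane) :
    ∇ (weightedWave a A d k) x = ∑ σ : S3,
      (d σ * cas (phase ((-k) ∘ σ) (angles a A x))) • freqVec a (k ∘ σ) := by
  refine HasGradientAt.gradient ?_
  rw [hasGradientAt_iff_hasFDerivAt, map_sum]
  refine HasFDerivAt.fun_sum fun σ _ => ?_
  have h1 : HasFDerivAt (fun y => phase (k ∘ σ) (angles a A y))
      (innerSL ℝ (freqVec a (k ∘ σ))) x := by
    simp_rw [phase_angles]
    exact (innerSL ℝ (freqVec a (k ∘ σ))).hasFDerivAt.comp x ((hasFDerivAt_id x).sub_const A)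
  have h2 := ((hasDerivAt_cas (phase (k ∘ σ) (angles a A x))).comp_hasFDerivAt x h1).const_mul (d σ)
  have e : phase ((-k) ∘ σ) (angles a A x) = -phase (k ∘ σ) (angles a A x) := phase_neg _ _
  rw [e]
  refine h2.congr_fderiv ?_
  ext v
  simp [mul_assoc]

theorem inner_gradient_weightedWave (e : Plane) (d : S3 → ℝ) (k : Fin 3 → ℤ) (x : Plane) :
    inner ℝ e (∇ (weightedWave a A d k) x) =
      weightedWave a A (fun σ => d σ * inner ℝ e (freqVec a (k ∘ σ))) (-k) x := by
  rw [gradient_weightedWave, inner_sum, weightedWave]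
  refine Finset.sum_congr rfl fun σ _ => ?_
  rw [real_inner_smul_right]
  ring

theorem IsA2Frame.isHelmholtz_weightedWave (ha : IsA2Frame a q) (d : S3 → ℝ) (k : Fin 3 → ℤ) :
    IsHelmholtz (weightedWave a A d k) (‖freqVec a k‖ ^ 2) := by
  intro x
  simp_rw [inner_gradient_weightedWave, neg_neg, weightedWave]
  rw [Finset.sum_comm, Finset.mul_sum]
  refine Finset.sum_congr rfl fun σ _ => ?_
  have h : ∀ i, inner ℝ (EuclideanSpace.basisFun (Fin 2) ℝ i) (freqVec a ((-k) ∘ σ)) =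
      -inner ℝ (EuclideanSpace.basisFun (Fin 2) ℝ i) (freqVec a (k ∘ σ)) := fun i => by
    rw [← inner_neg_right, ← freqVec_neg]
    rfl
  simp_rw [h]
  rw [← Finset.sum_mul, ← ha.norm_freqVec_comp_sq k σ, ← real_inner_self_eq_norm_sq,
    ← sum_inner_basisFun_mul (freqVec a (k ∘ σ)) (freqVec a (k ∘ σ))]
  simp_rw [mul_neg, mul_assoc]
  rw [Finset.sum_neg_distrib, ← Finset.mul_sum]
  ring

/-- The symmetrized wave as a function on the plane. -/
noncomputable def planeWave (a : Fin 3 → Plane) (A : Plane) (χ : S3 →* ℤˣ) (k : Fin 3 → ℤ)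
    (x : Plane) : ℝ :=
  orbitWave χ k (angles a A x)

theorem planeWave_eq_weightedWave (χ : S3 →* ℤˣ) (k : Fin 3 → ℤ) :
    planeWave a A χ k = weightedWave a A (charVal χ) k := rfl

theorem contDiff_planeWave (χ : S3 →* ℤˣ) (k : Fin 3 → ℤ) : ContDiff ℝ ∞ (planeWave a A χ k) :=
  contDiff_weightedWave _ _

theorem exists_bound_weightedWave (d : S3 → ℝ) (k : Fin 3 → ℤ) (j : Fin 3)
    (hd : ∀ σ : S3, d (σ * Equiv.swap j (j + 1)) = -d σ) :
    ∃ C, 0 ≤ C ∧ ∀ x ∈ alcove a A, |weightedWave a A d k x| ≤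
      C * (alcoveConst a A j + inner ℝ (alcoveNormal a j) x) := by
  have hj : j ≠ j + 1 := by fin_cases j <;> decide
  obtain ⟨C, hC0, hC⟩ := exists_bound_sum_cas_phase k hj d hd ((![0, 0, 1] : Fin 3 → ℤ) j)
  refine ⟨C, hC0, fun x hx => ?_⟩
  have := hC _ _ (angles_sub_angles (a := a) (A := A) j x)
  rwa [abs_of_pos (hx j)] at this

theorem exists_common_bound {f : Fin 3 → Plane → ℝ}
    (h : ∀ j, ∃ C, 0 ≤ C ∧ ∀ x ∈ alcove a A, |f j x| ≤
      C * (alcoveConst a A j + inner ℝ (alcoveNormal a j) x)) :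
    ∃ C, ∀ j, ∀ x ∈ alcove a A, |f j x| ≤
      C * (alcoveConst a A j + inner ℝ (alcoveNormal a j) x) := by
  choose C hC0 hC using h
  refine ⟨∑ j, C j, fun j x hx => (hC j x hx).trans ?_⟩
  have := (hx j).le
  gcongr
  exact Finset.single_le_sum (fun i _ => hC0 i) (Finset.mem_univ j)

/-- Antisymmetric waves are Dirichlet eigenfunctions of the alcove. -/
theorem IsA2Frame.restrictL2_planeWave_mem_dirichlet (ha : IsA2Frame a q)
    (hb : Bornology.IsBounded (alcove a A)) (k : Fin 3 → ℤ) :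
    restrictL2 (alcove a A) (planeWave a A Equiv.Perm.sign k) ∈
      laplaceEigenspace (sobolevH10 (alcove a A)) (‖freqVec a k‖ ^ 2) := by
  refine restrictL2_mem_dirichletEigenspace hb (contDiff_planeWave _ _)
    (ha.isHelmholtz_weightedWave _ k) (exists_common_bound
      (f := fun _ => planeWave a A Equiv.Perm.sign k) fun j => ?_)
  refine exists_bound_weightedWave _ k j fun σ => ?_
  have hj : j ≠ j + 1 := by fin_cases j <;> decide
  rw [charVal_mul, charVal_sign_swap hj, mul_neg_one]

theorem IsA2Frame.inner_alcoveNormal_swap (ha : IsA2Frame a q) (j i : Fin 3) :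
    inner ℝ (alcoveNormal a j) (a (Equiv.swap j (j + 1) i)) =
      -inner ℝ (alcoveNormal a j) (a i) := by
  have hj : j ≠ j + 1 := by fin_cases j <;> decide
  simp only [alcoveNormal, real_inner_smul_left, inner_sub_left]
  by_cases h1 : i = j
  · subst h1
    rw [Equiv.swap_apply_left, ha.inner_self, ha.inner_self, ha.inner_ne _ _ hj,
      ha.inner_ne _ _ hj.symm]
    ring
  by_cases h2 : i = j + 1
  · subst h2
    rw [Equiv.swap_apply_right, ha.inner_self, ha.inner_self, ha.inner_ne _ _ hj,
      ha.inner_ne _ _ hj.symm]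
    ring
  rw [Equiv.swap_apply_of_ne_of_ne h1 h2, ha.inner_ne _ _ (Ne.symm h1),
    ha.inner_ne _ _ (Ne.symm h2)]
  ring

/-- Symmetric waves are Neumann eigenfunctions of the alcove. -/
theorem IsA2Frame.restrictL2_planeWave_mem_neumann (ha : IsA2Frame a q)
    (hb : Bornology.IsBounded (alcove a A)) (k : Fin 3 → ℤ) :
    restrictL2 (alcove a A) (planeWave a A 1 k) ∈
      laplaceEigenspace (sobolevH1 (alcove a A)) (‖freqVec a k‖ ^ 2) := by
  refine restrictL2_mem_neumannEigenspace hb (contDiff_planeWave _ _)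
    (ha.isHelmholtz_weightedWave _ k) (exists_common_bound
      (f := fun j x => inner ℝ (alcoveNormal a j) (∇ (planeWave a A 1 k) x)) fun j => ?_)
  simp_rw [planeWave_eq_weightedWave, inner_gradient_weightedWave]
  refine exists_bound_weightedWave _ (-k) j fun σ => ?_
  have h : freqVec a (k ∘ (σ * Equiv.swap j (j + 1) : S3)) =
      freqVec (a ∘ Equiv.swap j (j + 1)) (k ∘ σ) := by
    have := freqVec_comp (a := a) (k ∘ σ) (Equiv.swap j (j + 1))
    rwa [Equiv.symm_swap] at this
  rw [h]
  simp only [charVal_one, one_mul, freqVec, inner_sum, real_inner_smul_right, Function.comp_apply,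
    ha.inner_alcoveNormal_swap, mul_neg, Finset.sum_neg_distrib]

end waves

/-! ### Completeness of the symmetrized waves -/

theorem univ_S3 : (Finset.univ : Finset S3) = {1, Equiv.swap 0 1, Equiv.swap 0 2, Equiv.swap 1 2,
    Equiv.swap 0 1 * Equiv.swap 1 2, Equiv.swap 1 2 * Equiv.swap 0 1} := by
  decide

theorem sum_S3 (f : S3 → ℝ) : ∑ σ : S3, f σ = f 1 + f (Equiv.swap 0 1) + f (Equiv.swap 0 2) +
    f (Equiv.swap 1 2) + f (Equiv.swap 0 1 * Equiv.swap 1 2) +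
    f (Equiv.swap 1 2 * Equiv.swap 0 1) := by
  rw [univ_S3, Finset.sum_insert (by decide), Finset.sum_insert (by decide),
    Finset.sum_insert (by decide), Finset.sum_insert (by decide), Finset.sum_insert (by decide),
    Finset.sum_singleton]
  ring

theorem orbitWave_one_first (α : Fin 3 → ℝ) :
    orbitWave 1 ![1, 0, 0] α = 2 * ∑ i, cas (α i) := by
  rw [orbitWave, sum_S3]
  simp [phase, Fin.sum_univ_three, Equiv.swap_apply_def]
  ring

theorem orbitWave_one_last (α : Fin 3 → ℝ) :
    orbitWave 1 ![-1, 0, 0] α = 2 * ∑ i, cas (-α i) := by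
  rw [orbitWave, sum_S3]
  simp [phase, Fin.sum_univ_three, Equiv.swap_apply_def]
  ring

/-- The Weyl denominator formula for `A₂`. -/
theorem orbitWave_sign_weyl (α : Fin 3 → ℝ) :
    orbitWave Equiv.Perm.sign ![1, 0, -1] α = -8 * (Real.sin ((α 0 - α 1) / 2) *
      Real.sin ((α 1 - α 2) / 2) * Real.sin ((α 0 - α 2) / 2)) := by
  have h1 : orbitWave Equiv.Perm.sign ![1, 0, -1] α =
      2 * (Real.sin (α 0 - α 2) - Real.sin (α 0 - α 1) - Real.sin (α 1 - α 2)) := by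
    have s01 := charVal_sign_swap (i := 0) (j := 1) (by decide)
    have s02 := charVal_sign_swap (i := 0) (j := 2) (by decide)
    have s12 := charVal_sign_swap (i := 1) (j := 2) (by decide)
    rw [orbitWave, sum_S3]
    simp only [charVal_mul, s01, s02, s12, charVal_apply_one]
    simp [phase, Fin.sum_univ_three, Equiv.swap_apply_def, cas, Real.cos_add, Real.sin_add,
      Real.sin_sub]
    ring
  rw [h1]
  obtain ⟨x, hx⟩ : ∃ x, x = (α 0 - α 1) / 2 := ⟨_, rfl⟩
  obtain ⟨y, hy⟩ : ∃ y, y = (α 1 - α 2) / 2 := ⟨_, rfl⟩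
  have e1 : α 0 - α 1 = 2 * x := by linarith
  have e2 : α 1 - α 2 = 2 * y := by linarith
  have e3 : α 0 - α 2 = 2 * (x + y) := by linarith
  have e4 : (α 0 - α 2) / 2 = x + y := by linarith
  rw [e4, e3, ← hx, ← hy, e1, e2]
  simp only [Real.sin_two_mul, Real.sin_add, Real.cos_add]
  linear_combination (2 * 2 * Real.sin x * Real.cos x) * (Real.sin_sq_add_cos_sq y) +
    (2 * 2 * Real.sin y * Real.cos y) * (Real.sin_sq_add_cos_sq x)

/-- Three unimodular numbers with product `1` are determined, up to order, by their sum: the other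
elementary symmetric function is the conjugate of the sum. -/
theorem unimodular_triple_eq {z w : Fin 3 → ℂ} (hz : ∀ i, ‖z i‖ = 1) (hw : ∀ i, ‖w i‖ = 1)
    (hzp : z 0 * z 1 * z 2 = 1) (hwp : w 0 * w 1 * w 2 = 1)
    (hs : w 0 + w 1 + w 2 = z 0 + z 1 + z 2) : ∃ σ : S3, ∀ i, w i = z (σ i) := by
  have key : ∀ v : Fin 3 → ℂ, (∀ i, ‖v i‖ = 1) → v 0 * v 1 * v 2 = 1 →
      v 0 * v 1 + v 1 * v 2 + v 0 * v 2 = (starRingEnd ℂ) (v 0 + v 1 + v 2) := by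
    intro v hv hp
    have hc : ∀ i, v i * (starRingEnd ℂ) (v i) = 1 := fun i => by
      rw [Complex.mul_conj, Complex.normSq_eq_norm_sq, hv i]
      norm_num
    rw [map_add, map_add]
    linear_combination (-v 0 * v 1) * hc 2 - v 1 * v 2 * hc 0 - v 0 * v 2 * hc 1 +
      ((starRingEnd ℂ) (v 0) + (starRingEnd ℂ) (v 1) + (starRingEnd ℂ) (v 2)) * hp
  have h2 : w 0 * w 1 + w 1 * w 2 + w 0 * w 2 = z 0 * z 1 + z 1 * z 2 + z 0 * z 2 := by
    rw [key w hw hwp, key z hz hzp, hs]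
  have h3 : (w 0 - z 0) * ((w 0 - z 1) * (w 0 - z 2)) = 0 := by
    linear_combination w 0 ^ 2 * hs - w 0 * h2 + hwp - hzp
  have pair : ∀ a b c d : ℂ, a + b = c + d → a * b = c * d → (a = c ∧ b = d) ∨ (a = d ∧ b = c) := by
    intro a b c d h h'
    have : (a - c) * (a - d) = 0 := by linear_combination a * h - h'
    rcases mul_eq_zero.1 this with h1 | h1
    · exact Or.inl ⟨by linear_combination h1, by linear_combination h - h1⟩
    · exact Or.inr ⟨by linear_combination h1, by linear_combination h - h1⟩
  have w0 : w 0 ≠ 0 := norm_ne_zero_iff.1 (by rw [hw 0]; exact one_ne_zero)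
  rcases mul_eq_zero.1 h3 with h | h
  · have e : w 0 = z 0 := by linear_combination h
    have hp : w 1 * w 2 = z 1 * z 2 := mul_left_cancel₀ w0 (by
      rw [e] at hwp ⊢
      linear_combination hwp - hzp)
    rcases pair (w 1) (w 2) (z 1) (z 2) (by linear_combination hs - e) hp with ⟨h5, h6⟩ | ⟨h5, h6⟩
    · exact ⟨1, fun i => by fin_cases i <;> simp [e, h5, h6]⟩
    · exact ⟨Equiv.swap 1 2, fun i => by
        fin_cases i <;> simp [e, h5, h6, Equiv.swap_apply_def]⟩
  rcases mul_eq_zero.1 h with h | h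
  · have e : w 0 = z 1 := by linear_combination h
    have hp : w 1 * w 2 = z 0 * z 2 := mul_left_cancel₀ w0 (by
      rw [e] at hwp ⊢
      linear_combination hwp - hzp)
    rcases pair (w 1) (w 2) (z 0) (z 2) (by linear_combination hs - e) hp with ⟨h5, h6⟩ | ⟨h5, h6⟩
    · exact ⟨Equiv.swap 0 1, fun i => by
        fin_cases i <;> simp [e, h5, h6, Equiv.swap_apply_def]⟩
    · exact ⟨Equiv.swap 0 1 * Equiv.swap 1 2, fun i => by
        fin_cases i <;> simp [e, h5, h6, Equiv.swap_apply_def]⟩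
  · have e : w 0 = z 2 := by linear_combination h
    have hp : w 1 * w 2 = z 0 * z 1 := mul_left_cancel₀ w0 (by
      rw [e] at hwp ⊢
      linear_combination hwp - hzp)
    rcases pair (w 1) (w 2) (z 0) (z 1) (by linear_combination hs - e) hp with ⟨h5, h6⟩ | ⟨h5, h6⟩
    · exact ⟨Equiv.swap 1 2 * Equiv.swap 0 1, fun i => by
        fin_cases i <;> simp [e, h5, h6, Equiv.swap_apply_def]⟩
    · exact ⟨Equiv.swap 0 2, fun i => by
        fin_cases i <;> simp [e, h5, h6, Equiv.swap_apply_def]⟩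

/-- The closed alcove `a₀ ≥ a₁ ≥ a₂ ≥ a₀ - 1` meets each orbit of the affine Weyl group in at most
one point. -/
theorem eq_of_mem_alcove_of_perm {a b : Fin 3 → ℝ} (ha : a 0 + a 1 + a 2 = 0)
    (hb : b 0 + b 1 + b 2 = 0) (ha01 : a 1 ≤ a 0) (ha12 : a 2 ≤ a 1) (ha02 : a 0 - 1 ≤ a 2)
    (hb01 : b 1 ≤ b 0) (hb12 : b 2 ≤ b 1) (hb02 : b 0 - 1 ≤ b 2) {σ : S3} {n : Fin 3 → ℤ}
    (h : ∀ i, b i = a (σ i) + n i) : a = b := by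
  have hd : ∀ i j, a i - a j ≤ 1 := by
    intro i j
    fin_cases i <;> fin_cases j <;> simp <;> linarith
  have h0 := h 0
  have h1 := h 1
  have h2 := h 2
  have hsum : a (σ 0) + a (σ 1) + a (σ 2) = 0 := by
    rw [← ha, ← Fin.sum_univ_three, ← Fin.sum_univ_three fun i => a (σ i)]
    exact Equiv.sum_comp σ a
  have hn : n 0 + n 1 + n 2 = 0 := by
    have : ((n 0 + n 1 + n 2 : ℤ) : ℝ) = 0 := by push_cast; linarith
    exact_mod_cast this
  have b1 : n 0 - n 1 ≤ 2 := by
    have : ((n 0 - n 1 : ℤ) : ℝ) ≤ 2 := by push_cast; linarith [hd (σ 1) (σ 0)]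
    exact_mod_cast this
  have b2 : -1 ≤ n 0 - n 1 := by
    have : (-1 : ℝ) ≤ ((n 0 - n 1 : ℤ) : ℝ) := by push_cast; linarith [hd (σ 0) (σ 1)]
    exact_mod_cast this
  have b3 : n 1 - n 2 ≤ 2 := by
    have : ((n 1 - n 2 : ℤ) : ℝ) ≤ 2 := by push_cast; linarith [hd (σ 2) (σ 1)]
    exact_mod_cast this
  have b4 : -1 ≤ n 1 - n 2 := by
    have : (-1 : ℝ) ≤ ((n 1 - n 2 : ℤ) : ℝ) := by push_cast; linarith [hd (σ 1) (σ 2)]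
    exact_mod_cast this
  have e2 : n 2 = -n 0 - n 1 := by omega
  have l0 : -1 ≤ n 0 := by omega
  have u0 : n 0 ≤ 2 := by omega
  have l1 : -1 ≤ n 1 := by omega
  have u1 : n 1 ≤ 1 := by omega
  have i01 : σ 0 ≠ σ 1 := σ.injective.ne (by decide)
  have i02 : σ 0 ≠ σ 2 := σ.injective.ne (by decide)
  have i12 : σ 1 ≠ σ 2 := σ.injective.ne (by decide)
  suffices a 0 = b 0 ∧ a 1 = b 1 by
    ext i
    fin_cases i
    · exact this.1
    · exact this.2
    · change a 2 = b 2
      linarith [this.1, this.2]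
  rw [e2] at h2 b3 b4
  clear h hd hn e2
  generalize n 0 = m0 at *
  generalize n 1 = m1 at *
  generalize σ 0 = s0 at *
  generalize σ 1 = s1 at *
  generalize σ 2 = s2 at *
  interval_cases m0 <;> interval_cases m1 <;> first
    | omega
    | (fin_cases s0 <;> fin_cases s1 <;> fin_cases s2 <;> simp at i01 i02 i12 h0 h1 h2 <;>
        constructor <;> linarith)

theorem eq_of_sum_cos_eq {α β : Fin 3 → ℝ} (hα : ∑ i, α i = 0) (hβ : ∑ i, β i = 0)
    (hα01 : α 1 ≤ α 0) (hα12 : α 2 ≤ α 1) (hα02 : α 0 - 2 * Real.pi ≤ α 2)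
    (hβ01 : β 1 ≤ β 0) (hβ12 : β 2 ≤ β 1) (hβ02 : β 0 - 2 * Real.pi ≤ β 2)
    (hc : ∑ i, Real.cos (α i) = ∑ i, Real.cos (β i))
    (hs : ∑ i, Real.sin (α i) = ∑ i, Real.sin (β i)) : α = β := by
  have hprod : ∀ γ : Fin 3 → ℝ, ∑ i, γ i = 0 → Complex.exp (γ 0 * Complex.I) *
      Complex.exp (γ 1 * Complex.I) * Complex.exp (γ 2 * Complex.I) = 1 := by
    intro γ hγ
    rw [← Complex.exp_add, ← Complex.exp_add, ← add_mul, ← add_mul]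
    rw [Fin.sum_univ_three] at hγ
    have : (γ 0 + γ 1 + γ 2 : ℂ) = 0 := by exact_mod_cast hγ
    rw [this, zero_mul, Complex.exp_zero]
  have hsum : ∀ γ : Fin 3 → ℝ, Complex.exp (γ 0 * Complex.I) + Complex.exp (γ 1 * Complex.I) +
      Complex.exp (γ 2 * Complex.I) =
      ((∑ i, Real.cos (γ i) : ℝ) : ℂ) + ((∑ i, Real.sin (γ i) : ℝ) : ℂ) * Complex.I := by
    intro γ
    simp only [Complex.exp_mul_I, Fin.sum_univ_three]
    push_cast
    ring
  obtain ⟨σ, hσ⟩ := unimodular_triple_eq (z := fun i => Complex.exp (α i * Complex.I))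
    (w := fun i => Complex.exp (β i * Complex.I)) (fun i => Complex.norm_exp_ofReal_mul_I _)
    (fun i => Complex.norm_exp_ofReal_mul_I _) (hprod α hα) (hprod β hβ)
    (by rw [hsum, hsum, hc, hs])
  have hn : ∀ i, ∃ n : ℤ, β i = α (σ i) + n * (2 * Real.pi) := by
    intro i
    obtain ⟨n, hn⟩ := Complex.exp_eq_exp_iff_exists_int.1 (hσ i)
    refine ⟨n, ?_⟩
    have h2 : ((β i : ℂ)) * Complex.I = ((α (σ i) + n * (2 * Real.pi) : ℝ) : ℂ) * Complex.I := by
      rw [hn]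
      push_cast
      ring
    exact_mod_cast mul_right_cancel₀ Complex.I_ne_zero h2
  choose n hn using hn
  have hpi := Real.two_pi_pos
  rw [Fin.sum_univ_three] at hα hβ
  have := eq_of_mem_alcove_of_perm (a := fun i => α i / (2 * Real.pi))
    (b := fun i => β i / (2 * Real.pi)) (by field_simp; linarith) (by field_simp; linarith)
    (by gcongr) (by gcongr) (by field_simp; linarith) (by gcongr) (by gcongr)
    (by field_simp; linarith) (σ := σ) (n := n) (fun i => by rw [hn i]; field_simp)
  ext i
  have h2 : α i / (2 * Real.pi) = β i / (2 * Real.pi) := congrFun this i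
  field_simp at h2
  exact h2

section density

variable {a : Fin 3 → Plane} {A : Plane} {q : ℝ}

/-- The symmetrized waves separate the points of the closed alcove. -/
theorem IsA2Frame.eq_of_planeWave_eq (ha : IsA2Frame a q) {x y : Plane}
    (hx : x ∈ closure (alcove a A)) (hy : y ∈ closure (alcove a A))
    (h : ∀ k, planeWave a A 1 k x = planeWave a A 1 k y) : x = y := by
  have hpi := Real.two_pi_pos
  have hcl : ∀ z ∈ closure (alcove a A), ∀ j,
      2 * Real.pi * (-((![0, 0, 1] : Fin 3 → ℤ) j : ℝ)) ≤
        angles a A z j - angles a A z (j + 1) := by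
    intro z hz j
    have : IsClosed {z : Plane | 0 ≤ alcoveConst a A j + inner ℝ (alcoveNormal a j) z} :=
      isClosed_le continuous_const (by fun_prop)
    have h1 : 0 ≤ alcoveConst a A j + inner ℝ (alcoveNormal a j) z :=
      closure_minimal (fun z hz => (hz j).le : alcove a A ⊆ _) this hz
    rw [angles_sub_angles]
    gcongr
    linarith
  have hx0 := hcl x hx 0
  have hx1 := hcl x hx 1
  have hx2 := hcl x hx 2
  have hy0 := hcl y hy 0
  have hy1 := hcl y hy 1
  have hy2 := hcl y hy 2
  simp at hx0 hx1 hx2 hy0 hy1 hy2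
  have h1 := h ![1, 0, 0]
  have h2 := h ![-1, 0, 0]
  simp only [planeWave, orbitWave_one_first, orbitWave_one_last, cas, Real.cos_neg, Real.sin_neg,
    Finset.sum_add_distrib, Finset.sum_neg_distrib] at h1 h2
  exact ha.ext_angles (A := A) fun i => congrFun (eq_of_sum_cos_eq (ha.sum_angles x)
    (ha.sum_angles y) hx0 hx1 (by linarith) hy0 hy1 (by linarith) (by linarith) (by linarith)) i

/-- A symmetrized wave as a continuous function. -/
noncomputable def waveMap (a : Fin 3 → Plane) (A : Plane) (k : Fin 3 → ℤ) : C(Plane, ℝ) :=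
  ⟨planeWave a A 1 k, (contDiff_planeWave 1 k).continuous⟩

/-- The algebra of trigonometric polynomials that are symmetric in the three angles. -/
noncomputable def waveAlgebra (a : Fin 3 → Plane) (A : Plane) : Subalgebra ℝ C(Plane, ℝ) :=
  (Submodule.span ℝ (Set.range (waveMap a A))).toSubalgebra
    (by
      have h : (6 : ℝ)⁻¹ • waveMap a A 0 = 1 := by
        ext x
        have h0 : phase 0 (angles a A x) = 0 := by simp [phase]
        simp [waveMap, planeWave, orbitWave, h0, cas, Fintype.card_perm, Nat.factorial]
      rw [← h]
      exact Submodule.smul_mem _ _ (Submodule.subset_span ⟨0, rfl⟩))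
    (by
      have h : Submodule.span ℝ (Set.range (waveMap a A)) *
          Submodule.span ℝ (Set.range (waveMap a A)) ≤
          Submodule.span ℝ (Set.range (waveMap a A)) := by
        rw [Submodule.span_mul_span, Submodule.span_le]
        rintro _ ⟨_, ⟨k, rfl⟩, _, ⟨l, rfl⟩, rfl⟩
        have e : waveMap a A k * waveMap a A l = ∑ τ : S3, (2 : ℝ)⁻¹ •
            (waveMap a A (k - l ∘ τ) + waveMap a A (l ∘ τ - k) + waveMap a A (k + l ∘ τ)
              - waveMap a A (-k - l ∘ τ)) := by
          ext x
          have := orbitWave_mul 1 1 k l (angles a A x)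
          simp only [charVal_one, one_mul, mul_one] at this
          simp only [ContinuousMap.mul_apply, ContinuousMap.coe_sum, Finset.sum_apply,
            ContinuousMap.smul_apply, ContinuousMap.add_apply, ContinuousMap.sub_apply, waveMap,
            ContinuousMap.coe_mk, planeWave, smul_eq_mul]
          rw [this]
          exact Finset.sum_congr rfl fun τ _ => by ring
        simp only [SetLike.mem_coe]
        have hw : ∀ k, waveMap a A k ∈ Submodule.span ℝ (Set.range (waveMap a A)) :=
          fun k => Submodule.subset_span ⟨k, rfl⟩
        rw [e]
        exact Submodule.sum_mem _ fun τ _ => Submodule.smul_mem _ _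
          (Submodule.sub_mem _ (Submodule.add_mem _ (Submodule.add_mem _ (hw _) (hw _)) (hw _))
            (hw _))
      exact fun x y hx hy => h (Submodule.mul_mem_mul hx hy))

/-- An integrable function on the alcove that is orthogonal to all symmetric waves vanishes, by
the Stone–Weierstrass theorem. -/
theorem IsA2Frame.ae_eq_zero_of_integral_planeWave (ha : IsA2Frame a q)
    (hb : Bornology.IsBounded (alcove a A)) {u : Plane → ℝ}
    (hu : Integrable u (volume.restrict (alcove a A)))
    (h : ∀ k, ∫ x in alcove a A, planeWave a A 1 k x * u x = 0) :
    u =ᵐ[volume.restrict (alcove a A)] 0 := by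
  have hm : MeasurableSet (alcove a A) := isOpen_alcove.measurableSet
  have hint : ∀ g : C(Plane, ℝ), Integrable (fun x => g x * u x)
      (volume.restrict (alcove a A)) := by
    intro g
    obtain ⟨C, hC0, hC⟩ := g.continuous.exists_bound_of_isBounded hb
    exact hu.bdd_mul (c := C) g.continuous.aestronglyMeasurable
      ((ae_restrict_iff' hm).2 (ae_of_all _ hC))
  have halg : ∀ g ∈ waveAlgebra a A, ∫ x in alcove a A, g x * u x = 0 := by
    intro g hg'
    have hg : g ∈ Submodule.span ℝ (Set.range (waveMap a A)) := hg'
    clear hg'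
    induction hg using Submodule.span_induction with
    | zero => simp
    | mem g hg =>
      obtain ⟨k, rfl⟩ := hg
      exact h k
    | add f g _ _ hf hg =>
      simp only [ContinuousMap.add_apply, add_mul]
      rw [integral_add (hint f) (hint g), hf, hg, add_zero]
    | smul c f _ hf =>
      simp only [ContinuousMap.smul_apply, smul_eq_mul, mul_assoc]
      rw [integral_const_mul, hf, mul_zero]
  have hall : ∀ g : C(Plane, ℝ), ∫ x in alcove a A, g x * u x = 0 := by
    intro g
    have hK : IsCompact (closure (alcove a A)) := hb.isCompact_closure
    have := isCompact_iff_compactSpace.1 hK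
    let ι : C(closure (alcove a A), Plane) := ⟨Subtype.val, continuous_subtype_val⟩
    let R := (waveAlgebra a A).map (ContinuousMap.compRightAlgHom ℝ ℝ ι)
    have hR : R.SeparatesPoints := by
      intro x y hxy
      by_contra hcon
      push Not at hcon
      refine hxy (Subtype.ext (ha.eq_of_planeWave_eq x.2 y.2 fun k => ?_))
      exact hcon _ ⟨_, ⟨waveMap a A k, Submodule.subset_span ⟨k, rfl⟩, rfl⟩, rfl⟩
    have hsmall : ∀ ε : ℝ, 0 < ε →
        |∫ x in alcove a A, g x * u x| ≤ ε * ∫ x in alcove a A, |u x| := by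
      intro ε hε
      obtain ⟨⟨_, f, hf, rfl⟩, hfg⟩ :=
        ContinuousMap.exists_mem_subalgebra_near_continuous_of_separatesPoints R hR
          (fun x => g x) (by fun_prop) ε hε
      have e : ∫ x in alcove a A, g x * u x = ∫ x in alcove a A, (g x * u x - f x * u x) := by
        rw [integral_sub (hint g) (hint f), halg f hf, sub_zero]
      rw [e, ← integral_const_mul, ← Real.norm_eq_abs]
      refine norm_integral_le_of_norm_le (hu.abs.const_mul _)
        ((ae_restrict_iff' hm).2 (ae_of_all _ fun x hx => ?_))
      rw [← sub_mul, norm_mul, norm_sub_rev, Real.norm_eq_abs (u x)]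
      gcongr
      exact (hfg ⟨x, subset_closure hx⟩).le
    by_contra hne
    have hpos : 0 < |∫ x in alcove a A, g x * u x| := abs_pos.2 hne
    set I := ∫ x in alcove a A, |u x| with hI
    have hI0 : 0 ≤ I := integral_nonneg fun x => abs_nonneg _
    have h1 := hsmall (|∫ x in alcove a A, g x * u x| / (2 * (I + 1))) (by positivity)
    have h2 : |∫ x in alcove a A, g x * u x| / (2 * (I + 1)) * I <
        |∫ x in alcove a A, g x * u x| := by
      rw [div_mul_eq_mul_div, div_lt_iff₀ (by positivity)]
      nlinarith
    linarith
  have hae := isOpen_alcove.ae_eq_zero_of_integral_contDiff_smul_eq_zero (μ := volume)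
    (f := u) (U := alcove a A) (IntegrableOn.locallyIntegrableOn hu) (by
      intro g hg _ hgs
      rw [← setIntegral_eq_integral_of_forall_compl_eq_zero (s := alcove a A)]
      · exact hall ⟨g, hg.continuous⟩
      · intro x hx
        rw [image_eq_zero_of_notMem_tsupport fun h => hx (hgs h), zero_smul])
  exact (ae_restrict_iff' hm).2 hae

/-- The symmetric waves with dominant frequencies are complete in `L²`. -/
theorem IsA2Frame.eq_zero_of_inner_neumann (ha : IsA2Frame a q)
    (hb : Bornology.IsBounded (alcove a A)) (u : L2 (alcove a A) ℝ)
    (h : ∀ p, inner ℝ (restrictL2 (alcove a A) (planeWave a A 1 (dominant p))) u = 0) : u = 0 := by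
  have hm : MeasurableSet (alcove a A) := isOpen_alcove.measurableSet
  rw [Lp.eq_zero_iff_ae_eq_zero]
  refine ha.ae_eq_zero_of_integral_planeWave hb (integrable_of_L2 hb u) fun k => ?_
  obtain ⟨σ, p, hp⟩ := orbitWave_eq_dominant k
  have h1 := h p
  rw [inner_restrictL2 hb hm (contDiff_planeWave 1 _).continuous] at h1
  have h2 : ∀ x, planeWave a A 1 k x = planeWave a A 1 (dominant p) x := fun x => by
    rw [planeWave, hp 1 _ (ha.sum_angles x), charVal_one, one_mul]
    rfl
  simp_rw [h2]
  rw [← h1]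
  refine integral_congr_ae (ae_of_all _ fun x => ?_)
  simp [mul_comm]

theorem planeWave_weyl_ne_zero {x : Plane} (hx : x ∈ alcove a A) :
    planeWave a A Equiv.Perm.sign ![1, 0, -1] x ≠ 0 := by
  have hpi := Real.pi_pos
  have h : ∀ j, 2 * Real.pi * (-((![0, 0, 1] : Fin 3 → ℤ) j : ℝ)) <
      angles a A x j - angles a A x (j + 1) := by
    intro j
    have := hx j
    rw [angles_sub_angles]
    gcongr
    linarith
  have h0 := h 0
  have h1 := h 1
  have h2 := h 2
  simp at h0 h1 h2
  have p1 := Real.sin_pos_of_pos_of_lt_pi (x := (angles a A x 0 - angles a A x 1) / 2)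
    (by linarith) (by linarith)
  have p2 := Real.sin_pos_of_pos_of_lt_pi (x := (angles a A x 1 - angles a A x 2) / 2)
    (by linarith) (by linarith)
  have p3 := Real.sin_pos_of_pos_of_lt_pi (x := (angles a A x 0 - angles a A x 2) / 2)
    (by linarith) (by linarith)
  rw [planeWave, orbitWave_sign_weyl]
  have := mul_pos (mul_pos p1 p2) p3
  linarith

/-- The antisymmetric waves with regular dominant frequencies are complete in `L²`: products of
the Weyl denominator, which has no zeros in the alcove, with symmetric waves are combinations of
antisymmetric waves. -/
theorem IsA2Frame.eq_zero_of_inner_dirichlet (ha : IsA2Frame a q)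
    (hb : Bornology.IsBounded (alcove a A)) (u : L2 (alcove a A) ℝ)
    (h : ∀ p : ℕ × ℕ, inner ℝ (restrictL2 (alcove a A)
      (planeWave a A Equiv.Perm.sign (dominant (p.1 + 1, p.2 + 1)))) u = 0) : u = 0 := by
  have hm : MeasurableSet (alcove a A) := isOpen_alcove.measurableSet
  have hw : ∀ k, Integrable (fun x => planeWave a A Equiv.Perm.sign k x * u x)
      (volume.restrict (alcove a A)) := by
    intro k
    have hc := (contDiff_planeWave (a := a) (A := A) Equiv.Perm.sign k).continuous
    obtain ⟨C, hC0, hC⟩ := hc.exists_bound_of_isBounded hb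
    exact (integrable_of_L2 hb u).bdd_mul (c := C) hc.aestronglyMeasurable
      ((ae_restrict_iff' hm).2 (ae_of_all _ hC))
  have hk : ∀ k, ∫ x in alcove a A, planeWave a A Equiv.Perm.sign k x * u x = 0 := by
    intro k
    obtain ⟨σ, p, hp⟩ := orbitWave_eq_dominant k
    have h2 : ∀ x, planeWave a A Equiv.Perm.sign k x * u x =
        charVal Equiv.Perm.sign σ * (planeWave a A Equiv.Perm.sign (dominant p) x * u x) := by
      intro x
      rw [planeWave, hp _ _ (ha.sum_angles x), mul_assoc]
      rfl
    simp_rw [h2]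
    rw [integral_const_mul]
    obtain ⟨m, n⟩ := p
    rcases Nat.eq_zero_or_pos m with rfl | hm0
    · simp_rw [planeWave]
      simp [orbitWave_sign_eq_zero (k := dominant (0, n)) (i := 0) (j := 1) (by decide)
        (by simp [dominant])]
    rcases Nat.eq_zero_or_pos n with rfl | hn0
    · simp_rw [planeWave]
      simp [orbitWave_sign_eq_zero (k := dominant (m, 0)) (i := 1) (j := 2) (by decide)
        (by simp [dominant])]
    have h1 := h (m - 1, n - 1)
    simp only [Nat.sub_add_cancel hm0, Nat.sub_add_cancel hn0] at h1
    rw [inner_restrictL2 hb hm (contDiff_planeWave _ _).continuous] at h1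
    rw [mul_eq_zero]
    right
    rw [← h1]
    refine integral_congr_ae (ae_of_all _ fun x => ?_)
    simp [mul_comm]
  have h0 : (fun x => planeWave a A Equiv.Perm.sign ![1, 0, -1] x * u x)
      =ᵐ[volume.restrict (alcove a A)] 0 := by
    refine ha.ae_eq_zero_of_integral_planeWave hb (hw _) fun l => ?_
    have e : ∀ x, planeWave a A 1 l x * (planeWave a A Equiv.Perm.sign ![1, 0, -1] x * u x) =
        ∑ τ : S3, 2⁻¹ * (planeWave a A Equiv.Perm.sign (![1, 0, -1] - l ∘ τ) x * u x
          + planeWave a A Equiv.Perm.sign (l ∘ τ - ![1, 0, -1]) x * u x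
          + planeWave a A Equiv.Perm.sign (![1, 0, -1] + l ∘ τ) x * u x
          - planeWave a A Equiv.Perm.sign (-![1, 0, -1] - l ∘ τ) x * u x) := by
      intro x
      have := orbitWave_mul Equiv.Perm.sign 1 ![1, 0, -1] l (angles a A x)
      simp only [charVal_one, one_mul, mul_one] at this
      rw [← mul_assoc, mul_comm (planeWave a A 1 l x)]
      simp only [planeWave]
      rw [this, Finset.sum_mul]
      exact Finset.sum_congr rfl fun τ _ => by ring
    simp_rw [e]
    have hw2 : ∀ k l, Integrable (fun x => planeWave a A Equiv.Perm.sign k x * u x +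
        planeWave a A Equiv.Perm.sign l x * u x) (volume.restrict (alcove a A)) :=
      fun k l => (hw k).add (hw l)
    have hw3 : ∀ k l m, Integrable (fun x => planeWave a A Equiv.Perm.sign k x * u x +
        planeWave a A Equiv.Perm.sign l x * u x + planeWave a A Equiv.Perm.sign m x * u x)
        (volume.restrict (alcove a A)) :=
      fun k l m => (hw2 k l).add (hw m)
    rw [integral_finsetSum]
    · refine Finset.sum_eq_zero fun τ _ => ?_
      rw [integral_const_mul, integral_sub (hw3 _ _ _) (hw _), integral_add (hw2 _ _) (hw _),
        integral_add (hw _) (hw _), hk, hk, hk, hk]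
      simp
    · exact fun τ _ => ((((hw _).add (hw _)).add (hw _)).sub (hw _)).const_mul _
  rw [Lp.eq_zero_iff_ae_eq_zero]
  filter_upwards [h0, ae_restrict_mem hm] with x hx hxm
  exact (mul_eq_zero.1 hx).resolve_left (planeWave_weyl_ne_zero hxm)

end density

/-! ### Eigenspaces and the heat trace -/

section spectral

variable {Ω : Set Plane} {V : Submodule ℝ (L2 Ω ℝ × L2 Ω Plane)}

theorem inner_eq_zero_of_mem_laplaceEigenspace {lam mu : ℝ} (h : lam ≠ mu) {u v : L2 Ω ℝ}
    (hu : u ∈ laplaceEigenspace V lam) (hv : v ∈ laplaceEigenspace V mu) : inner ℝ u v = 0 := by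
  obtain ⟨G, hG, -, hG'⟩ := hu
  obtain ⟨H, hH, -, hH'⟩ := hv
  have h1 := hG' _ hH
  have h2 := hH' _ hG
  simp only at h1 h2
  rw [real_inner_comm, h1, real_inner_comm u v] at h2
  exact (mul_eq_mul_right_iff.1 h2).resolve_left h

/-- If a complete system in `L²(Ω)` consists of eigenfunctions, with finitely many for each
eigenvalue, then those with eigenvalue `lam` span the eigenspace of `lam`. -/
theorem laplaceEigenspace_eq_span {ι : Type} {f : ι → L2 Ω ℝ} {ev : ι → ℝ}
    (hmem : ∀ p, f p ∈ laplaceEigenspace V (ev p))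
    (hfin : ∀ lam, {p | ev p = lam}.Finite)
    (hcomplete : ∀ u, (∀ p, inner ℝ (f p) u = 0) → u = 0) (lam : ℝ) :
    laplaceEigenspace V lam =
      Submodule.span ℝ (Set.range fun p : {p // ev p = lam} => f p) := by
  refine le_antisymm (fun u hu => ?_) (Submodule.span_le.2 ?_)
  · set S := Submodule.span ℝ (Set.range fun p : {p // ev p = lam} => f p) with hS
    have : Finite {p // ev p = lam} := hfin lam
    have hfd : FiniteDimensional ℝ S := FiniteDimensional.span_of_finite ℝ (Set.finite_range _)
    have hSV : S ≤ laplaceEigenspace V lam := Submodule.span_le.2 (by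
      rintro _ ⟨⟨p, rfl⟩, rfl⟩
      exact hmem p)
    have hw : u - S.starProjection u = 0 := by
      refine hcomplete _ fun p => ?_
      by_cases hp : ev p = lam
      · exact Submodule.sub_starProjection_mem_orthogonal (K := S) u _
          (Submodule.subset_span ⟨⟨p, hp⟩, rfl⟩)
      · exact inner_eq_zero_of_mem_laplaceEigenspace hp (hmem p)
          (sub_mem hu (hSV (Submodule.starProjection_apply_mem S u)))
    rw [sub_eq_zero.1 hw]
    exact Submodule.starProjection_apply_mem S u
  · rintro _ ⟨⟨p, rfl⟩, rfl⟩
    exact hmem p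

/-- The heat trace is the sum over the members of a complete orthogonal system of
eigenfunctions. -/
theorem heatTrace_eq_tsum {ι : Type} {f : ι → L2 Ω ℝ} {ev : ι → ℝ}
    (hmem : ∀ p, f p ∈ laplaceEigenspace V (ev p)) (hne : ∀ p, f p ≠ 0)
    (horth : ∀ p p', p ≠ p' → inner ℝ (f p) (f p') = 0)
    (hfin : ∀ lam, {p | ev p = lam}.Finite)
    (hcomplete : ∀ u, (∀ p, inner ℝ (f p) u = 0) → u = 0) (t : ℝ) :
    heatTrace V t = ∑' p, ENNReal.ofReal (Real.exp (-ev p * t)) := by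
  have hli : LinearIndependent ℝ f :=
    linearIndependent_of_ne_zero_of_inner_eq_zero hne fun p p' h => horth p p' h
  rw [heatTrace, ← (Equiv.sigmaFiberEquiv ev).tsum_eq, ENNReal.tsum_sigma']
  refine tsum_congr fun lam => ?_
  have hrank : Module.rank ℝ (laplaceEigenspace V lam) = Cardinal.mk {p // ev p = lam} := by
    have hli' : LinearIndependent ℝ fun p : {p // ev p = lam} => f p :=
      hli.comp _ Subtype.val_injective
    rw [laplaceEigenspace_eq_span hmem hfin hcomplete, rank_span hli',
      Cardinal.mk_range_eq _ hli'.injective]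
  have h2 : ∀ p : {p // ev p = lam}, ENNReal.ofReal (Real.exp
      (-ev ((Equiv.sigmaFiberEquiv ev) ⟨lam, p⟩) * t)) = ENNReal.ofReal (Real.exp (-lam * t)) := by
    rintro ⟨p, rfl⟩
    rfl
  simp_rw [h2]
  rw [hrank, ENNReal.tsum_const]
  rfl

end spectral

section orthogonality

variable {a : Fin 3 → Plane} {A : Plane} {q : ℝ}

theorem IsA2Frame.integral_planeWave_one_of_const (ha : IsA2Frame a q) {k : Fin 3 → ℤ}
    (hk : ∀ i, k i = k 0) :
    ∫ x in alcove a A, planeWave a A 1 k x = 6 * volume.real (alcove a A) := by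
  have h : ∀ x, planeWave a A 1 k x = 6 := by
    intro x
    have h0 : ∀ σ : S3, phase (k ∘ σ) (angles a A x) = 0 := by
      intro σ
      rw [phase_angles, freqVec_eq_zero_of_const ha fun i => by simp [hk (σ i), hk (σ 0)],
        inner_zero_left]
    simp [planeWave, orbitWave, h0, cas, Fintype.card_perm, Nat.factorial]
  simp_rw [h]
  simp [mul_comm]

/-- Nonconstant symmetric waves have mean zero, being orthogonal to the constant eigenfunction. -/
theorem IsA2Frame.integral_planeWave_one (ha : IsA2Frame a q)
    (hb : Bornology.IsBounded (alcove a A)) {k : Fin 3 → ℤ} (hk : ¬∀ i, k i = k 0) :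
    ∫ x in alcove a A, planeWave a A 1 k x = 0 := by
  have hm : MeasurableSet (alcove a A) := isOpen_alcove.measurableSet
  have h1 := ha.restrictL2_planeWave_mem_neumann (A := A) hb k
  have h2 := ha.restrictL2_planeWave_mem_neumann (A := A) hb 0
  have hz : freqVec a 0 = 0 := freqVec_eq_zero_of_const ha fun i => rfl
  have hne : ‖freqVec a k‖ ^ 2 ≠ ‖freqVec a 0‖ ^ 2 := by
    rw [hz, norm_zero, zero_pow two_ne_zero]
    intro h
    exact hk fun i => ha.eq_of_freqVec_eq_zero (norm_eq_zero.1 (pow_eq_zero_iff two_ne_zero |>.1 h))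
      i 0
  have h3 := inner_eq_zero_of_mem_laplaceEigenspace hne h1 h2
  rw [inner_restrictL2 hb hm (contDiff_planeWave _ _).continuous] at h3
  have h4 : ∫ x in alcove a A, planeWave a A 1 k x * 6 = 0 := by
    rw [← h3]
    refine integral_congr_ae ?_
    filter_upwards [restrictL2_ae_eq hb hm (contDiff_planeWave (a := a) (A := A) 1 0).continuous]
      with x hx
    have h0 : phase 0 (angles a A x) = 0 := by simp [phase]
    rw [hx]
    simp [planeWave, orbitWave, h0, cas, Fintype.card_perm, Nat.factorial, mul_comm]
  rw [integral_mul_const] at h4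
  exact (mul_eq_zero.1 h4).resolve_right (by norm_num)

theorem IsA2Frame.integral_planeWave_one_neg (ha : IsA2Frame a q)
    (hb : Bornology.IsBounded (alcove a A)) (k : Fin 3 → ℤ) :
    ∫ x in alcove a A, planeWave a A 1 (-k) x = ∫ x in alcove a A, planeWave a A 1 k x := by
  by_cases hk : ∀ i, k i = k 0
  · rw [ha.integral_planeWave_one_of_const hk,
      ha.integral_planeWave_one_of_const (k := -k) fun i => by simp [hk i]]
  · rw [ha.integral_planeWave_one hb hk,
      ha.integral_planeWave_one hb (k := -k) fun h => hk fun i => by simpa using h i]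

/-- In the product formula the terms with `k - l ∘ τ` and its negative have equal integrals, and
those with `k + l ∘ τ` and its negative cancel. -/
theorem IsA2Frame.inner_planeWave (ha : IsA2Frame a q) (hb : Bornology.IsBounded (alcove a A))
    (χ : S3 →* ℤˣ) (k l : Fin 3 → ℤ) :
    inner ℝ (restrictL2 (alcove a A) (planeWave a A χ k))
      (restrictL2 (alcove a A) (planeWave a A χ l)) =
    ∑ τ : S3, charVal χ τ * ∫ x in alcove a A, planeWave a A 1 (k - l ∘ τ) x := by
  have hm : MeasurableSet (alcove a A) := isOpen_alcove.measurableSet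
  rw [inner_restrictL2 hb hm (contDiff_planeWave _ _).continuous]
  have hw : ∀ k, Integrable (fun x => planeWave a A 1 k x) (volume.restrict (alcove a A)) := by
    intro k
    have := hb.isFiniteMeasure_restrict
    exact ((contDiff_planeWave 1 k).continuous.memLp_of_isBounded hb hm).integrable one_le_two
  have hw2 : ∀ k l, Integrable (fun x => planeWave a A 1 k x + planeWave a A 1 l x)
      (volume.restrict (alcove a A)) := fun k l => (hw k).add (hw l)
  have hw3 : ∀ k l m, Integrable (fun x => planeWave a A 1 k x + planeWave a A 1 l x +
      planeWave a A 1 m x) (volume.restrict (alcove a A)) := fun k l m => (hw2 k l).add (hw m)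
  have hw4 : ∀ k l m n, Integrable (fun x => planeWave a A 1 k x + planeWave a A 1 l x +
      planeWave a A 1 m x - planeWave a A 1 n x) (volume.restrict (alcove a A)) :=
    fun k l m n => (hw3 k l m).sub (hw n)
  have e : ∫ x in alcove a A, inner ℝ (planeWave a A χ k x)
      (restrictL2 (alcove a A) (planeWave a A χ l) x) = ∫ x in alcove a A, ∑ τ : S3,
      charVal χ τ * ((planeWave a A 1 (k - l ∘ τ) x + planeWave a A 1 (l ∘ τ - k) x
        + planeWave a A 1 (k + l ∘ τ) x - planeWave a A 1 (-k - l ∘ τ) x) / 2) := by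
    refine integral_congr_ae ?_
    filter_upwards [restrictL2_ae_eq hb hm (contDiff_planeWave (a := a) (A := A) χ l).continuous]
      with x hx
    have := orbitWave_mul χ χ k l (angles a A x)
    rw [character_mul_self] at this
    rw [hx, RCLike.inner_apply, conj_trivial, mul_comm]
    exact this
  rw [e, integral_finsetSum _ fun τ _ => ((hw4 _ _ _ _).div_const 2).const_mul _]
  refine Finset.sum_congr rfl fun τ _ => ?_
  rw [integral_const_mul, integral_div, integral_sub (hw3 _ _ _) (hw _),
    integral_add (hw2 _ _) (hw _), integral_add (hw _) (hw _), ← neg_sub k (l ∘ τ),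
    ha.integral_planeWave_one_neg hb, ← neg_add', ha.integral_planeWave_one_neg hb]
  ring

theorem IsA2Frame.inner_planeWave_dominant (ha : IsA2Frame a q)
    (hb : Bornology.IsBounded (alcove a A)) (χ : S3 →* ℤˣ) {p p' : ℕ × ℕ} (h : p ≠ p') :
    inner ℝ (restrictL2 (alcove a A) (planeWave a A χ (dominant p)))
      (restrictL2 (alcove a A) (planeWave a A χ (dominant p'))) = 0 := by
  rw [ha.inner_planeWave hb]
  refine Finset.sum_eq_zero fun τ _ => ?_
  rw [ha.integral_planeWave_one hb (k := dominant p - dominant p' ∘ τ)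
    (fun hc => h (dominant_eq_of_comp hc)), mul_zero]

theorem IsA2Frame.restrictL2_planeWave_one_ne_zero (ha : IsA2Frame a q)
    (hb : Bornology.IsBounded (alcove a A)) (hne : (alcove a A).Nonempty) (p : ℕ × ℕ) :
    restrictL2 (alcove a A) (planeWave a A 1 (dominant p)) ≠ 0 := by
  have hpos : 0 < volume.real (alcove a A) :=
    ENNReal.toReal_pos (isOpen_alcove.measure_pos _ hne).ne' hb.measure_lt_top.ne
  rw [← inner_self_ne_zero (𝕜 := ℝ), ha.inner_planeWave hb]
  refine (Finset.sum_pos' (fun τ _ => ?_) ⟨1, Finset.mem_univ _, ?_⟩).ne'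
  · rw [charVal_one, one_mul]
    by_cases hk : ∀ i, (dominant p - dominant p ∘ τ) i = (dominant p - dominant p ∘ τ) 0
    · rw [ha.integral_planeWave_one_of_const hk]
      positivity
    · rw [ha.integral_planeWave_one hb hk]
  · rw [charVal_one, one_mul, ha.integral_planeWave_one_of_const fun i => by simp]
    positivity

theorem IsA2Frame.restrictL2_planeWave_sign_ne_zero (ha : IsA2Frame a q)
    (hb : Bornology.IsBounded (alcove a A)) (hne : (alcove a A).Nonempty) {p : ℕ × ℕ}
    (h1 : 0 < p.1) (h2 : 0 < p.2) :
    restrictL2 (alcove a A) (planeWave a A Equiv.Perm.sign (dominant p)) ≠ 0 := by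
  have hpos : 0 < volume.real (alcove a A) :=
    ENNReal.toReal_pos (isOpen_alcove.measure_pos _ hne).ne' hb.measure_lt_top.ne
  rw [← inner_self_ne_zero (𝕜 := ℝ), ha.inner_planeWave hb, Finset.sum_eq_single 1]
  · rw [charVal_apply_one, one_mul, ha.integral_planeWave_one_of_const fun i => by simp]
    positivity
  · intro τ _ hτ
    rw [ha.integral_planeWave_one hb (k := dominant p - dominant p ∘ τ)
      (fun hc => hτ (eq_one_of_dominant_comp h1 h2 hc)), mul_zero]
  · simp

theorem finite_setOf_quadraticForm_eq {q : ℝ} (hq : 0 < q) (lam : ℝ) :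
    {p : ℕ × ℕ | q * (p.1 ^ 2 + p.1 * p.2 + p.2 ^ 2 : ℕ) = lam}.Finite := by
  refine ((Set.finite_Iic ⌈lam / q⌉₊).prod (Set.finite_Iic ⌈lam / q⌉₊)).subset ?_
  rintro ⟨m, n⟩ h
  simp only [Set.mem_ofPred_eq] at h
  have h1 : ((m ^ 2 + m * n + n ^ 2 : ℕ) : ℝ) ≤ ⌈lam / q⌉₊ := by
    refine le_trans (le_of_eq ?_) (Nat.le_ceil _)
    rw [← h]
    field_simp
  have h2 : m ^ 2 + m * n + n ^ 2 ≤ ⌈lam / q⌉₊ := by exact_mod_cast h1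
  have hm : m ≤ m ^ 2 := Nat.le_self_pow two_ne_zero m
  have hn : n ≤ n ^ 2 := Nat.le_self_pow two_ne_zero n
  exact ⟨by simp; omega, by simp; omega⟩

theorem IsA2Frame.heatTrace_neumann (ha : IsA2Frame a q) (hb : Bornology.IsBounded (alcove a A))
    (hne : (alcove a A).Nonempty) (t : ℝ) :
    neumannHeatTrace (alcove a A) t = ∑' p : ℕ × ℕ,
      ENNReal.ofReal (Real.exp (-(q * t) * (p.1 ^ 2 + p.1 * p.2 + p.2 ^ 2 : ℕ))) := by
  rw [neumannHeatTrace, heatTrace_eq_tsum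
    (f := fun p => restrictL2 (alcove a A) (planeWave a A 1 (dominant p)))
    (ev := fun p => q * (p.1 ^ 2 + p.1 * p.2 + p.2 ^ 2 : ℕ))
    (fun p => ha.norm_freqVec_dominant_sq p ▸ ha.restrictL2_planeWave_mem_neumann hb _)
    (ha.restrictL2_planeWave_one_ne_zero hb hne) (fun p p' h => ha.inner_planeWave_dominant hb 1 h)
    (finite_setOf_quadraticForm_eq ha.pos) (ha.eq_zero_of_inner_neumann hb)]
  refine tsum_congr fun p => ?_
  congr 2
  ring

theorem IsA2Frame.heatTrace_dirichlet (ha : IsA2Frame a q) (hb : Bornology.IsBounded (alcove a A))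
    (hne : (alcove a A).Nonempty) (t : ℝ) :
    dirichletHeatTrace (alcove a A) t = ∑' p : ℕ × ℕ, ENNReal.ofReal (Real.exp
      (-(q * t) * ((p.1 + 1) ^ 2 + (p.1 + 1) * (p.2 + 1) + (p.2 + 1) ^ 2 : ℕ))) := by
  have hinj : Function.Injective fun p : ℕ × ℕ => (p.1 + 1, p.2 + 1) := by
    rintro ⟨m, n⟩ ⟨m', n'⟩ h
    simpa using h
  rw [dirichletHeatTrace, heatTrace_eq_tsum
    (f := fun p : ℕ × ℕ => restrictL2 (alcove a A)
      (planeWave a A Equiv.Perm.sign (dominant (p.1 + 1, p.2 + 1))))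
    (ev := fun p => q * ((p.1 + 1) ^ 2 + (p.1 + 1) * (p.2 + 1) + (p.2 + 1) ^ 2 : ℕ))
    (fun p => ha.norm_freqVec_dominant_sq (p.1 + 1, p.2 + 1) ▸
      ha.restrictL2_planeWave_mem_dirichlet hb _)
    (fun p => ha.restrictL2_planeWave_sign_ne_zero hb hne (Nat.succ_pos _) (Nat.succ_pos _))
    (fun p p' h => ha.inner_planeWave_dominant hb _ (hinj.ne h))
    (fun lam => (finite_setOf_quadraticForm_eq ha.pos lam).preimage hinj.injOn)
    (ha.eq_zero_of_inner_dirichlet hb)]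
  refine tsum_congr fun p => ?_
  congr 2
  ring

end orthogonality

/-! ### The equilateral triangle as an alcove -/

section triangle

variable {ℓ : ℝ} {A B C : Plane}

/-- The weights attached to an equilateral triangle of side length `ℓ` of which `u` and `v` are two
sides with a common starting point: multiples of the oriented sides. -/
noncomputable def sideFrame (ℓ : ℝ) (u v : Plane) : Fin 3 → Plane :=
  ![(4 * Real.pi / (3 * ℓ ^ 2)) • u, (4 * Real.pi / (3 * ℓ ^ 2)) • (v - u),
    (4 * Real.pi / (3 * ℓ ^ 2)) • (-v)]

theorem inner_sides (hAB : dist A B = ℓ) (hBC : dist B C = ℓ) (hCA : dist C A = ℓ) :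
    inner ℝ (B - A) (B - A) = ℓ ^ 2 ∧ inner ℝ (C - A) (C - A) = ℓ ^ 2 ∧
      inner ℝ (B - A) (C - A) = ℓ ^ 2 / 2 := by
  have h1 : inner ℝ (B - A) (B - A) = ℓ ^ 2 := by
    rw [real_inner_self_eq_norm_sq, ← dist_eq_norm, dist_comm, hAB]
  have h2 : inner ℝ (C - A) (C - A) = ℓ ^ 2 := by
    rw [real_inner_self_eq_norm_sq, ← dist_eq_norm, hCA]
  have h3 : inner ℝ ((B - A) - (C - A)) ((B - A) - (C - A)) = ℓ ^ 2 := by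
    rw [sub_sub_sub_cancel_right, real_inner_self_eq_norm_sq, ← dist_eq_norm, hBC]
  refine ⟨h1, h2, ?_⟩
  rw [real_inner_sub_sub_self, h1, h2] at h3
  linarith

theorem isA2Frame_sideFrame (hℓ : 0 < ℓ) {u v : Plane} (h1 : inner ℝ u u = ℓ ^ 2)
    (h2 : inner ℝ v v = ℓ ^ 2) (h3 : inner ℝ u v = ℓ ^ 2 / 2) :
    IsA2Frame (sideFrame ℓ u v) (16 * Real.pi ^ 2 / (9 * ℓ ^ 2)) := by
  have h3' : inner ℝ v u = ℓ ^ 2 / 2 := by rw [real_inner_comm, h3]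
  have hpi := Real.pi_pos
  refine ⟨by positivity, ?_, fun i => ?_, fun i j hij => ?_⟩
  · rw [Fin.sum_univ_three]
    simp only [sideFrame, Matrix.cons_val]
    module
  · fin_cases i <;>
      simp only [sideFrame, Fin.zero_eta, Fin.mk_one, Fin.reduceFinMk, Matrix.cons_val,
        real_inner_smul_left, real_inner_smul_right, inner_sub_left, inner_sub_right,
        inner_neg_left, inner_neg_right, h1, h2, h3, h3'] <;> field_simp <;> ring
  · fin_cases i <;> fin_cases j <;> first | exact absurd rfl hij | skip
    all_goals
      simp only [sideFrame, Fin.zero_eta, Fin.mk_one, Fin.reduceFinMk, Matrix.cons_val,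
        real_inner_smul_left, real_inner_smul_right, inner_sub_left, inner_sub_right,
        inner_neg_left, inner_neg_right, h1, h2, h3, h3']
      field_simp
      ring

theorem affineIndependent_of_dist_eq (hℓ : 0 < ℓ) (hAB : dist A B = ℓ) (hBC : dist B C = ℓ)
    (hCA : dist C A = ℓ) : AffineIndependent ℝ ![A, B, C] := by
  obtain ⟨h1, h2, h3⟩ := inner_sides hAB hBC hCA
  rw [affineIndependent_iff_not_collinear_set]
  intro h
  obtain ⟨v, hv⟩ := (collinear_iff_of_mem (p₀ := A) (by simp)).1 h
  obtain ⟨r, hr⟩ := hv B (by simp)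
  obtain ⟨s, hs⟩ := hv C (by simp)
  have hr' : B - A = r • v := by rw [hr]; simp
  have hs' : C - A = s • v := by rw [hs]; simp
  rw [hr', real_inner_smul_left, real_inner_smul_right] at h1
  rw [hs', real_inner_smul_left, real_inner_smul_right] at h2
  rw [hr', hs', real_inner_smul_left, real_inner_smul_right] at h3
  have h4 : (ℓ ^ 2 / 2) * (ℓ ^ 2 / 2) = ℓ ^ 2 * ℓ ^ 2 := by
    calc _ = (r * (r * inner ℝ v v)) * (s * (s * inner ℝ v v)) := by rw [← h3]; ring
      _ = _ := by rw [h1, h2]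
  have : 0 < ℓ ^ 2 * ℓ ^ 2 := by positivity
  linarith

/-- The affine functions that define the alcove are the barycentric coordinates of the triangle. -/
theorem openTriangle_eq_alcove (hℓ : 0 < ℓ) (hAB : dist A B = ℓ) (hBC : dist B C = ℓ)
    (hCA : dist C A = ℓ) : openTriangle A B C = alcove (sideFrame ℓ (B - A) (C - A)) A := by
  have hind := affineIndependent_of_dist_eq hℓ hAB hBC hCA
  obtain ⟨h1, h2, h3⟩ := inner_sides hAB hBC hCA
  let b : AffineBasis (Fin 3) ℝ Plane := ⟨![A, B, C], hind, by
    rw [hind.affineSpan_eq_top_iff_card_eq_finrank_add_one]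
    simp⟩
  have hrange : Set.range b = {A, B, C} := by
    change Set.range ![A, B, C] = _
    rw [Matrix.range_cons, Matrix.range_cons, Matrix.range_cons, Matrix.range_empty,
      Set.union_empty]
    rfl
  rw [openTriangle, ← hrange, b.interior_convexHull]
  have key : ∀ x j, alcoveConst (sideFrame ℓ (B - A) (C - A)) A j +
      inner ℝ (alcoveNormal (sideFrame ℓ (B - A) (C - A)) j) x = b.coord (j + 1) x := by
    intro x j
    have hsum : b.coord 0 x + b.coord 1 x + b.coord 2 x = 1 := by
      rw [← b.sum_coord_apply_eq_one x, Fin.sum_univ_three]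
    have hx : x - A = b.coord 1 x • (B - A) + b.coord 2 x • (C - A) := by
      have h := b.linear_combination_coord_eq_self x
      rw [Fin.sum_univ_three] at h
      change b.coord 0 x • A + b.coord 1 x • B + b.coord 2 x • C = x at h
      have h0 : b.coord 0 x = 1 - b.coord 1 x - b.coord 2 x := by linarith
      rw [h0] at h
      nth_rewrite 1 [← h]
      module
    have hpi := Real.pi_pos
    have ha := angles_sub_angles (a := sideFrame ℓ (B - A) (C - A)) (A := A) j x
    have ha' : alcoveConst (sideFrame ℓ (B - A) (C - A)) A j +
        inner ℝ (alcoveNormal (sideFrame ℓ (B - A) (C - A)) j) x =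
        (angles (sideFrame ℓ (B - A) (C - A)) A x j -
          angles (sideFrame ℓ (B - A) (C - A)) A x (j + 1)) / (2 * Real.pi) +
        ((![0, 0, 1] : Fin 3 → ℤ) j : ℝ) := by
      rw [ha]
      field_simp
      ring
    rw [ha']
    generalize B - A = u at *
    generalize C - A = v at *
    have h3' : inner ℝ v u = ℓ ^ 2 / 2 := by rw [real_inner_comm, h3]
    have hang : ∀ j : Fin 3, b.coord (j + 1) x =
        (![b.coord 1 x, b.coord 2 x, 1 - b.coord 1 x - b.coord 2 x] : Fin 3 → ℝ) j := by
      intro j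
      fin_cases j
      · rfl
      · rfl
      · change b.coord 0 x = 1 - b.coord 1 x - b.coord 2 x
        linarith
    rw [hang]
    simp only [angles, hx]
    generalize b.coord 1 x = y
    generalize b.coord 2 x = z
    fin_cases j <;>
      simp only [sideFrame, Fin.zero_eta, Fin.mk_one, Fin.reduceFinMk, Fin.reduceAdd, zero_add,
        Matrix.cons_val, real_inner_smul_left, real_inner_smul_right, inner_sub_left,
        inner_add_right, inner_neg_left, h1, h2, h3, h3'] <;> field_simp <;> norm_num <;> ring
  ext x
  constructor
  · intro hx j
    rw [key]
    exact hx (j + 1)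
  · intro hx i
    have := hx (i - 1)
    rwa [key, sub_add_cancel] at this

end triangle

/-! ### Theta series -/

/-- The term `exp (-s x)` of a theta series, as an extended nonnegative real. -/
noncomputable def expTerm (s x : ℝ) : ℝ≥0∞ := ENNReal.ofReal (Real.exp (-s * x))

theorem expTerm_add (s x y : ℝ) : expTerm s (x + y) = expTerm s x * expTerm s y := by
  rw [expTerm, expTerm, expTerm, ← ENNReal.ofReal_mul (Real.exp_pos _).le, ← Real.exp_add]
  congr 2
  ring

theorem expTerm_mul (s r x : ℝ) : expTerm (s * r) x = expTerm s (r * x) := by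
  rw [expTerm, expTerm]
  congr 2
  ring

theorem expTerm_zero (s : ℝ) : expTerm s 0 = 1 := by simp [expTerm]

/-- The theta series `∑ exp (-s n²)` over the integers. -/
noncomputable def thetaSum (s : ℝ) : ℝ≥0∞ := ∑' n : ℤ, expTerm s (n ^ 2)

/-- The shifted theta series `∑ exp (-s (n + 1/2)²)`. -/
noncomputable def thetaHalfSum (s : ℝ) : ℝ≥0∞ := ∑' n : ℤ, expTerm s ((n + 1 / 2) ^ 2)

theorem ENNReal.tsum_int (f : ℤ → ℝ≥0∞) :
    ∑' n : ℤ, f n = f 0 + ∑' n : ℕ, f (n + 1) + ∑' n : ℕ, f (-(n + 1)) := by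
  rw [tsum_of_nat_of_neg_add_one ENNReal.summable ENNReal.summable,
    tsum_eq_zero_add' ENNReal.summable]
  simp

theorem ENNReal.tsum_int_even_add_odd (f : ℤ → ℝ≥0∞) :
    ∑' n : ℤ, f n = ∑' n : ℤ, f (2 * n) + ∑' n : ℤ, f (2 * n + 1) := by
  have hbij : Function.Bijective (Sum.elim (fun n : ℤ => 2 * n) fun n : ℤ => 2 * n + 1) := by
    constructor
    · rintro (m | m) (n | n) h <;> simp at h ⊢ <;> omega
    · intro n
      rcases Int.even_or_odd' n with ⟨k, rfl | rfl⟩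
      · exact ⟨Sum.inl k, rfl⟩
      · exact ⟨Sum.inr k, rfl⟩
  rw [← (Equiv.ofBijective _ hbij).tsum_eq, Summable.tsum_sum ENNReal.summable ENNReal.summable]
  rfl

/-- Splitting a sum over pairs of natural numbers along the diagonal. -/
theorem ENNReal.tsum_prod_nat_diagonal (f : ℕ × ℕ → ℝ≥0∞) :
    ∑' p, f p = ∑' n, f (n, n) + (∑' p : ℕ × ℕ, f (p.1 + p.2 + 1, p.2) +
      ∑' p : ℕ × ℕ, f (p.1, p.1 + p.2 + 1)) := by
  have hbij : Function.Bijective (Sum.elim (fun n : ℕ => (n, n)) (Sum.elim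
      (fun p : ℕ × ℕ => (p.1 + p.2 + 1, p.2)) fun p : ℕ × ℕ => (p.1, p.1 + p.2 + 1))) := by
    constructor
    · rintro (m | ⟨m, m'⟩ | ⟨m, m'⟩) (n | ⟨n, n'⟩ | ⟨n, n'⟩) h <;> simp at h ⊢ <;> omega
    · rintro ⟨m, n⟩
      rcases lt_trichotomy m n with h | rfl | h
      · exact ⟨Sum.inr (Sum.inr (m, n - m - 1)), by simp; omega⟩
      · exact ⟨Sum.inl m, rfl⟩
      · exact ⟨Sum.inr (Sum.inl (m - n - 1, n)), by simp; omega⟩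
  rw [← (Equiv.ofBijective _ hbij).tsum_eq, Summable.tsum_sum ENNReal.summable ENNReal.summable,
    Summable.tsum_sum ENNReal.summable ENNReal.summable]
  rfl

theorem thetaSum_eq (s : ℝ) : thetaSum s = 1 + 2 * ∑' n : ℕ, expTerm s ((n + 1) ^ 2) := by
  rw [thetaSum, ENNReal.tsum_int, two_mul, ← add_assoc]
  congr 1
  · congr 1
    · simp [expTerm_zero]
    · simp
  · refine tsum_congr fun n => ?_
    congr 1
    push_cast
    ring

theorem thetaSum_div_four (s : ℝ) : thetaSum (s / 4) = thetaSum s + thetaHalfSum s := by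
  rw [thetaSum, ENNReal.tsum_int_even_add_odd]
  congr 1 <;>
  · refine tsum_congr fun n => ?_
    rw [expTerm, expTerm]
    congr 2
    push_cast
    ring

/-- The theta series of the hexagonal lattice. -/
noncomputable def hexSum (s : ℝ) : ℝ≥0∞ :=
  ∑' n : ℤ, ∑' m : ℤ, expTerm s (m ^ 2 + m * n + n ^ 2)

/-- The hexagonal lattice is the union of two translates of a rectangular lattice. -/
theorem hexSum_eq (s : ℝ) : hexSum s =
    thetaSum (s * 3) * thetaSum s + thetaHalfSum (s * 3) * thetaHalfSum s := by
  rw [hexSum, ENNReal.tsum_int_even_add_odd]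
  congr 1
  · rw [thetaSum, ← ENNReal.tsum_mul_right]
    refine tsum_congr fun n => ?_
    rw [thetaSum, ← ENNReal.tsum_mul_left, ← (Equiv.subRight n).tsum_eq]
    refine tsum_congr fun m => ?_
    rw [expTerm_mul, ← expTerm_add]
    congr 1
    simp only [Equiv.subRight_apply]
    push_cast
    ring
  · rw [thetaHalfSum, ← ENNReal.tsum_mul_right]
    refine tsum_congr fun n => ?_
    rw [thetaHalfSum, ← ENNReal.tsum_mul_left, ← (Equiv.subRight n).tsum_eq]
    refine tsum_congr fun m => ?_
    rw [expTerm_mul, ← expTerm_add]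
    congr 1
    simp only [Equiv.subRight_apply]
    push_cast
    ring

/-- The sum over the interior of a sector of opening `π / 3` of the hexagonal lattice. -/
noncomputable def sectorSum (s : ℝ) : ℝ≥0∞ := ∑' p : ℕ × ℕ, expTerm s
  ((p.1 + 1) ^ 2 + (p.1 + 1) * (p.2 + 1) + (p.2 + 1) ^ 2)

/-- The sum over the interior of a ray bounding a sector. -/
noncomputable def raySum (s : ℝ) : ℝ≥0∞ := ∑' n : ℕ, expTerm s ((n + 1) ^ 2)

/-- The sum over the interior of a sector of opening `2π / 3`, which splits into two sectors of
opening `π / 3` and a ray. -/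
theorem tsum_wide_sector (s : ℝ) : ∑' p : ℕ × ℕ, expTerm s
    ((p.1 + 1) ^ 2 - (p.1 + 1) * (p.2 + 1) + (p.2 + 1) ^ 2) = raySum s + 2 * sectorSum s := by
  rw [ENNReal.tsum_prod_nat_diagonal, two_mul]
  congr 1
  · refine tsum_congr fun n => ?_
    congr 1
    ring
  congr 1
  · refine tsum_congr fun p => ?_
    congr 1
    push_cast
    ring
  · refine tsum_congr fun p => ?_
    congr 1
    push_cast
    ring

/-- The hexagonal lattice is the union of six open sectors, six rays and the origin. -/
theorem hexSum_eq_sectors (s : ℝ) : hexSum s = 6 * sectorSum s + 6 * raySum s + 1 := by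
  have h1 : ∀ n : ℤ, ∑' m : ℤ, expTerm s (m ^ 2 + m * n + n ^ 2) = expTerm s (n ^ 2) +
      ∑' m : ℕ, expTerm s ((m + 1) ^ 2 + (m + 1) * n + n ^ 2) +
      ∑' m : ℕ, expTerm s ((m + 1) ^ 2 - (m + 1) * n + n ^ 2) := by
    intro n
    rw [ENNReal.tsum_int]
    congr 1
    · congr 1
      · simp
      · push_cast
        rfl
    · refine tsum_congr fun m => ?_
      congr 1
      push_cast
      ring
  rw [hexSum, ENNReal.tsum_int]
  simp_rw [h1]
  have e0 : expTerm s (((0 : ℤ) : ℝ) ^ 2) = 1 := by simp [expTerm_zero]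
  have e1 : ∑' m : ℕ, expTerm s (((m : ℝ) + 1) ^ 2 + (m + 1) * ((0 : ℤ) : ℝ) + ((0 : ℤ) : ℝ) ^ 2) =
      raySum s := tsum_congr fun m => by
    congr 1
    push_cast
    ring
  have e2 : ∑' m : ℕ, expTerm s (((m : ℝ) + 1) ^ 2 - (m + 1) * ((0 : ℤ) : ℝ) + ((0 : ℤ) : ℝ) ^ 2) =
      raySum s := tsum_congr fun m => by
    congr 1
    push_cast
    ring
  have e3 : ∑' n : ℕ, expTerm s ((((n : ℤ) + 1 : ℤ) : ℝ) ^ 2) = raySum s :=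
    tsum_congr fun m => by push_cast; rfl
  have e4 : ∑' n : ℕ, expTerm s (((-((n : ℤ) + 1) : ℤ) : ℝ) ^ 2) = raySum s :=
    tsum_congr fun m => by
      congr 1
      push_cast
      ring
  have e5 : ∑' (n : ℕ) (m : ℕ), expTerm s (((m : ℝ) + 1) ^ 2 + (m + 1) * (((n : ℤ) + 1 : ℤ) : ℝ) +
      (((n : ℤ) + 1 : ℤ) : ℝ) ^ 2) = sectorSum s := by
    rw [sectorSum, ← ENNReal.tsum_prod]
    refine tsum_congr fun p => ?_
    congr 1
    push_cast
    ring
  have e6 : ∑' (n : ℕ) (m : ℕ), expTerm s (((m : ℝ) + 1) ^ 2 - (m + 1) * (((n : ℤ) + 1 : ℤ) : ℝ) +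
      (((n : ℤ) + 1 : ℤ) : ℝ) ^ 2) = raySum s + 2 * sectorSum s := by
    rw [← tsum_wide_sector, ← ENNReal.tsum_prod]
    refine tsum_congr fun p => ?_
    congr 1
    push_cast
    ring
  have e7 : ∑' (n : ℕ) (m : ℕ), expTerm s (((m : ℝ) + 1) ^ 2 +
      (m + 1) * ((-((n : ℤ) + 1) : ℤ) : ℝ) + ((-((n : ℤ) + 1) : ℤ) : ℝ) ^ 2) =
      raySum s + 2 * sectorSum s := by
    rw [← tsum_wide_sector, ← ENNReal.tsum_prod]
    refine tsum_congr fun p => ?_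
    congr 1
    push_cast
    ring
  have e8 : ∑' (n : ℕ) (m : ℕ), expTerm s (((m : ℝ) + 1) ^ 2 -
      (m + 1) * ((-((n : ℤ) + 1) : ℤ) : ℝ) + ((-((n : ℤ) + 1) : ℤ) : ℝ) ^ 2) = sectorSum s := by
    rw [sectorSum, ← ENNReal.tsum_prod]
    refine tsum_congr fun p => ?_
    congr 1
    push_cast
    ring
  rw [e0, e1, e2, ENNReal.tsum_add, ENNReal.tsum_add, ENNReal.tsum_add, ENNReal.tsum_add, e3, e4,
    e5, e6, e7, e8]
  ring

theorem tsum_closed_sector (s : ℝ) : ∑' p : ℕ × ℕ, expTerm s (p.1 ^ 2 + p.1 * p.2 + p.2 ^ 2) =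
    sectorSum s + 2 * raySum s + 1 := by
  rw [ENNReal.tsum_prod (f := fun m n : ℕ => expTerm s (m ^ 2 + m * n + n ^ 2)),
    tsum_eq_zero_add' ENNReal.summable]
  have h1 : ∀ m : ℕ, ∑' n : ℕ, expTerm s (m ^ 2 + m * n + n ^ 2) = expTerm s (m ^ 2) +
      ∑' n : ℕ, expTerm s (m ^ 2 + m * (n + 1) + (n + 1) ^ 2) := by
    intro m
    rw [tsum_eq_zero_add' ENNReal.summable]
    congr 1
    · simp
    · push_cast
      rfl
  simp_rw [h1]
  rw [ENNReal.tsum_add]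
  have e1 : ∑' n : ℕ, expTerm s ((((0 : ℕ) : ℝ)) ^ 2 + ((0 : ℕ) : ℝ) * (n + 1) + (n + 1) ^ 2) =
      raySum s := tsum_congr fun n => by
    congr 1
    push_cast
    ring
  have e2 : expTerm s (((0 : ℕ) : ℝ) ^ 2) = 1 := by simp [expTerm_zero]
  have e3 : ∑' n : ℕ, expTerm s (((n + 1 : ℕ) : ℝ) ^ 2) = raySum s :=
    tsum_congr fun n => by push_cast; rfl
  have e4 : ∑' (m : ℕ) (n : ℕ), expTerm s (((m + 1 : ℕ) : ℝ) ^ 2 + ((m + 1 : ℕ) : ℝ) * (n + 1) +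
      ((n : ℝ) + 1) ^ 2) = sectorSum s := by
    rw [sectorSum, ← ENNReal.tsum_prod]
    refine tsum_congr fun p => ?_
    push_cast
    rfl
  rw [e1, e2, e3, e4]
  ring

/-- The theta series as a function of the nome: `1 + 2 ∑ y^{(n+1)²}`. -/
noncomputable def thetaNome (y : ℝ) : ℝ := 1 + 2 * ∑' n : ℕ, y ^ ((n + 1) ^ 2)

theorem summable_nome {y : ℝ} (h0 : 0 ≤ y) (h1 : y < 1) :
    Summable fun n : ℕ => y ^ ((n + 1) ^ 2) := by
  refine Summable.of_nonneg_of_le (fun n => by positivity) (fun n => ?_)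
    (summable_geometric_of_lt_one h0 h1)
  exact pow_le_pow_of_le_one h0 h1.le (by nlinarith)

theorem thetaSum_eq_ofReal {s : ℝ} (hs : 0 < s) :
    thetaSum s = ENNReal.ofReal (thetaNome (Real.exp (-s))) := by
  have hy : Real.exp (-s) < 1 := Real.exp_lt_one_iff.2 (by linarith)
  have h0 := (Real.exp_pos (-s)).le
  rw [thetaSum_eq, thetaNome, ENNReal.ofReal_add zero_le_one
    (mul_nonneg zero_le_two (tsum_nonneg fun n => by positivity)), ENNReal.ofReal_one,
    ENNReal.ofReal_mul zero_le_two, ENNReal.ofReal_tsum_of_nonneg (fun n => by positivity)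
    (summable_nome h0 hy)]
  congr 2
  · simp
  · refine tsum_congr fun n => ?_
    rw [expTerm, ← Real.exp_nat_mul]
    congr 2
    push_cast
    ring

theorem thetaNome_exp_eq_tsum {s : ℝ} (hs : 0 < s) :
    thetaNome (Real.exp (-s)) = ∑' n : ℤ, Real.exp (-s * n ^ 2) := by
  have hsum := summable_nome (Real.exp_pos (-s)).le (Real.exp_lt_one_iff.2 (by linarith))
  rw [thetaNome]
  have e : ∀ n : ℕ, Real.exp (-s) ^ ((n + 1) ^ 2) = Real.exp (-s * (n + 1) ^ 2) := by
    intro n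
    rw [← Real.exp_nat_mul]
    congr 1
    push_cast
    ring
  simp_rw [e] at hsum ⊢
  obtain ⟨f, hf⟩ : ∃ f : ℤ → ℝ, ∀ n, f n = Real.exp (-s * n ^ 2) := ⟨_, fun _ => rfl⟩
  have e1 : ∀ n : ℕ, Real.exp (-s * (n + 1) ^ 2) = f ((n + 1 : ℕ) : ℤ) := fun n => by
    rw [hf]
    push_cast
    rfl
  have e2 : ∀ n : ℕ, f (-((n : ℤ) + 1)) = f ((n + 1 : ℕ) : ℤ) := fun n => by
    rw [hf, hf]
    congr 1
    push_cast
    ring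
  have e3 : f ((0 : ℕ) : ℤ) = 1 := by simp [hf]
  simp_rw [e1] at hsum ⊢
  simp_rw [← hf]
  have hs1 : Summable fun n : ℕ => f n := (summable_nat_add_iff 1).1 hsum
  rw [tsum_of_nat_of_neg_add_one hs1 (by simp_rw [e2]; exact hsum), hs1.tsum_eq_zero_add, e3]
  simp_rw [e2]
  ring

/-- Jacobi's transformation of the theta function. -/
theorem thetaNome_exp_neg {s : ℝ} (hs : 0 < s) :
    thetaNome (Real.exp (-s)) = √(Real.pi / s) * thetaNome (Real.exp (-(Real.pi ^ 2 / s))) := by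
  have hpi := Real.pi_pos
  have h := Real.tsum_exp_neg_mul_int_sq (a := s / Real.pi) (by positivity)
  have e1 : -Real.pi * (s / Real.pi) = -s := by field_simp
  have e2 : -Real.pi / (s / Real.pi) = -(Real.pi ^ 2 / s) := by field_simp
  have e3 : 1 / (s / Real.pi) ^ (1 / 2 : ℝ) = √(Real.pi / s) := by
    rw [← Real.sqrt_eq_rpow, one_div, ← Real.sqrt_inv, inv_div]
  rw [e1, e2, e3] at h
  rw [thetaNome_exp_eq_tsum hs, thetaNome_exp_eq_tsum (by positivity)]
  exact h

/-- Truncation of the theta series after the term `2 y⁹`. -/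
theorem thetaNome_bound {y : ℝ} (h0 : 0 ≤ y) (h1 : y ≤ 1 / 2) :
    0 ≤ thetaNome y - (1 + 2 * y + 2 * y ^ 4 + 2 * y ^ 9) ∧
      thetaNome y - (1 + 2 * y + 2 * y ^ 4 + 2 * y ^ 9) ≤ 4 * y ^ 16 := by
  have hsum := summable_nome h0 (by linarith : y < 1)
  obtain ⟨f, hf⟩ : ∃ f : ℕ → ℝ, ∀ n, f n = y ^ ((n + 1) ^ 2) := ⟨_, fun _ => rfl⟩
  have hpos : ∀ n, 0 ≤ f n := fun n => by
    rw [hf]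
    exact pow_nonneg h0 _
  rw [thetaNome]
  simp_rw [← hf] at hsum ⊢
  have hs3 : Summable fun n : ℕ => f (n + 3) := (summable_nat_add_iff 3).2 hsum
  have h := hsum.sum_add_tsum_nat_add 3
  rw [Finset.sum_range_succ, Finset.sum_range_succ, Finset.sum_range_one, hf 0, hf 1, hf 2] at h
  norm_num only [zero_add] at h
  have e : 1 + 2 * ∑' n, f n - (1 + 2 * y + 2 * y ^ 4 + 2 * y ^ 9) = 2 * ∑' n : ℕ, f (n + 3) := by
    rw [← h]
    ring
  rw [e]
  have hg := summable_geometric_of_lt_one h0 (by linarith : y < 1)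
  have hle : ∑' n : ℕ, f (n + 3) ≤ ∑' n : ℕ, y ^ 16 * y ^ n := by
    refine hs3.tsum_le_tsum (fun n => ?_) (hg.mul_left _)
    rw [hf, ← pow_add]
    exact pow_le_pow_of_le_one h0 (by linarith) (by nlinarith)
  rw [tsum_mul_left, tsum_geometric_of_lt_one h0 (by linarith)] at hle
  have h2 : (1 - y)⁻¹ ≤ 2 := inv_le_of_inv_le₀ two_pos (by linarith)
  constructor
  · have : 0 ≤ ∑' n : ℕ, f (n + 3) := tsum_nonneg fun n => hpos _
    linarith
  · have : y ^ 16 * (1 - y)⁻¹ ≤ y ^ 16 * 2 := by gcongr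
    linarith

/-! ### Asymptotics -/

/-- The remainder of the theta series after the term `2 y⁹`, relative to `y¹²`. -/
theorem tendsto_thetaNome_remainder : Tendsto (fun y : ℝ =>
    (thetaNome y - (1 + 2 * y + 2 * y ^ 4 + 2 * y ^ 9)) / y ^ 12) (𝓝[>] 0) (𝓝 0) := by
  have hlim : Tendsto (fun y : ℝ => 4 * y ^ 4) (𝓝[>] 0) (𝓝 0) := by
    have h : Tendsto (fun y : ℝ => 4 * y ^ 4) (𝓝 0) (𝓝 (4 * 0 ^ 4)) :=
      (by fun_prop : Continuous fun y : ℝ => 4 * y ^ 4).tendsto 0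
    simpa using h.mono_left nhdsWithin_le_nhds
  have hev : ∀ᶠ y : ℝ in 𝓝[>] 0, 0 < y ∧ y ≤ 1 / 2 := by
    filter_upwards [Ioc_mem_nhdsGT (by norm_num : (0 : ℝ) < 1 / 2)] with y hy using hy
  refine tendsto_of_tendsto_of_tendsto_of_le_of_le' tendsto_const_nhds hlim ?_ ?_
  · filter_upwards [hev] with y hy
    have := (thetaNome_bound hy.1.le hy.2).1
    have := hy.1
    positivity
  · filter_upwards [hev] with y hy
    have h1 := (thetaNome_bound hy.1.le hy.2).2
    have h2 := hy.1
    rw [div_le_iff₀ (by positivity)]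
    linarith [(by ring : 4 * y ^ 4 * y ^ 12 = 4 * y ^ 16)]

theorem tendsto_pow_nhdsGT_zero {k : ℕ} (hk : k ≠ 0) :
    Tendsto (fun x : ℝ => x ^ k) (𝓝[>] 0) (𝓝[>] 0) := by
  refine tendsto_nhdsWithin_iff.2 ⟨?_, ?_⟩
  · have h : Tendsto (fun x : ℝ => x ^ k) (𝓝 0) (𝓝 (0 ^ k)) := (continuous_pow k).tendsto 0
    rw [zero_pow hk] at h
    exact h.mono_left nhdsWithin_le_nhds
  · filter_upwards [self_mem_nhdsWithin] with x hx using pow_pos (Set.mem_Ioi.1 hx) k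

/-- The nome expansion of the theta series with argument `x ^ k`, to precision `o(x ^ (12 k))`. -/
theorem tendsto_thetaNome_remainder_comp {k : ℕ} (hk : k ≠ 0) : Tendsto (fun x : ℝ =>
    (thetaNome (x ^ k) - (1 + 2 * x ^ k + 2 * (x ^ k) ^ 4 + 2 * (x ^ k) ^ 9)) / (x ^ k) ^ 12)
    (𝓝[>] 0) (𝓝 0) :=
  tendsto_thetaNome_remainder.comp (tendsto_pow_nhdsGT_zero hk)

theorem tendsto_theta_cube : Tendsto (fun x : ℝ => (thetaNome (x ^ 3) - (1 + 2 * x ^ 3)) / x ^ 12)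
    (𝓝[>] 0) (𝓝 2) := by
  have h1 := tendsto_thetaNome_remainder_comp (k := 3) (by norm_num)
  have hx : Tendsto (fun x : ℝ => x) (𝓝[>] 0) (𝓝 0) := tendsto_id.mono_left nhdsWithin_le_nhds
  have h : Tendsto (fun x : ℝ => 2 + 2 * x ^ 15 + x ^ 24 * ((thetaNome (x ^ 3) -
      (1 + 2 * x ^ 3 + 2 * (x ^ 3) ^ 4 + 2 * (x ^ 3) ^ 9)) / (x ^ 3) ^ 12)) (𝓝[>] 0)
      (𝓝 (2 + 2 * 0 ^ 15 + 0 ^ 24 * 0)) :=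
    (tendsto_const_nhds.add ((hx.pow 15).const_mul 2)).add ((hx.pow 24).mul h1)
  norm_num only [zero_pow, mul_zero, add_zero] at h
  refine h.congr' ?_
  filter_upwards [self_mem_nhdsWithin] with x hx
  have : x ≠ 0 := (Set.mem_Ioi.1 hx).ne'
  field_simp
  ring

/-- The dual theta series of the hexagonal lattice, up to a factor `2`. -/
noncomputable def hexNome (x : ℝ) : ℝ := thetaNome x * thetaNome (x ^ 3) +
  (2 * thetaNome (x ^ 4) - thetaNome x) * (2 * thetaNome (x ^ 12) - thetaNome (x ^ 3))

theorem tendsto_hexNome :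
    Tendsto (fun x : ℝ => (hexNome x - (2 + 12 * x ^ 4)) / x ^ 12) (𝓝[>] 0) (𝓝 12) := by
  have hx : Tendsto (fun x : ℝ => x) (𝓝[>] 0) (𝓝 0) := tendsto_id.mono_left nhdsWithin_le_nhds
  obtain ⟨A, hA⟩ : ∃ A : ℝ → ℝ, ∀ x, A x =
    (thetaNome x - (1 + 2 * x + 2 * x ^ 4 + 2 * x ^ 9)) / x ^ 12 := ⟨_, fun _ => rfl⟩
  obtain ⟨B, hB⟩ : ∃ B : ℝ → ℝ, ∀ x, B x =
    (thetaNome (x ^ 3) - (1 + 2 * x ^ 3 + 2 * (x ^ 3) ^ 4 + 2 * (x ^ 3) ^ 9)) / (x ^ 3) ^ 12 :=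
    ⟨_, fun _ => rfl⟩
  obtain ⟨C, hC⟩ : ∃ C : ℝ → ℝ, ∀ x, C x =
    (thetaNome (x ^ 4) - (1 + 2 * x ^ 4 + 2 * (x ^ 4) ^ 4 + 2 * (x ^ 4) ^ 9)) / (x ^ 4) ^ 12 :=
    ⟨_, fun _ => rfl⟩
  obtain ⟨D, hD⟩ : ∃ D : ℝ → ℝ, ∀ x, D x =
    (thetaNome (x ^ 12) - (1 + 2 * x ^ 12 + 2 * (x ^ 12) ^ 4 + 2 * (x ^ 12) ^ 9)) /
      (x ^ 12) ^ 12 := ⟨_, fun _ => rfl⟩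
  have lA : Tendsto A (𝓝[>] 0) (𝓝 0) :=
    tendsto_thetaNome_remainder.congr fun x => (hA x).symm
  have lB : Tendsto B (𝓝[>] 0) (𝓝 0) :=
    (tendsto_thetaNome_remainder_comp (by norm_num)).congr fun x => (hB x).symm
  have lC : Tendsto C (𝓝[>] 0) (𝓝 0) :=
    (tendsto_thetaNome_remainder_comp (by norm_num)).congr fun x => (hC x).symm
  have lD : Tendsto D (𝓝[>] 0) (𝓝 0) :=
    (tendsto_thetaNome_remainder_comp (by norm_num)).congr fun x => (hD x).symm
  -- The four series, written as polynomials plus `x ^ 12` times a quantity tending to zero.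
  have lb : Tendsto (fun x => 2 * x ^ 15 + x ^ 24 * B x) (𝓝[>] 0) (𝓝 0) := by
    simpa using ((hx.pow 15).const_mul 2).add ((hx.pow 24).mul lB)
  have lc : Tendsto (fun x => 2 * x ^ 4 + 2 * x ^ 24 + x ^ 36 * C x) (𝓝[>] 0) (𝓝 0) := by
    simpa using (((hx.pow 4).const_mul 2).add ((hx.pow 24).const_mul 2)).add ((hx.pow 36).mul lC)
  have ld : Tendsto (fun x => 2 * x ^ 36 + 2 * x ^ 96 + x ^ 132 * D x) (𝓝[>] 0) (𝓝 0) := by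
    simpa using (((hx.pow 36).const_mul 2).add ((hx.pow 96).const_mul 2)).add ((hx.pow 132).mul lD)
  obtain ⟨b, hb⟩ : ∃ b : ℝ → ℝ, ∀ x, b x = 2 * x ^ 15 + x ^ 24 * B x := ⟨_, fun _ => rfl⟩
  obtain ⟨c, hc⟩ : ∃ c : ℝ → ℝ, ∀ x, c x = 2 * x ^ 4 + 2 * x ^ 24 + x ^ 36 * C x :=
    ⟨_, fun _ => rfl⟩
  obtain ⟨d, hd⟩ : ∃ d : ℝ → ℝ, ∀ x, d x = 2 * x ^ 36 + 2 * x ^ 96 + x ^ 132 * D x :=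
    ⟨_, fun _ => rfl⟩
  simp_rw [← hb] at lb
  simp_rw [← hc] at lc
  simp_rw [← hd] at ld
  have key : ∀ x : ℝ, 0 < x → (hexNome x - (2 + 12 * x ^ 4)) / x ^ 12 = 12 + 8 * x ^ 4 +
      A x * (1 + 2 * x ^ 3 + 2 * x ^ 12 + x ^ 12 * b x) +
      (1 + 2 * x + 2 * x ^ 4 + 2 * x ^ 9) * b x +
      (2 * c x - A x) * (1 - 2 * x ^ 3 + 2 * x ^ 12 + x ^ 12 * (2 * d x - b x)) +
      (1 - 2 * x + 2 * x ^ 4 - 2 * x ^ 9) * (2 * d x - b x) := by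
    intro x hx
    have hx0 : x ≠ 0 := hx.ne'
    have t1 : thetaNome x = 1 + 2 * x + 2 * x ^ 4 + 2 * x ^ 9 + x ^ 12 * A x := by
      rw [hA]
      field_simp
      ring
    have t3 : thetaNome (x ^ 3) = 1 + 2 * x ^ 3 + 2 * x ^ 12 + x ^ 12 * b x := by
      rw [hb, hB]
      field_simp
      ring
    have t4 : thetaNome (x ^ 4) = 1 + 2 * x ^ 4 + x ^ 12 * c x := by
      rw [hc, hC]
      field_simp
      ring
    have t12 : thetaNome (x ^ 12) = 1 + 2 * x ^ 12 + x ^ 12 * d x := by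
      rw [hd, hD]
      field_simp
      ring
    rw [hexNome, t1, t3, t4, t12, div_eq_iff (by positivity)]
    ring
  have hcont : Tendsto (fun x : ℝ => 12 + 8 * x ^ 4 +
      A x * (1 + 2 * x ^ 3 + 2 * x ^ 12 + x ^ 12 * b x) +
      (1 + 2 * x + 2 * x ^ 4 + 2 * x ^ 9) * b x +
      (2 * c x - A x) * (1 - 2 * x ^ 3 + 2 * x ^ 12 + x ^ 12 * (2 * d x - b x)) +
      (1 - 2 * x + 2 * x ^ 4 - 2 * x ^ 9) * (2 * d x - b x)) (𝓝[>] 0) (𝓝 12) := by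
    have hp : Continuous fun v : ℝ × ℝ × ℝ × ℝ × ℝ => 12 + 8 * v.1 ^ 4 +
      v.2.1 * (1 + 2 * v.1 ^ 3 + 2 * v.1 ^ 12 + v.1 ^ 12 * v.2.2.1) +
      (1 + 2 * v.1 + 2 * v.1 ^ 4 + 2 * v.1 ^ 9) * v.2.2.1 +
      (2 * v.2.2.2.1 - v.2.1) * (1 - 2 * v.1 ^ 3 + 2 * v.1 ^ 12 +
        v.1 ^ 12 * (2 * v.2.2.2.2 - v.2.2.1)) +
      (1 - 2 * v.1 + 2 * v.1 ^ 4 - 2 * v.1 ^ 9) * (2 * v.2.2.2.2 - v.2.2.1) := by fun_prop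
    have h := (hp.tendsto (0, 0, 0, 0, 0)).comp
      (hx.prodMk_nhds (lA.prodMk_nhds (lb.prodMk_nhds (lc.prodMk_nhds ld))))
    simpa [Function.comp_def] using h
  refine hcont.congr' ?_
  filter_upwards [self_mem_nhdsWithin] with x hx using (key x hx).symm

/-- The factor `t⁻¹` does not matter for exponential rates. -/
theorem isSharpRemainder_of_tendsto {R k : ℝ → ℝ} {c κ : ℝ} (hc : 0 < c) (hκ : κ ≠ 0)
    (hR : ∀ t, 0 < t → R t = t⁻¹ * Real.exp (-c / t) * k t)
    (hk : Tendsto k (𝓝[>] 0) (𝓝 κ)) : IsSharpRemainder R c := by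
  have hR' : R =ᶠ[𝓝[>] 0] fun t => t⁻¹ * Real.exp (-c / t) * k t := by
    filter_upwards [self_mem_nhdsWithin] with t ht using hR t ht
  have h1 : R =O[𝓝[>] 0] (fun t => t⁻¹ * Real.exp (-c / t)) := by
    refine hR'.trans_isBigO ?_
    simpa using (isBigO_refl (fun t : ℝ => t⁻¹ * Real.exp (-c / t)) (𝓝[>] 0)).mul
      (hk.isBigO_one ℝ)
  have h2 : (fun t => t⁻¹ * Real.exp (-c / t)) =O[𝓝[>] 0] R := by
    have h3 : (fun t => t⁻¹ * Real.exp (-c / t)) =ᶠ[𝓝[>] 0] fun t => R t * (k t)⁻¹ := by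
      filter_upwards [hR', hk.eventually_ne hκ] with t ht hkt
      rw [ht]
      field_simp
    refine h3.trans_isBigO ?_
    simpa using (isBigO_refl R (𝓝[>] 0)).mul ((hk.inv₀ hκ).isBigO_one ℝ)
  refine ⟨h1, h2, ?_, ?_⟩
  · rintro b ⟨hb, hRb⟩
    by_contra! hcb
    have h3 : (fun t : ℝ => t⁻¹) =O[𝓝[>] 0] fun _ => (1 : ℝ) := by
      have h4 := (h2.trans hRb).mul (isBigO_refl (fun t : ℝ => Real.exp (b / t)) (𝓝[>] 0))
      refine IsBigO.trans ?_ (h4.trans (Eventually.isBigO ?_))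
      · refine IsBigO.of_bound 1 ?_
        filter_upwards [self_mem_nhdsWithin] with t ht
        have ht : 0 < t := ht
        rw [mul_assoc, ← Real.exp_add, norm_mul, one_mul, Real.norm_of_nonneg (Real.exp_pos _).le]
        refine le_mul_of_one_le_right (norm_nonneg _) (Real.one_le_exp ?_)
        rw [← add_div]
        exact div_nonneg (by linarith) ht.le
      · filter_upwards with t
        rw [← Real.exp_add, neg_div, neg_add_cancel, Real.exp_zero, norm_one]
    refine not_isBoundedUnder_of_tendsto_atTop
      (tendsto_norm_atTop_atTop.comp tendsto_inv_nhdsGT_zero) ?_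
    exact h3.isBoundedUnder_le
  · intro M hM
    refine le_of_forall_lt fun b hb => ?_
    obtain ⟨b', hb', hb'c⟩ := exists_between (max_lt hb hc)
    refine ((le_max_left _ _).trans_lt hb').trans_le (hM ⟨(le_max_right _ _).trans_lt hb', ?_⟩)
    refine h1.trans ?_
    have h3 : Tendsto (fun t : ℝ => t⁻¹ * Real.exp (-(c - b') * t⁻¹)) (𝓝[>] 0) (𝓝 0) := by
      have h := (tendsto_rpow_mul_exp_neg_mul_atTop_nhds_zero 1 (c - b') (by linarith)).comp
        (tendsto_inv_nhdsGT_zero (𝕜 := ℝ))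
      simpa [Function.comp_def] using h
    have h5 := (h3.isBigO_one ℝ).mul (isBigO_refl (fun t : ℝ => Real.exp (-b' / t)) (𝓝[>] 0))
    simp only [one_mul] at h5
    refine h5.congr_left fun t => ?_
    rw [mul_assoc, ← Real.exp_add]
    congr 2
    ring

/-- The sums over a sector and over a ray in terms of dual theta series. -/
theorem sectorSum_raySum_eq {s : ℝ} (hs : 0 < s) :
    sectorSum s ≠ ⊤ ∧ raySum s ≠ ⊤ ∧
    (sectorSum s).toReal = Real.pi / (√3 * s) / 6 * hexNome (Real.exp (-(Real.pi ^ 2 / (3 * s)))) -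
      √(Real.pi / s) / 2 * thetaNome (Real.exp (-(Real.pi ^ 2 / (3 * s))) ^ 3) + 1 / 3 ∧
    (raySum s).toReal =
      (√(Real.pi / s) * thetaNome (Real.exp (-(Real.pi ^ 2 / (3 * s))) ^ 3) - 1) / 2 := by
  have hpi := Real.pi_pos
  obtain ⟨x, hx⟩ : ∃ x, x = Real.exp (-(Real.pi ^ 2 / (3 * s))) := ⟨_, rfl⟩
  rw [← hx]
  have hT : ∀ r : ℝ, 0 < r → thetaSum r ≠ ⊤ ∧
      (thetaSum r).toReal = thetaNome (Real.exp (-r)) := by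
    intro r hr
    rw [thetaSum_eq_ofReal hr]
    refine ⟨ENNReal.ofReal_ne_top, ENNReal.toReal_ofReal ?_⟩
    exact add_nonneg zero_le_one (mul_nonneg zero_le_two (tsum_nonneg fun n => by positivity))
  have hH : ∀ r : ℝ, 0 < r → thetaHalfSum r ≠ ⊤ ∧
      (thetaHalfSum r).toReal = (thetaSum (r / 4)).toReal - (thetaSum r).toReal := by
    intro r hr
    have h4 := (hT (r / 4) (by positivity)).1
    have h : thetaHalfSum r ≠ ⊤ := by
      rw [thetaSum_div_four] at h4
      exact (ENNReal.add_ne_top.1 h4).2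
    refine ⟨h, ?_⟩
    rw [thetaSum_div_four, ENNReal.toReal_add (hT r hr).1 h]
    ring
  have hpow : ∀ k : ℕ, Real.exp (-(k * (Real.pi ^ 2 / (3 * s)))) = x ^ k := fun k => by
    rw [hx, ← Real.exp_nat_mul]
    congr 1
    ring
  have h3s : 0 < s * 3 := by positivity
  have t1 : (thetaSum s).toReal = √(Real.pi / s) * thetaNome (x ^ 3) := by
    rw [(hT s hs).2, thetaNome_exp_neg hs, ← hpow 3]
    congr 3
    push_cast
    field_simp
  have t2 : (thetaSum (s * 3)).toReal = √(Real.pi / (s * 3)) * thetaNome x := by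
    rw [(hT _ h3s).2, thetaNome_exp_neg h3s, hx, mul_comm s 3]
  have t3 : (thetaSum (s / 4)).toReal = 2 * √(Real.pi / s) * thetaNome (x ^ 12) := by
    rw [(hT _ (by positivity)).2, thetaNome_exp_neg (by positivity), ← hpow 12]
    have e : √(Real.pi / (s / 4)) = 2 * √(Real.pi / s) := by
      rw [show Real.pi / (s / 4) = 2 ^ 2 * (Real.pi / s) by field_simp; norm_num,
        Real.sqrt_mul (by positivity), Real.sqrt_sq zero_le_two]
    rw [e]
    congr 3
    push_cast
    field_simp
    norm_num
  have t4 : (thetaSum (s * 3 / 4)).toReal = 2 * √(Real.pi / (s * 3)) * thetaNome (x ^ 4) := by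
    rw [(hT _ (by positivity)).2, thetaNome_exp_neg (by positivity), ← hpow 4]
    have e : √(Real.pi / (s * 3 / 4)) = 2 * √(Real.pi / (s * 3)) := by
      rw [show Real.pi / (s * 3 / 4) = 2 ^ 2 * (Real.pi / (s * 3)) by field_simp; norm_num,
        Real.sqrt_mul (by positivity), Real.sqrt_sq zero_le_two]
    rw [e]
    congr 3
    push_cast
    field_simp
  have hsq : √(Real.pi / (s * 3)) * √(Real.pi / s) = Real.pi / (√3 * s) := by
    rw [Real.sqrt_div hpi.le, Real.sqrt_div hpi.le, Real.sqrt_mul hs.le, div_mul_div_comm,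
      Real.mul_self_sqrt hpi.le, mul_right_comm, Real.mul_self_sqrt hs.le, mul_comm s]
  have hhex : hexSum s ≠ ⊤ := by
    rw [hexSum_eq]
    exact ENNReal.add_ne_top.2 ⟨ENNReal.mul_ne_top (hT _ h3s).1 (hT _ hs).1,
      ENNReal.mul_ne_top (hH _ h3s).1 (hH _ hs).1⟩
  have hhexR : (hexSum s).toReal = Real.pi / (√3 * s) * hexNome x := by
    rw [hexSum_eq, ENNReal.toReal_add (ENNReal.mul_ne_top (hT _ h3s).1 (hT _ hs).1)
      (ENNReal.mul_ne_top (hH _ h3s).1 (hH _ hs).1), ENNReal.toReal_mul, ENNReal.toReal_mul,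
      (hH _ h3s).2, (hH _ hs).2, t1, t2, t3, t4, ← hsq, hexNome]
    ring
  have hray : raySum s ≠ ⊤ := by
    have h := (hT s hs).1
    rw [thetaSum_eq] at h
    intro h'
    refine h ?_
    change 1 + 2 * raySum s = ⊤
    rw [h']
    simp
  have hsec : sectorSum s ≠ ⊤ := by
    intro h'
    rw [hexSum_eq_sectors, h'] at hhex
    simp at hhex
  have hrayR : (raySum s).toReal = (√(Real.pi / s) * thetaNome (x ^ 3) - 1) / 2 := by
    have h : thetaSum s = 1 + 2 * raySum s := thetaSum_eq s
    rw [← t1, h, ENNReal.toReal_add ENNReal.one_ne_top (ENNReal.mul_ne_top (by simp) hray),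
      ENNReal.toReal_mul]
    simp
  refine ⟨hsec, hray, ?_, hrayR⟩
  have h6 : ∀ y : ℝ≥0∞, y ≠ ⊤ → 6 * y ≠ ⊤ := fun y hy => ENNReal.mul_ne_top (by simp) hy
  have h := hhexR
  rw [hexSum_eq_sectors, ENNReal.toReal_add (ENNReal.add_ne_top.2 ⟨h6 _ hsec, h6 _ hray⟩)
    ENNReal.one_ne_top, ENNReal.toReal_add (h6 _ hsec) (h6 _ hray), ENNReal.toReal_mul,
    ENNReal.toReal_mul, hrayR] at h
  simp only [ENNReal.toReal_ofNat, ENNReal.toReal_one] at h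
  linarith

theorem tendsto_exp_neg_div_nhdsGT {c : ℝ} (hc : 0 < c) :
    Tendsto (fun t : ℝ => Real.exp (-(c / t))) (𝓝[>] 0) (𝓝[>] 0) := by
  refine tendsto_nhdsWithin_iff.2 ⟨?_, Eventually.of_forall fun t => Real.exp_pos _⟩
  have h := Real.tendsto_exp_neg_atTop_nhds_zero.comp
    ((tendsto_inv_nhdsGT_zero (𝕜 := ℝ)).const_mul_atTop hc)
  simpa [Function.comp_def, div_eq_mul_inv] using h

/-- A function with the dual expansion of the heat traces has a sharp remainder. The sign `ε` is
that of the boundary term. -/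
theorem isSharpRemainder_of_eq {ℓ ε : ℝ} (hℓ : 0 < ℓ) {R : ℝ → ℝ}
    (hR : ∀ t, 0 < t → R t = ℓ ^ 2 * √3 / (32 * Real.pi * t) *
      (hexNome (Real.exp (-(3 * ℓ ^ 2 / 16 / t))) -
        (2 + 12 * Real.exp (-(3 * ℓ ^ 2 / 16 / t)) ^ 4)) +
      ε * (3 * ℓ / (8 * √(Real.pi * t))) * (thetaNome (Real.exp (-(3 * ℓ ^ 2 / 16 / t)) ^ 3) -
        (1 + 2 * Real.exp (-(3 * ℓ ^ 2 / 16 / t)) ^ 3))) :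
    IsSharpRemainder R (9 * ℓ ^ 2 / 4) := by
  have hpi := Real.pi_pos
  have hx := tendsto_exp_neg_div_nhdsGT (c := 3 * ℓ ^ 2 / 16) (by positivity)
  have l1 := tendsto_hexNome.comp hx
  have l2 := tendsto_theta_cube.comp hx
  have l3 : Tendsto (fun t : ℝ => √t) (𝓝[>] 0) (𝓝 0) := by
    have h := Real.continuous_sqrt.tendsto 0
    rw [Real.sqrt_zero] at h
    exact h.mono_left nhdsWithin_le_nhds
  have lim := (l1.const_mul (ℓ ^ 2 * √3 / (32 * Real.pi))).add
    ((l3.const_mul (ε * (3 * ℓ / (8 * √Real.pi)))).mul l2)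
  rw [mul_zero, zero_mul, add_zero] at lim
  refine isSharpRemainder_of_tendsto (by positivity) (by positivity) (fun t ht => ?_) lim
  have hexp : Real.exp (-(9 * ℓ ^ 2 / 4) / t) = Real.exp (-(3 * ℓ ^ 2 / 16 / t)) ^ 12 := by
    rw [← Real.exp_nat_mul]
    congr 1
    push_cast
    field_simp
    norm_num
  rw [hR t ht, hexp]
  simp only [Function.comp_apply]
  obtain ⟨x, hxd⟩ : ∃ x, x = Real.exp (-(3 * ℓ ^ 2 / 16 / t)) := ⟨_, rfl⟩
  have hx0 : x ≠ 0 := by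
    rw [hxd]
    exact (Real.exp_pos _).ne'
  rw [← hxd, Real.sqrt_mul hpi.le]
  have hst : √t ^ 2 = t := Real.sq_sqrt ht.le
  have hst0 : √t ≠ 0 := (Real.sqrt_pos.2 ht).ne'
  have hsp0 : √Real.pi ≠ 0 := (Real.sqrt_pos.2 hpi).ne'
  generalize √Real.pi = p at *
  obtain ⟨r, hr⟩ : ∃ r, r = √t := ⟨_, rfl⟩
  rw [← hr] at hst hst0 ⊢
  rw [← hst]
  field_simp

/-! ### The heat traces of the equilateral triangle -/

section heat

variable {ℓ : ℝ} {A B C : Plane}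

theorem heatTrace_equilateral (hℓ : 0 < ℓ) (hAB : dist A B = ℓ) (hBC : dist B C = ℓ)
    (hCA : dist C A = ℓ) (t : ℝ) :
    dirichletHeatTrace (openTriangle A B C) t =
      sectorSum (16 * Real.pi ^ 2 / (9 * ℓ ^ 2) * t) ∧
    neumannHeatTrace (openTriangle A B C) t =
      sectorSum (16 * Real.pi ^ 2 / (9 * ℓ ^ 2) * t) +
        2 * raySum (16 * Real.pi ^ 2 / (9 * ℓ ^ 2) * t) + 1 := by
  obtain ⟨h1, h2, h3⟩ := inner_sides hAB hBC hCA
  have hframe := isA2Frame_sideFrame hℓ h1 h2 h3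
  have hind := affineIndependent_of_dist_eq hℓ hAB hBC hCA
  have hb : Bornology.IsBounded (openTriangle A B C) :=
    ((Set.Finite.isCompact_convexHull ℝ (Set.toFinite {A, B, C})).isBounded).subset interior_subset
  have hne : (openTriangle A B C).Nonempty := by
    have hrange : Set.range ![A, B, C] = {A, B, C} := by
      rw [Matrix.range_cons, Matrix.range_cons, Matrix.range_cons, Matrix.range_empty,
        Set.union_empty]
      rfl
    rw [openTriangle, ← hrange, interior_convexHull_nonempty_iff_affineSpan_eq_top,
      hind.affineSpan_eq_top_iff_card_eq_finrank_add_one]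
    simp
  rw [openTriangle_eq_alcove hℓ hAB hBC hCA] at hb hne ⊢
  rw [hframe.heatTrace_dirichlet hb hne, hframe.heatTrace_neumann hb hne, ← tsum_closed_sector,
    sectorSum]
  constructor <;>
  · refine tsum_congr fun p => ?_
    rw [expTerm]
    push_cast
    rfl

/-- The dual expansion of the sums over a sector and a ray, in terms of the side length. -/
theorem sectorSum_raySum_equilateral (hℓ : 0 < ℓ) {t : ℝ} (ht : 0 < t) :
    (sectorSum (16 * Real.pi ^ 2 / (9 * ℓ ^ 2) * t)).toReal =
      ℓ ^ 2 * √3 / (32 * Real.pi * t) * hexNome (Real.exp (-(3 * ℓ ^ 2 / 16 / t))) -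
      3 * ℓ / (8 * √(Real.pi * t)) * thetaNome (Real.exp (-(3 * ℓ ^ 2 / 16 / t)) ^ 3) + 1 / 3 ∧
    (raySum (16 * Real.pi ^ 2 / (9 * ℓ ^ 2) * t)).toReal =
      3 * ℓ / (8 * √(Real.pi * t)) * thetaNome (Real.exp (-(3 * ℓ ^ 2 / 16 / t)) ^ 3) - 1 / 2 := by
  have hpi := Real.pi_pos
  obtain ⟨-, -, h1, h2⟩ := sectorSum_raySum_eq (s := 16 * Real.pi ^ 2 / (9 * ℓ ^ 2) * t)
    (by positivity)
  have e1 : Real.pi ^ 2 / (3 * (16 * Real.pi ^ 2 / (9 * ℓ ^ 2) * t)) = 3 * ℓ ^ 2 / 16 / t := by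
    field_simp
    norm_num
  have e2 : √(Real.pi / (16 * Real.pi ^ 2 / (9 * ℓ ^ 2) * t)) = 3 * ℓ / (4 * √(Real.pi * t)) := by
    have h : Real.pi / (16 * Real.pi ^ 2 / (9 * ℓ ^ 2) * t) =
        (3 * ℓ) ^ 2 / (4 ^ 2 * (Real.pi * t)) := by
      field_simp
      norm_num
    rw [h, Real.sqrt_div (by positivity), Real.sqrt_sq (by positivity),
      Real.sqrt_mul (by positivity), Real.sqrt_sq (by positivity)]
  have e3 : Real.pi / (√3 * (16 * Real.pi ^ 2 / (9 * ℓ ^ 2) * t)) / 6 =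
      ℓ ^ 2 * √3 / (32 * Real.pi * t) := by
    have h3 : √3 ^ 2 = 3 := Real.sq_sqrt (by norm_num)
    have h30 : √3 ≠ 0 := by positivity
    field_simp
    rw [h3]
    norm_num
  rw [e1, e2, e3] at h1
  rw [e1, e2] at h2
  have h0 : √(Real.pi * t) ≠ 0 := by positivity
  constructor
  · rw [h1]
    field_simp
    ring
  · rw [h2]
    field_simp
    ring

end heat

theorem mainTheorem2 (ℓ : ℝ) (hℓ : 0 < ℓ) (A B C : Plane)
    (hAB : dist A B = ℓ) (hBC : dist B C = ℓ) (hCA : dist C A = ℓ) :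
    (∀ t : ℝ, 0 < t → dirichletHeatTrace (openTriangle A B C) t ≠ ⊤ ∧
      neumannHeatTrace (openTriangle A B C) t ≠ ⊤) ∧
    IsSharpRemainder
      (fun t => (dirichletHeatTrace (openTriangle A B C) t).toReal - dirichletExpansion ℓ t)
      (9 * ℓ ^ 2 / 4) ∧
    IsSharpRemainder
      (fun t => (neumannHeatTrace (openTriangle A B C) t).toReal - neumannExpansion ℓ t)
      (9 * ℓ ^ 2 / 4) := by
  have hpi := Real.pi_pos
  have htrace := heatTrace_equilateral hℓ hAB hBC hCA
  have hfin : ∀ t : ℝ, 0 < t → sectorSum (16 * Real.pi ^ 2 / (9 * ℓ ^ 2) * t) ≠ ⊤ ∧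
      2 * raySum (16 * Real.pi ^ 2 / (9 * ℓ ^ 2) * t) ≠ ⊤ := fun t ht =>
    have h := sectorSum_raySum_eq (s := 16 * Real.pi ^ 2 / (9 * ℓ ^ 2) * t) (by positivity)
    ⟨h.1, ENNReal.mul_ne_top (by simp) h.2.1⟩
  -- The explicit exponentials are powers of `x = exp (-3 ℓ² / (16 t))`.
  have hexp3 : ∀ t : ℝ, 0 < t → Real.exp (-(9 * ℓ ^ 2) / (16 * t)) =
      Real.exp (-(3 * ℓ ^ 2 / 16 / t)) ^ 3 := fun t ht => by
    rw [← Real.exp_nat_mul]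
    congr 1
    push_cast
    field_simp
    norm_num
  have hexp4 : ∀ t : ℝ, 0 < t → Real.exp (-(3 * ℓ ^ 2) / (4 * t)) =
      Real.exp (-(3 * ℓ ^ 2 / 16 / t)) ^ 4 := fun t ht => by
    rw [← Real.exp_nat_mul]
    congr 1
    push_cast
    field_simp
    norm_num
  refine ⟨fun t ht => ?_, ?_, ?_⟩
  · rw [(htrace t).1, (htrace t).2]
    exact ⟨(hfin t ht).1, ENNReal.add_ne_top.2
      ⟨ENNReal.add_ne_top.2 (hfin t ht), ENNReal.one_ne_top⟩⟩
  · refine isSharpRemainder_of_eq hℓ (ε := -1) fun t ht => ?_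
    have hst : √(Real.pi * t) ≠ 0 := by positivity
    rw [(htrace t).1, (sectorSum_raySum_equilateral hℓ ht).1, dirichletExpansion, hexp3 t ht,
      hexp4 t ht]
    field_simp
    ring
  · refine isSharpRemainder_of_eq hℓ (ε := 1) fun t ht => ?_
    have hst : √(Real.pi * t) ≠ 0 := by positivity
    rw [(htrace t).2, ENNReal.toReal_add (ENNReal.add_ne_top.2 (hfin t ht)) ENNReal.one_ne_top,
      ENNReal.toReal_add (hfin t ht).1 (hfin t ht).2, ENNReal.toReal_mul,
      (sectorSum_raySum_equilateral hℓ ht).1, (sectorSum_raySum_equilateral hℓ ht).2,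
      neumannExpansion, hexp3 t ht, hexp4 t ht]
    simp only [ENNReal.toReal_ofNat, ENNReal.toReal_one]
    field_simp
    ring
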